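/- Consider two agents with state $x=(x_1,x_2)\in\mathbb R^2$ and quadratic payoffs $J_i(x)=\frac12x^{\mathrm T}A_ix+b_i^{\mathrm T}x+c_i$, $i\in\{1,2\}$, where $A_i=\begin{bmatrix}a^i_{11}&a^i_{12}\\a^i_{12}&a^i_{22}\end{bmatrix}$, $a^i_{ii}<0$ and $a^1_{11}a^2_{22}\ne a^1_{12}a^2_{12}$, and let $x^*$ be the (unique) Nash equilibrium. Let $0<\alpha_i^{\rm L}\le\alpha_i^{\rm H}$, and for a mode $k\in\mathcal K=\{\rm LL,HL,LH,HH\}$ let $\alpha_i^k$ be $\alpha_i^{\rm L}$ or $\alpha_i^{\rm H}$ according to the $i$-th letter of $k$, $$\mathbb A_k=\mathrm{diag}[\alpha_1^k,\alpha_2^k]\begin{bmatrix}a^1_{11}&a^1_{12}\\a^2_{12}&a^2_{22}\end{bmatrix},\qquad \dot J_i^k(x)=\nabla J_i(x)^{\mathrm T}\mathbb A_k(x-x^*),\qquad Q_2^k=A_2\mathbb A_k+\mathbb A_k^{\mathrm T}A_2 .$$ Let $\mathcal D_k$ be the set of $x$ with $\dot J_i^k(x)\le 0$ for each $i$ whose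 letter in $k$ is L, and $\dot J_i^k(x)\ge0$ for each $i$ whose letter is H. The loss-averse pseudo-gradient dynamics are $\dot x_i(t)=\alpha_i(t)\,\partial J_i(x(t))/\partial x_i$ with piecewise constant $\alpha_i(t)$ equal to $\alpha_i^{\rm L}$ if $\dot J_i(t^-)<0$ and to $\alpha_i^{\rm H}$ if $\dot J_i(t^-)>0$; an agent that reaches $\dot J_i=0$ switches to its other value (this rule is void at $x^*$), and the active mode $k$ is kept while the state is in the interior of $\mathcal D_k$. Assume that every $\mathbb A_k$ has a pair of (non-real) complex conjugate eigenvalues; then $a^1_{12}a^2_{12}<0$, and all trajectories rotate around $x^*$ counterclockwise if $a^1_{12}<0<a^2_{12}$ and clockwise if $a^1_{12}>0>a^2_{12}$. Assume further that $A_1x^*+b_1\ne0$, that $A_2x^*+b_2=0$, and that all the matrices $Q_2^k$, $k\in\mathcal K$, are sign-indefinite. Let $\hat{\mathcal D}_k$ be defined like $\mathcal D_k$, with $\dot J_1^k$ replaced by its linearization at $x^*$ (and $\dot J_2^k(x)=\frac12(x-x^*)^{\mathrm T}Q_2^k(x-x^*)$ unchanged). Let $\eta(\theta)=[\cos\theta,\sin\theta]^{\mathrm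 T}$. The effective domain $\tilde{\mathcal D}_k$ is the cone, with apex $x^*$, of the phases $\theta$ with the following property: going back from $\theta$ against the rotational direction, the point $x^*+\eta$ stays in $\hat{\mathcal D}_k$ until (and including) some phase at which it is in $\hat{\mathcal D}_k$ and in no other $\hat{\mathcal D}_j$. For all but finitely many phases $\theta$ modulo $2\pi$, the point $x^*+\eta(\theta)$ lies in exactly one $\tilde{\mathcal D}_k$; let $K(\theta)$ be this $k$, and for any $\theta_0\in\mathbb R$ put $$\rho_k(\theta)=\frac{\eta^{\mathrm T}(\theta)\mathbb A_k\eta(\theta)}{\det[\eta(\theta),\mathbb A_k\eta(\theta)]},\qquad \gamma_{\rm rg}=\int_{\theta_0}^{\theta_0+2\pi}\rho_{K(\theta)}(\theta)\,\mathrm d\theta .$$ If $a^1_{12}\gamma_{\rm rg}>0$ and $a^2_{12}\gamma_{\rm rg}<0$, then $x^*$ is (locally) asymptotically stable for the dynamics: it is Lyapunov stable, and every initial state in some neighbourhood of $x^*$ admits a trajectory for all $t\ge0$, and all such trajectories converge to $x^*$. If $a^1_{12}\gamma_{\rm rg}<0$ and $a^2_{12}\gamma_{\rm rg}>0$, then $x^*$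 is unstable (not Lyapunov stable). -/

import Mathlib

open Filter Topology Matrix

/-- The two sensitivity levels: `L` (payoff decreasing), `H` (payoff increasing). -/
inductive Level
  | L
  | H

/-- A mode gives the level of each of the two agents; agent 1 is `0` and agent 2 is `1`, so that
the mode `HL` is `![Level.H, Level.L]`. -/
abbrev Mode := Fin 2 → Level

/-- A two-agent noncooperative system with quadratic payoffs
`J i x = (1/2) xᵀ (A i) x + (b i)ᵀ x + c i`, together with the sensitivity parameters of its
loss-averse agents. The entry `a^i_{jl}` is `A i j l` (indices from `0`). -/
structure LossAverseGame where
  A : Fin 2 → Matrix (Fin 2) (Fin 2) ℝ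
  b : Fin 2 → Fin 2 → ℝ
  c : Fin 2 → ℝ
  symm : ∀ i, (A i)ᵀ = A i
  concave : ∀ i, A i i i < 0
  nondegenerate : A 0 0 0 * A 1 1 1 ≠ A 0 0 1 * A 1 0 1
  alphaL : Fin 2 → ℝ
  alphaH : Fin 2 → ℝ
  alphaL_pos : ∀ i, 0 < alphaL i
  alphaL_le_alphaH : ∀ i, alphaL i ≤ alphaH i

namespace LossAverseGame

noncomputable section

variable (G : LossAverseGame)

/-- The payoff function of agent `i`. -/
def payoff (i : Fin 2) (x : Fin 2 → ℝ) : ℝ :=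
  (1 / 2) * (x ⬝ᵥ (G.A i *ᵥ x)) + G.b i ⬝ᵥ x + G.c i

/-- Nash equilibrium: no agent gains by changing its own coordinate alone. -/
def IsNash (x : Fin 2 → ℝ) : Prop :=
  ∀ (i : Fin 2) (y : ℝ), G.payoff i (Function.update x i y) ≤ G.payoff i x

/-- The partial derivative of the payoff of agent `i` with respect to the `j`-th coordinate. -/
def dpayoff (i j : Fin 2) (x : Fin 2 → ℝ) : ℝ :=
  deriv (fun y : ℝ => G.payoff i (Function.update x j y)) (x j)

theorem dpayoff_eq (i j : Fin 2) (x : Fin 2 → ℝ) :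
    G.dpayoff i j x = (G.A i *ᵥ x + G.b i) j := by
  have hs : G.A i 1 0 = G.A i 0 1 := congrFun (congrFun (G.symm i) 0) 1
  have key : ∀ p q r y : ℝ, HasDerivAt (fun y : ℝ => p * y ^ 2 + q * y + r) (2 * p * y + q) y := by
    intro p q r y
    have h := (((hasDerivAt_id y).pow 2).const_mul p).add ((hasDerivAt_id y).const_mul q)
    have h2 := h.add_const r
    refine (h2.congr_deriv ?_)
    simp
    ring
  unfold dpayoff
  fin_cases j
  · have : (fun y : ℝ => G.payoff i (Function.update x 0 y)) =
        fun y : ℝ => (G.A i 0 0 / 2) * y ^ 2 + (G.A i 0 1 * x 1 + G.b i 0) * y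
          + (G.A i 1 1 / 2 * x 1 ^ 2 + G.b i 1 * x 1 + G.c i) := by
      funext y
      simp [payoff, dotProduct, mulVec, Fin.sum_univ_two, hs]
      ring
    simp only [Fin.zero_eta, this, (key _ _ _ _).deriv]
    simp [mulVec, dotProduct, Fin.sum_univ_two]
    ring
  · have : (fun y : ℝ => G.payoff i (Function.update x 1 y)) =
        fun y : ℝ => (G.A i 1 1 / 2) * y ^ 2 + (G.A i 0 1 * x 0 + G.b i 1) * y
          + (G.A i 0 0 / 2 * x 0 ^ 2 + G.b i 0 * x 0 + G.c i) := by
      funext y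
      simp [payoff, dotProduct, mulVec, Fin.sum_univ_two, hs]
      ring
    simp only [Fin.mk_one, this, (key _ _ _ _).deriv]
    simp [mulVec, dotProduct, Fin.sum_univ_two, hs]
    ring

/-- The sensitivity of agent `i` in mode `k`. -/
def alpha (k : Mode) (i : Fin 2) : ℝ :=
  match k i with
  | Level.L => G.alphaL i
  | Level.H => G.alphaH i

/-- The system matrix of mode `k`. -/
def sysMatrix (k : Mode) : Matrix (Fin 2) (Fin 2) ℝ :=
  Matrix.diagonal (G.alpha k) * !![G.A 0 0 0, G.A 0 0 1; G.A 1 0 1, G.A 1 1 1]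

/-- The pseudo-gradient vector field of mode `k`: every agent follows the partial derivative of
its own payoff with respect to its own coordinate, scaled by its sensitivity. -/
def field (k : Mode) (x : Fin 2 → ℝ) : Fin 2 → ℝ :=
  fun i => G.alpha k i * G.dpayoff i i x

/-- The rate of change of the payoff of agent `i` at the state `x` when mode `k` is active. -/
def rate (k : Mode) (i : Fin 2) (x : Fin 2 → ℝ) : ℝ :=
  ∑ j, G.dpayoff i j x * G.field k x j

end

end LossAverseGame

/-- The sign `v` is (weakly) compatible with the level. -/
def Level.Compatible : Level → ℝ → Prop
  | Level.L, v => v ≤ 0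
  | Level.H, v => 0 ≤ v

namespace LossAverseGame

noncomputable section

variable (G : LossAverseGame)

/-- The domain `D_k`, on which the payoff rates in mode `k` have the signs that mode `k` asks
for. -/
def domain (k : Mode) : Set (Fin 2 → ℝ) :=
  {x | ∀ i, (k i).Compatible (G.rate k i x)}

/-- `x` (state) and `K` (mode) form a trajectory of the loss-averse pseudo-gradient dynamics on
the time interval `I`, an interval of the form `[0, T)` or `[0, ∞)`. The mode is piecewise
constant: it has one-sided limits everywhere. Its value at an instant may differ from both
one-sided limits (one agent's switch may make the other agent switch right afterwards). -/
structure IsTrajectory (I : Set ℝ) (x : ℝ → Fin 2 → ℝ) (K : ℝ → Mode) : Prop where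
  continuousOn : ContinuousOn x I
  /-- The state follows the vector field of the mode that is active just after `t`. -/
  dynamics : ∀ t ∈ I, ∃ k : Mode, (∀ᶠ s in 𝓝[>] t, K s = k) ∧
    HasDerivWithinAt x (G.field k (x t)) (Set.Ici t) t
  /-- With `k` the mode just before `t`, the payoff rate at `t⁻` is `G.rate k i (x t)`: the agent
  has level `L` if it is negative and `H` if it is positive; an agent that reaches rate zero
  switches to its other level (this is void at the equilibrium, where all rates vanish
  identically in time). -/
  levels : ∀ t ∈ I, 0 < t → ∃ k : Mode, (∀ᶠ s in 𝓝[<] t, K s = k) ∧ ∀ i,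
    (G.rate k i (x t) < 0 → K t i = Level.L) ∧
    (0 < G.rate k i (x t) → K t i = Level.H) ∧
    (G.rate k i (x t) = 0 → ¬ G.IsNash (x t) → K t i ≠ k i)
  /-- In overlaps of domains, the active mode is kept as long as the state is in the interior of
  its domain. -/
  keep : ∀ t ∈ I, x t ∈ interior (G.domain (K t)) → ∀ᶠ s in 𝓝[>] t, K s = K t

/-- Lyapunov stability, for all trajectories on all intervals `[0, T)`. -/
def IsStable (xs : Fin 2 → ℝ) : Prop :=
  ∀ U ∈ 𝓝 xs, ∃ V ∈ 𝓝 xs, ∀ (T : ℝ) (x : ℝ → Fin 2 → ℝ) (K : ℝ → Mode), 0 < T →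
    G.IsTrajectory (Set.Ico 0 T) x K → x 0 ∈ V → ∀ t ∈ Set.Ico 0 T, x t ∈ U

/-- (Local) asymptotic stability: Lyapunov stability, and from all initial states in some
neighbourhood there are trajectories for all times, all of which converge to `xs`. -/
def IsAsymptoticallyStable (xs : Fin 2 → ℝ) : Prop :=
  G.IsStable xs ∧ ∃ V ∈ 𝓝 xs,
    (∀ x₀ ∈ V, ∃ x K, G.IsTrajectory (Set.Ici 0) x K ∧ x 0 = x₀) ∧
    ∀ x K, G.IsTrajectory (Set.Ici 0) x K → x 0 ∈ V → Tendsto x atTop (𝓝 xs)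

/-- Instability: Lyapunov stability fails. -/
def IsUnstable (xs : Fin 2 → ℝ) : Prop := ¬ G.IsStable xs

/-- Every system matrix has a pair of complex conjugate (non-real) eigenvalues. -/
def HasComplexEigenvalues : Prop :=
  ∀ k : Mode, ∃ μ : ℂ, μ.im ≠ 0 ∧
    Module.End.HasEigenvalue (Matrix.toLin' ((G.sysMatrix k).map Complex.ofReal)) μ ∧
    Module.End.HasEigenvalue (Matrix.toLin' ((G.sysMatrix k).map Complex.ofReal))
      (starRingEnd ℂ μ)

/-- The symmetric matrix `Q_i^k` of the quadratic part of the payoff rate of agent `i` in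
mode `k`. -/
def rateMatrix (k : Mode) (i : Fin 2) : Matrix (Fin 2) (Fin 2) ℝ :=
  G.A i * G.sysMatrix k + (G.sysMatrix k)ᵀ * G.A i

end

end LossAverseGame

/-- The quadratic form of `Q` takes a positive and a negative value. -/
def SignIndefinite (Q : Matrix (Fin 2) (Fin 2) ℝ) : Prop :=
  (∃ v, 0 < v ⬝ᵥ (Q *ᵥ v)) ∧ ∃ v, v ⬝ᵥ (Q *ᵥ v) < 0

/-- The unit vector of phase `θ`. -/
noncomputable def phaseVec (θ : ℝ) : Fin 2 → ℝ := ![Real.cos θ, Real.sin θ]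

namespace LossAverseGame

noncomputable section

variable (G : LossAverseGame)

/-- The approximated domain `D̂_k` around the equilibrium `xs` for the mixed case: the payoff rate
of agent 1 is replaced by its linearization at `xs`, the payoff rate of agent 2 (a quadratic form
in `x - xs`) is kept. -/
def approxDomain (xs : Fin 2 → ℝ) (k : Mode) : Set (Fin 2 → ℝ) :=
  {x | (k 0).Compatible (fderiv ℝ (G.rate k 0) xs (x - xs)) ∧
    (k 1).Compatible (G.rate k 1 x)}

open Classical in
/-- The rotational direction of the trajectories around the equilibrium: `1` (counterclockwise)
if `a^1_{12} < 0 < a^2_{12}`, and `-1` (clockwise) otherwise. -/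
def rotation : ℝ := if G.A 0 0 1 < 0 ∧ 0 < G.A 1 0 1 then 1 else -1

/-- The phases of the effective domain `D̃_k`: a state that rotates around `xs` was, at some earlier
(or the present) phase, in no approximated domain but that of `k`, and it has not left the
approximated domain of `k` since. -/
def effectivePhases (xs : Fin 2 → ℝ) (k : Mode) : Set ℝ :=
  {θ | ∃ s : ℝ, 0 ≤ s ∧
    (∀ j, j ≠ k → xs + phaseVec (θ - G.rotation * s) ∉ G.approxDomain xs j) ∧
    ∀ s' ∈ Set.Icc 0 s, xs + phaseVec (θ - G.rotation * s') ∈ G.approxDomain xs k}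

/-- The effective domain `D̃_k`. -/
def effectiveDomain (xs : Fin 2 → ℝ) (k : Mode) : Set (Fin 2 → ℝ) :=
  {x | ∃ r : ℝ, 0 ≤ r ∧ ∃ θ ∈ G.effectivePhases xs k, x = xs + r • phaseVec θ}

/-- The mode `K(θ)` that is active at phase `θ` (a choice is made at the finitely many switching
phases modulo `2π`, which belong to more than one effective domain). -/
def activeMode (xs : Fin 2 → ℝ) (θ : ℝ) : Mode :=
  @Classical.epsilon Mode ⟨fun _ => Level.L⟩
    (fun k => xs + phaseVec θ ∈ G.effectiveDomain xs k)

/-- The normalized radial growth rate `ρ_k(θ) = ηᵀ 𝔸_k η / det [η, 𝔸_k η]` with `η` the unit vector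
of phase `θ`. -/
def growthRate (k : Mode) (θ : ℝ) : ℝ :=
  (phaseVec θ ⬝ᵥ (G.sysMatrix k *ᵥ phaseVec θ)) /
    (Matrix.of ![phaseVec θ, G.sysMatrix k *ᵥ phaseVec θ])ᵀ.det

/-- The integral `γ_rg` of the normalized radial growth rate of the active mode over one turn. -/
def gammaRg (xs : Fin 2 → ℝ) (θ₀ : ℝ) : ℝ :=
  ∫ θ in θ₀..(θ₀ + 2 * Real.pi), G.growthRate (G.activeMode xs θ) θ

end

end LossAverseGame

/-! Write a state near the equilibrium in polar form, with radius `r` and phase `θ`. In mode `k`,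
`log r` has derivative `radial k θ` and `θ` has derivative `spin k (phaseVec θ)`; neither depends on
`r`. Non-real eigenvalues keep `rotation * spin` positive in all modes, and periodicity bounds it
below by a constant. If the active mode were `K(θ)` throughout, each turn would therefore change
`log r` by `rotation * γ_rg`. Since `rotation` has the sign of `a^2_{12}`, the two sign hypotheses
say that this change is negative, respectively positive. Two gaps separate this heuristic from a
proof.

The first gap is that the actual mode depends on the exact domains and on the past. Divided by `r`,
the exact rate of agent 1 tends to its linearization as `r → 0`, uniformly in the phase, and the
rate of agent 2 is homogeneous. Off the zeros of `barrier`, a null set, every phase is `Robust` for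
some mode `k`: it ends an arc strictly inside the approximated domain of `k`, and at the start of
the arc no other mode is possible (`exists_robust`). Strict inequalities survive for small `r`, so a
true trajectory must be in mode `k` at the start of the arc and cannot leave it before the end
(`rightMode_near_robust`). By compactness, after a transient the mode is `K(θ)` away from a small
neighbourhood of the switching phases. Near these phases the growth rate is replaced by an upper
bound. The mean of the resulting continuous function `smoothRate` still has the right sign, and
correcting `log r` by a periodic primitive gives linear decay or growth (`exists_radial_estimate`).

The second gap is the existence of trajectories, since switches might accumulate. Close to the
equilibrium every other state is `Nondeg`: one agent has a rate of fixed strict sign, and the other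
crosses zero transversally in a direction common to all modes. Hence at most one mode whose domain
contains a given state can be left there, so switches do not accumulate (`exists_leftMode`) and
bounded trajectories can be continued (`exists_trajectory_Ici`). Instability needs this as well:
without a trajectory that lives long enough to grow, Lyapunov stability could hold vacuously. -/

namespace Level

/-! ### Signs of levels -/

/-- The sign of a level. -/
def sgn : Level → ℝ
  | L => -1
  | H => 1

theorem compatible_iff (l : Level) (v : ℝ) : l.Compatible v ↔ 0 ≤ l.sgn * v := by
  cases l <;> simp [Compatible, sgn]

theorem sgn_ne_zero (l : Level) : l.sgn ≠ 0 := by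
  cases l <;> simp [sgn]

theorem eq_of_sgn_mul_pos {l l' : Level} {v : ℝ} (h : 0 < l.sgn * v) (h' : 0 ≤ l'.sgn * v) :
    l = l' := by
  cases l <;> cases l' <;> simp_all [sgn] <;> linarith

instance : Fintype Level := ⟨⟨{Level.L, Level.H}, by simp⟩, by intro l; cases l <;> simp⟩

end Level

/-! ### The payoff rates in coordinates around the equilibrium -/

namespace LossAverseGame

noncomputable section

variable (G : LossAverseGame)

theorem symm_apply (i : Fin 2) : G.A i 1 0 = G.A i 0 1 := congrFun (congrFun (G.symm i) 0) 1

theorem alpha_pos (k : Mode) (i : Fin 2) : 0 < G.alpha k i := by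
  unfold alpha
  cases k i
  · exact G.alphaL_pos i
  · exact (G.alphaL_pos i).trans_le (G.alphaL_le_alphaH i)

/-- The determinant of the unscaled system matrix. -/
def det0 : ℝ := G.A 0 0 0 * G.A 1 1 1 - G.A 0 0 1 * G.A 1 0 1

/-- The determinant of the Hessian of the payoff of agent 2. -/
def hessDet : ℝ := G.A 1 0 0 * G.A 1 1 1 - G.A 1 0 1 ^ 2

/-- The mixed coefficient of the payoff rate of agent 2 in the coordinates `grad0`, `grad1`. -/
def mixedCoeff : ℝ := G.A 0 0 0 * G.A 1 0 1 - G.A 0 0 1 * G.A 1 0 0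

/-- The own partial derivative of the payoff of agent 1, as a linear form. -/
def grad0 (y : Fin 2 → ℝ) : ℝ := G.A 0 0 0 * y 0 + G.A 0 0 1 * y 1

/-- The own partial derivative of the payoff of agent 2, as a linear form. -/
def grad1 (y : Fin 2 → ℝ) : ℝ := G.A 1 0 1 * y 0 + G.A 1 1 1 * y 1

/-- The derivative of the payoff of agent 1 at the equilibrium along the second coordinate. -/
def slope (xs : Fin 2 → ℝ) : ℝ := (G.A 0 *ᵥ xs + G.b 0) 1

/-- The mixed case in explicit form: `xs` is an equilibrium, critical for the payoff of agent 2
only, the system matrices have non-real eigenvalues, and the payoff rates of agent 2 are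
indefinite. -/
structure Mixed (xs : Fin 2 → ℝ) : Prop where
  nash0 : (G.A 0 *ᵥ xs + G.b 0) 0 = 0
  crit : G.A 1 *ᵥ xs + G.b 1 = 0
  slope_ne : G.slope xs ≠ 0
  disc : ∀ k, (G.alpha k 1 * G.A 1 1 1 - G.alpha k 0 * G.A 0 0 0) ^ 2
    + 4 * G.alpha k 0 * G.alpha k 1 * (G.A 0 0 1 * G.A 1 0 1) < 0
  indef : ∀ k, 4 * G.hessDet * (G.alpha k 1 * G.det0) < G.alpha k 0 * G.mixedCoeff ^ 2

theorem sysMatrix_mulVec (k : Mode) (y : Fin 2 → ℝ) :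
    G.sysMatrix k *ᵥ y = ![G.alpha k 0 * G.grad0 y, G.alpha k 1 * G.grad1 y] := by
  ext i
  fin_cases i <;>
    simp [sysMatrix, mulVec, dotProduct, Fin.sum_univ_two, Matrix.mul_apply, grad0, grad1,
      Matrix.diagonal] <;> ring

theorem field_eq (k : Mode) (x : Fin 2 → ℝ) (i : Fin 2) :
    G.field k x i = G.alpha k i * (G.A i *ᵥ x + G.b i) i := by
  simp only [field, dpayoff_eq]

/-- The derivative of the payoff rate of agent `i` along the vector field of mode `k`. -/
def drate (k : Mode) (i : Fin 2) (x : Fin 2 → ℝ) : ℝ :=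
  ∑ j, ((G.A i *ᵥ G.field k x) j * G.field k x j
    + (G.A i *ᵥ x + G.b i) j * (G.alpha k j * (G.A j *ᵥ G.field k x) j))

theorem rate_eq (k : Mode) (i : Fin 2) (x : Fin 2 → ℝ) :
    G.rate k i x = ∑ j, (G.A i *ᵥ x + G.b i) j * (G.alpha k j * (G.A j *ᵥ x + G.b j) j) := by
  simp only [rate, dpayoff_eq, field_eq]

theorem continuous_field (k : Mode) : Continuous (G.field k) := by
  have : G.field k = fun x i => G.alpha k i * (G.A i *ᵥ x + G.b i) i := by
    funext x i; exact G.field_eq k x i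
  rw [this]
  simp only [mulVec, dotProduct, Fin.sum_univ_two, Pi.add_apply]
  fun_prop

theorem continuous_rate (k : Mode) (i : Fin 2) : Continuous (G.rate k i) := by
  have : G.rate k i = fun x => ∑ j, (G.A i *ᵥ x + G.b i) j *
      (G.alpha k j * (G.A j *ᵥ x + G.b j) j) := by
    funext x; exact G.rate_eq k i x
  rw [this]
  simp only [mulVec, dotProduct, Fin.sum_univ_two, Pi.add_apply]
  fun_prop

theorem continuous_drate (k : Mode) (i : Fin 2) : Continuous (G.drate k i) := by
  have h := G.continuous_field k
  have h0 : Continuous fun x => G.field k x 0 := (continuous_apply 0).comp h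
  have h1 : Continuous fun x => G.field k x 1 := (continuous_apply 1).comp h
  unfold drate
  simp only [mulVec, dotProduct, Fin.sum_univ_two, Pi.add_apply]
  fun_prop

theorem hasDerivWithinAt_affine {x : ℝ → Fin 2 → ℝ} {f : Fin 2 → ℝ} {s : Set ℝ} {t : ℝ}
    (h : HasDerivWithinAt x f s t) (i j : Fin 2) :
    HasDerivWithinAt (fun t => (G.A i *ᵥ x t + G.b i) j) ((G.A i *ᵥ f) j) s t := by
  have h' := hasDerivWithinAt_pi.1 h
  simp only [mulVec, dotProduct, Fin.sum_univ_two, Pi.add_apply]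
  exact (((h' 0).const_mul _).add ((h' 1).const_mul _)).add_const _

theorem hasDerivWithinAt_rate {x : ℝ → Fin 2 → ℝ} {k : Mode} {s : Set ℝ} {t : ℝ}
    (h : HasDerivWithinAt x (G.field k (x t)) s t) (i : Fin 2) :
    HasDerivWithinAt (fun t => G.rate k i (x t)) (G.drate k i (x t)) s t := by
  have h1 := fun a b => G.hasDerivWithinAt_affine h a b
  have e : (fun t => G.rate k i (x t)) = fun t => ∑ j, (G.A i *ᵥ x t + G.b i) j *
      (G.alpha k j * (G.A j *ᵥ x t + G.b j) j) := by
    funext t; exact G.rate_eq k i (x t)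
  rw [e]
  refine (HasDerivWithinAt.fun_sum (u := Finset.univ) (fun j _ =>
    (h1 i j).mul ((h1 j j).const_mul (G.alpha k j)))).congr_deriv ?_
  simp only [drate, field_eq]

theorem IsNash.dpayoff_eq_zero {G : LossAverseGame} {x : Fin 2 → ℝ} (h : G.IsNash x) (i : Fin 2) :
    (G.A i *ᵥ x + G.b i) i = 0 := by
  rw [← dpayoff_eq, dpayoff]
  apply IsLocalMax.deriv_eq_zero
  apply Filter.Eventually.of_forall
  intro y
  simpa using h i y

variable {G} {xs : Fin 2 → ℝ}

theorem mul_neg_of_disc (h : ∀ k, (G.alpha k 1 * G.A 1 1 1 - G.alpha k 0 * G.A 0 0 0) ^ 2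
    + 4 * G.alpha k 0 * G.alpha k 1 * (G.A 0 0 1 * G.A 1 0 1) < 0) :
    G.A 0 0 1 * G.A 1 0 1 < 0 := by
  by_contra hc
  push Not at hc
  have h1 := h fun _ => Level.L
  have := G.alpha_pos (fun _ => Level.L) 0
  have := G.alpha_pos (fun _ => Level.L) 1
  have : 0 ≤ 4 * G.alpha (fun _ => Level.L) 0 * G.alpha (fun _ => Level.L) 1 *
    (G.A 0 0 1 * G.A 1 0 1) := by positivity
  nlinarith [sq_nonneg (G.alpha (fun _ => Level.L) 1 * G.A 1 1 1
    - G.alpha (fun _ => Level.L) 0 * G.A 0 0 0)]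

theorem det0_pos_of (h : G.A 0 0 1 * G.A 1 0 1 < 0) : 0 < G.det0 := by
  unfold det0
  have := mul_pos_of_neg_of_neg (G.concave 0) (G.concave 1)
  linarith

namespace Mixed

theorem mul_neg (h : G.Mixed xs) : G.A 0 0 1 * G.A 1 0 1 < 0 := mul_neg_of_disc h.disc

theorem det0_pos (h : G.Mixed xs) : 0 < G.det0 := det0_pos_of h.mul_neg

theorem crit_apply (h : G.Mixed xs) (i : Fin 2) : (G.A 1 *ᵥ xs + G.b 1) i = 0 := by
  rw [h.crit]; rfl

theorem own_grad (h : G.Mixed xs) (y : Fin 2 → ℝ) :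
    (G.A 0 *ᵥ (xs + y) + G.b 0) 0 = G.grad0 y ∧ (G.A 1 *ᵥ (xs + y) + G.b 1) 1 = G.grad1 y ∧
    (G.A 0 *ᵥ (xs + y) + G.b 0) 1 = G.slope xs + (G.A 0 0 1 * y 0 + G.A 0 1 1 * y 1) ∧
    (G.A 1 *ᵥ (xs + y) + G.b 1) 0 = G.A 1 0 0 * y 0 + G.A 1 0 1 * y 1 := by
  have h0 := h.nash0
  have h1 := h.crit_apply 0
  have h2 := h.crit_apply 1
  have e : G.slope xs = (G.A 0 *ᵥ xs + G.b 0) 1 := rfl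
  rw [e]
  simp only [mulVec, dotProduct, Fin.sum_univ_two, Pi.add_apply, grad0, grad1, symm_apply] at *
  refine ⟨?_, ?_, ?_, ?_⟩ <;> linarith

theorem field_add (h : G.Mixed xs) (k : Mode) (y : Fin 2 → ℝ) :
    G.field k (xs + y) = ![G.alpha k 0 * G.grad0 y, G.alpha k 1 * G.grad1 y] := by
  obtain ⟨h0, h1, -, -⟩ := h.own_grad y
  ext i
  fin_cases i
  · simp [field_eq, ← h0]
  · simp [field_eq, ← h1]

theorem rate_zero_add (h : G.Mixed xs) (k : Mode) (y : Fin 2 → ℝ) :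
    G.rate k 0 (xs + y) = G.alpha k 0 * G.grad0 y ^ 2 + G.alpha k 1 * G.grad1 y *
      (G.slope xs + (G.A 0 0 1 * y 0 + G.A 0 1 1 * y 1)) := by
  obtain ⟨h0, h1, h2, -⟩ := h.own_grad y
  rw [rate_eq, Fin.sum_univ_two, h0, h1, h2]
  ring

theorem rate_one_add (h : G.Mixed xs) (k : Mode) (y : Fin 2 → ℝ) :
    G.rate k 1 (xs + y) = G.alpha k 0 * G.grad0 y * (G.A 1 0 0 * y 0 + G.A 1 0 1 * y 1)
      + G.alpha k 1 * G.grad1 y ^ 2 := by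
  obtain ⟨h0, h1, -, h2⟩ := h.own_grad y
  rw [rate_eq, Fin.sum_univ_two, h0, h1, h2]
  ring

theorem drate_zero_add (h : G.Mixed xs) (k : Mode) (y : Fin 2 → ℝ) :
    G.drate k 0 (xs + y) =
      2 * G.alpha k 0 * G.grad0 y *
        (G.A 0 0 0 * (G.alpha k 0 * G.grad0 y) + G.A 0 0 1 * (G.alpha k 1 * G.grad1 y))
      + G.alpha k 1 *
        (G.A 1 0 1 * (G.alpha k 0 * G.grad0 y) + G.A 1 1 1 * (G.alpha k 1 * G.grad1 y)) *
        (G.slope xs + (G.A 0 0 1 * y 0 + G.A 0 1 1 * y 1))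
      + G.alpha k 1 * G.grad1 y *
        (G.A 0 0 1 * (G.alpha k 0 * G.grad0 y) + G.A 0 1 1 * (G.alpha k 1 * G.grad1 y)) := by
  obtain ⟨h0, h1, h2, -⟩ := h.own_grad y
  rw [drate, Fin.sum_univ_two, h.field_add, h0, h2]
  simp [mulVec, dotProduct, Fin.sum_univ_two, symm_apply]
  ring

theorem drate_one_add (h : G.Mixed xs) (k : Mode) (y : Fin 2 → ℝ) :
    G.drate k 1 (xs + y) =
      G.alpha k 0 * (G.A 0 0 0 * (G.alpha k 0 * G.grad0 y) + G.A 0 0 1 * (G.alpha k 1 * G.grad1 y))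
        * (G.A 1 0 0 * y 0 + G.A 1 0 1 * y 1)
      + G.alpha k 0 * G.grad0 y *
        (G.A 1 0 0 * (G.alpha k 0 * G.grad0 y) + G.A 1 0 1 * (G.alpha k 1 * G.grad1 y))
      + 2 * G.alpha k 1 * G.grad1 y *
        (G.A 1 0 1 * (G.alpha k 0 * G.grad0 y) + G.A 1 1 1 * (G.alpha k 1 * G.grad1 y)) := by
  obtain ⟨h0, h1, -, h2⟩ := h.own_grad y
  rw [drate, Fin.sum_univ_two, h.field_add, h1, h2]
  simp [mulVec, dotProduct, Fin.sum_univ_two, symm_apply]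
  ring

end Mixed

/-- A matrix with a non-real eigenvalue has negative discriminant. -/
theorem disc_neg_of_hasEigenvalue {M : Matrix (Fin 2) (Fin 2) ℝ} {μ : ℂ} (hμ : μ.im ≠ 0)
    (h : Module.End.HasEigenvalue (Matrix.toLin' (M.map Complex.ofReal)) μ) :
    (M 1 1 - M 0 0) ^ 2 + 4 * (M 0 1 * M 1 0) < 0 := by
  obtain ⟨v, hv⟩ := h.exists_hasEigenvector
  have h1 := hv.apply_eq_smul
  have h2 := hv.2
  have e0 := congrFun h1 0
  have e1 := congrFun h1 1
  simp [Matrix.toLin'_apply, mulVec, dotProduct, Fin.sum_univ_two] at e0 e1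
  have key : ((M 0 0 : ℂ) - μ) * (M 1 1 - μ) - M 0 1 * M 1 0 = 0 := by
    by_cases hv0 : v 0 = 0
    · have hv1 : v 1 ≠ 0 := by
        intro hv1
        apply h2
        ext i
        fin_cases i <;> simp [hv0, hv1]
      apply mul_right_cancel₀ hv1
      linear_combination ((M 0 0 : ℂ) - μ) * e1 - (M 1 0 : ℂ) * e0
    · apply mul_right_cancel₀ hv0
      linear_combination ((M 1 1 : ℂ) - μ) * e0 - (M 0 1 : ℂ) * e1
  have kr := congrArg Complex.re key
  have ki := congrArg Complex.im key
  simp at kr ki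
  have tr : M 0 0 + M 1 1 = 2 * μ.re := by
    apply mul_right_cancel₀ hμ
    linarith
  have : 0 < μ.im ^ 2 := by positivity
  have e : μ.re = (M 0 0 + M 1 1) / 2 := by linarith
  rw [e] at kr
  nlinarith

/-- In the coordinates `grad0`, `grad1` the rate of agent 2 is a binary quadratic form whose
coefficient at `grad1 ^ 2` is positive. It is therefore indefinite exactly when its discriminant is
positive, which is the field `indef` after division by `alpha k 0`. -/
theorem mixed_of (hG : G.HasComplexEigenvalues) (hxs : G.IsNash xs)
    (h1 : G.A 0 *ᵥ xs + G.b 0 ≠ 0) (h2 : G.A 1 *ᵥ xs + G.b 1 = 0)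
    (hQ : ∀ k : Mode, SignIndefinite (G.rateMatrix k 1)) : G.Mixed xs := by
  have disc : ∀ k, (G.alpha k 1 * G.A 1 1 1 - G.alpha k 0 * G.A 0 0 0) ^ 2
      + 4 * G.alpha k 0 * G.alpha k 1 * (G.A 0 0 1 * G.A 1 0 1) < 0 := by
    intro k
    obtain ⟨μ, hμ, h, -⟩ := hG k
    have := disc_neg_of_hasEigenvalue hμ h
    simp [sysMatrix, Matrix.mul_apply, Matrix.diagonal] at this
    nlinarith
  have h0 := hxs.dpayoff_eq_zero 0
  have hs : G.slope xs ≠ 0 := by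
    intro hs
    apply h1
    ext i
    fin_cases i
    · exact h0
    · exact hs
  have neg := mul_neg_of_disc disc
  refine ⟨h0, h2, hs, disc, fun k => ?_⟩
  -- A negative value suffices; positive values come for free from the coefficient at `grad1 ^ 2`.
  obtain ⟨-, y, hy⟩ := hQ k
  have hα := G.alpha_pos k 0
  have hβ := G.alpha_pos k 1
  have hD := det0_pos_of neg
  have key : G.det0 * (y ⬝ᵥ (G.rateMatrix k 1 *ᵥ y)) = 2 * (G.alpha k 0 *
      (G.hessDet * G.grad0 y ^ 2 + G.mixedCoeff * G.grad0 y * G.grad1 y)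
      + G.alpha k 1 * G.det0 * G.grad1 y ^ 2) := by
    simp [rateMatrix, sysMatrix, Matrix.mul_apply, Fin.sum_univ_two, Matrix.diagonal, mulVec,
      dotProduct, symm_apply, det0, hessDet, mixedCoeff, grad0, grad1]
    ring
  by_contra hc
  push Not at hc
  have h3 : G.det0 * (y ⬝ᵥ (G.rateMatrix k 1 *ᵥ y)) < 0 := mul_neg_of_pos_of_neg hD hy
  rw [key] at h3
  have h4 : 0 < G.alpha k 1 * G.det0 := by positivity
  have h5 : 0 ≤ (4 * G.hessDet * (G.alpha k 1 * G.det0) - G.alpha k 0 * G.mixedCoeff ^ 2) *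
    (G.alpha k 0 * G.grad0 y ^ 2) := mul_nonneg (by linarith) (by positivity)
  -- Completing the square: with a nonpositive discriminant the form would be nonnegative at `y`.
  nlinarith [sq_nonneg (2 * (G.alpha k 1 * G.det0) * G.grad1 y
    + G.alpha k 0 * G.mixedCoeff * G.grad0 y)]

end

end LossAverseGame

/-- States have only right derivatives at switching times, so all comparisons along trajectories go
through this form of monotonicity. -/
theorem le_of_right_deriv_nonneg {f f' : ℝ → ℝ} {a b : ℝ} (hab : a ≤ b)
    (hf : ContinuousOn f (Set.Icc a b))
    (hd : ∀ t ∈ Set.Ico a b, HasDerivWithinAt f (f' t) (Set.Ici t) t)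
    (h0 : ∀ t ∈ Set.Ico a b, 0 ≤ f' t) : f a ≤ f b := by
  have := image_le_of_deriv_right_le_deriv_boundary (f := fun t => - f t) (f' := fun t => - f' t)
    (B := fun _ => - f a) (B' := fun _ => 0) hf.neg (fun t ht => (hd t ht).neg) le_rfl
    continuousOn_const (fun t _ => hasDerivWithinAt_const _ _ _)
    (fun t ht => by simpa using h0 t ht) (Set.right_mem_Icc.2 hab)
  simpa using this

/-! ### Nondegenerate states and the modes possible at them -/

namespace LossAverseGame

noncomputable section

variable (G : LossAverseGame)

/-- The level of agent `j` enters its own payoff rate only through `alpha k j` times the square of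
its own partial derivative. Consequently, with the other level fixed, at least one of the two levels
is always compatible. -/
theorem rate_update_mono (k : Mode) (j : Fin 2) (x : Fin 2 → ℝ) :
    G.rate (Function.update k j Level.L) j x ≤ G.rate (Function.update k j Level.H) j x := by
  have hα := G.alphaL_le_alphaH j
  have key : ∀ p q : ℝ, p ≤ q → ∀ z, z * (p * z) ≤ z * (q * z) := by
    intro p q h z
    nlinarith [mul_le_mul_of_nonneg_right h (mul_self_nonneg z)]
  rw [rate_eq, rate_eq, Fin.sum_univ_two, Fin.sum_univ_two]
  fin_cases j
  · simpa [alpha] using key _ _ hα _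
  · simpa [alpha] using key _ _ hα _

/-- At `x` one agent has a payoff rate of the same strict sign in all modes, and the zeros of the
payoff rate of the other agent are crossed transversally, in the same direction in all modes. -/
def Nondeg (x : Fin 2 → ℝ) : Prop :=
  ∃ i j : Fin 2, i ≠ j ∧ ∃ s ε : ℝ, (∀ k, 0 < s * G.rate k i x) ∧
    ∀ k, G.rate k j x = 0 → 0 < ε * G.drate k j x

/-- The mode `k` cannot be left at `x`. -/
def Persistent (k : Mode) (x : Fin 2 → ℝ) : Prop :=
  ∀ i, G.rate k i x ≠ 0 ∨ 0 < (k i).sgn * G.drate k i x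

/-- The solution of mode `k` through `x` is inside the domain of `k` right afterwards. -/
def Ready (k : Mode) (x : Fin 2 → ℝ) : Prop :=
  ∀ i, 0 < (k i).sgn * G.rate k i x ∨ (G.rate k i x = 0 ∧ 0 < (k i).sgn * G.drate k i x)

variable {G}

theorem mem_domain_iff {k : Mode} {x : Fin 2 → ℝ} :
    x ∈ G.domain k ↔ ∀ i, 0 ≤ (k i).sgn * G.rate k i x := by
  simp [domain, Level.compatible_iff]

theorem mem_interior_domain {k : Mode} {x : Fin 2 → ℝ}
    (h : ∀ i, 0 < (k i).sgn * G.rate k i x) : x ∈ interior (G.domain k) := by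
  rw [mem_interior_iff_mem_nhds]
  have : ∀ i, ∀ᶠ y in 𝓝 x, 0 < (k i).sgn * G.rate k i y := fun i =>
    (((G.continuous_rate k i).const_mul (k i).sgn).tendsto x).eventually_const_lt (h i)
  filter_upwards [eventually_all.2 this] with y hy
  exact mem_domain_iff.2 fun i => (hy i).le

theorem Persistent.eventually {k : Mode} {x : Fin 2 → ℝ} (h : G.Persistent k x) :
    ∀ᶠ y in 𝓝 x, G.Persistent k y := by
  refine eventually_all.2 fun i => ?_
  rcases h i with h | h
  · filter_upwards [(G.continuous_rate k i).continuousAt.eventually_ne h] with y hy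
    exact Or.inl hy
  · filter_upwards [(((G.continuous_drate k i).const_mul
      (k i).sgn).tendsto x).eventually_const_lt h] with y hy
    exact Or.inr hy

theorem persistent_of_strict {k : Mode} {x : Fin 2 → ℝ}
    (h : ∀ i, 0 < (k i).sgn * G.rate k i x) : G.Persistent k x := fun i =>
  Or.inl fun h0 => by have := h i; simp [h0] at this

theorem Nondeg.drate_ne {x : Fin 2 → ℝ} (h : G.Nondeg x) (k : Mode) (i : Fin 2)
    (h0 : G.rate k i x = 0) : G.drate k i x ≠ 0 := by
  obtain ⟨a, b, hab, s, ε, hs, hε⟩ := h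
  have : i = b := by
    by_contra hib
    have : i = a := by omega
    subst this
    have := hs k
    simp [h0] at this
  subst this
  intro h1
  have := hε k h0
  simp [h1] at this

theorem exists_level_sgn_mul {s v : ℝ} (h : 0 < s * v) :
    ∃ l : Level, ∀ w, 0 < s * w → 0 < l.sgn * w := by
  rcases lt_trichotomy s 0 with hs | hs | hs
  · exact ⟨Level.L, fun w hw => by simp [Level.sgn]; nlinarith⟩
  · simp [hs] at h
  · exact ⟨Level.H, fun w hw => by simp [Level.sgn]; nlinarith⟩

/-- The agent with a rate of fixed sign has its level forced. For the other one, monotonicity in its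
level leaves a strictly compatible level or a common zero of both rates, and then the common
crossing direction picks the level. -/
theorem Nondeg.exists_ready {x : Fin 2 → ℝ} (h : G.Nondeg x) : ∃ k, G.Ready k x := by
  obtain ⟨a, b, hab, s, ε, hs, hε⟩ := h
  obtain ⟨l, hl⟩ := exists_level_sgn_mul (hs fun _ => Level.L)
  let m : Level → Mode := fun l' => Function.update (fun _ => l) b l'
  have ma : ∀ l', m l' a = l := fun l' => by simp [m, hab]
  have mb : ∀ l', m l' b = l' := fun l' => by simp [m]
  have mono : G.rate (m Level.L) b x ≤ G.rate (m Level.H) b x := G.rate_update_mono _ b x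
  have main : ∀ l', (0 < l'.sgn * G.rate (m l') b x ∨
      (G.rate (m l') b x = 0 ∧ 0 < l'.sgn * G.drate (m l') b x)) → G.Ready (m l') x := by
    intro l' h' i
    rcases eq_or_ne i b with rfl | hib
    · rwa [mb]
    · have : i = a := by omega
      subst this
      rw [ma]
      exact Or.inl (hl _ (hs _))
  by_cases hH : 0 < G.rate (m Level.H) b x
  · exact ⟨_, main Level.H (Or.inl (by simpa [Level.sgn] using hH))⟩
  by_cases hL : G.rate (m Level.L) b x < 0
  · exact ⟨_, main Level.L (Or.inl (by simpa [Level.sgn] using hL))⟩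
  -- The remaining case squeezes both rates: `0 ≤ rate L ≤ rate H ≤ 0`.
  have eH : G.rate (m Level.H) b x = 0 := by linarith
  have eL : G.rate (m Level.L) b x = 0 := by linarith
  have dH := hε _ eH
  have dL := hε _ eL
  rcases lt_or_ge 0 ε with h0 | h0
  · exact ⟨_, main Level.H (Or.inr ⟨eH, by simpa [Level.sgn] using pos_of_mul_pos_right dH h0.le⟩)⟩
  · refine ⟨_, main Level.L (Or.inr ⟨eL, ?_⟩)⟩
    simp only [Level.sgn]
    nlinarith

/-- Membership in the domain forces the level of the agent with fixed sign. A mode that can be left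
must give the other agent the level opposite to the crossing direction `ε`. Both levels are thus
determined, which is what rules out chattering between two modes. -/
theorem Nondeg.eq_of_not_persistent {x : Fin 2 → ℝ} (h : G.Nondeg x) {k k' : Mode}
    (hk : x ∈ G.domain k) (hk' : x ∈ G.domain k') (hp : ¬ G.Persistent k x)
    (hp' : ¬ G.Persistent k' x) : k = k' := by
  obtain ⟨a, b, hab, s, ε, hs, hε⟩ := h
  rw [mem_domain_iff] at hk hk'
  have main : ∀ k, ¬ G.Persistent k x → ¬ (0 < ε * (k b).sgn) := by
    intro k hp hb
    apply hp
    intro i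
    rcases eq_or_ne i b with rfl | hib
    · by_cases h0 : G.rate k i x = 0
      · right
        have := hε k h0
        rcases hkb : k i with _ | _ <;> simp only [hkb, Level.sgn] at hb ⊢ <;> nlinarith
      · exact Or.inl h0
    · have : i = a := by omega
      subst this
      exact Or.inl fun h0 => by have := hs k; simp [h0] at this
  by_cases hε0 : ε = 0
  · exfalso
    apply hp
    intro i
    rcases eq_or_ne i b with rfl | hib
    · exact Or.inl fun h0 => by have := hε k h0; simp [hε0] at this
    · have : i = a := by omega
      subst this
      exact Or.inl fun h0 => by have := hs k; simp [h0] at this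
  have h1 := main k hp
  have h2 := main k' hp'
  funext i
  rcases eq_or_ne i b with rfl | hib
  · rcases hkb : k i with _ | _ <;> rcases hkb' : k' i with _ | _ <;>
      simp only [hkb, hkb', Level.sgn] at h1 h2 ⊢ <;> exfalso <;> apply hε0 <;> linarith
  · have : i = a := by omega
    subst this
    obtain ⟨l, hl⟩ := exists_level_sgn_mul (hs fun _ => Level.L)
    rw [← Level.eq_of_sgn_mul_pos (hl _ (hs k)) (hk i),
      ← Level.eq_of_sgn_mul_pos (hl _ (hs k')) (hk' i)]

/-! ### How long a mode is kept along a trajectory -/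

/-- The mode just after `t` is `k`. -/
def RightMode (K : ℝ → Mode) (t : ℝ) (k : Mode) : Prop := ∀ᶠ s in 𝓝[>] t, K s = k

/-- The mode just before `t` is `k`. -/
def LeftMode (K : ℝ → Mode) (t : ℝ) (k : Mode) : Prop := ∀ᶠ s in 𝓝[<] t, K s = k

theorem RightMode.unique {K : ℝ → Mode} {t : ℝ} {k k' : Mode} (h : RightMode K t k)
    (h' : RightMode K t k') : k = k' := by
  obtain ⟨s, h1, h2⟩ := (h.and h').exists
  rw [← h1, h2]

theorem LeftMode.unique {K : ℝ → Mode} {t : ℝ} {k k' : Mode} (h : LeftMode K t k)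
    (h' : LeftMode K t k') : k = k' := by
  obtain ⟨s, h1, h2⟩ := (h.and h').exists
  rw [← h1, h2]

theorem rightMode_of_Ioo {K : ℝ → Mode} {a b t : ℝ} {k : Mode} (h : ∀ s ∈ Set.Ioo a b, K s = k)
    (ha : a ≤ t) (hb : t < b) : RightMode K t k := by
  filter_upwards [Ioo_mem_nhdsGT hb] with s hs
  exact h s ⟨ha.trans_lt hs.1, hs.2⟩

theorem leftMode_of_Ioo {K : ℝ → Mode} {a b t : ℝ} {k : Mode} (h : ∀ s ∈ Set.Ioo a b, K s = k)
    (ha : a < t) (hb : t ≤ b) : LeftMode K t k := by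
  filter_upwards [Ioo_mem_nhdsLT ha] with s hs
  exact h s ⟨hs.1, hs.2.trans_le hb⟩

theorem RightMode.exists_Ioo {K : ℝ → Mode} {t : ℝ} {k : Mode} (h : RightMode K t k) {T : ℝ}
    (hT : t < T) : ∃ b, t < b ∧ b ≤ T ∧ ∀ s ∈ Set.Ioo t b, K s = k := by
  obtain ⟨b, hb, hs⟩ := (mem_nhdsGT_iff_exists_Ioo_subset' hT).1 h
  refine ⟨min b T, lt_min hb hT, min_le_right _ _, fun s hs' => hs ⟨hs'.1, ?_⟩⟩
  exact hs'.2.trans_le (min_le_left _ _)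

theorem LeftMode.exists_Ioo {K : ℝ → Mode} {t : ℝ} {k : Mode} (h : LeftMode K t k) {T : ℝ}
    (hT : T < t) : ∃ b, b < t ∧ T ≤ b ∧ ∀ s ∈ Set.Ioo b t, K s = k := by
  obtain ⟨b, hb, hs⟩ := (mem_nhdsLT_iff_exists_Ioo_subset' hT).1 h
  refine ⟨max b T, max_lt hb hT, le_max_right _ _, fun s hs' => hs ⟨?_, hs'.2⟩⟩
  exact (le_max_left _ _).trans_lt hs'.1

namespace IsTrajectory

variable {x : ℝ → Fin 2 → ℝ} {K : ℝ → Mode} {T : ℝ}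

theorem exists_rightMode (h : G.IsTrajectory (Set.Ico 0 T) x K) {t : ℝ} (ht : t ∈ Set.Ico 0 T) :
    ∃ k, RightMode K t k := by
  obtain ⟨k, hk, -⟩ := h.dynamics t ht
  exact ⟨k, hk⟩

theorem hasDerivWithinAt (h : G.IsTrajectory (Set.Ico 0 T) x K) {t : ℝ} (ht : t ∈ Set.Ico 0 T)
    {k : Mode} (hk : RightMode K t k) :
    HasDerivWithinAt x (G.field k (x t)) (Set.Ici t) t := by
  obtain ⟨k', hk', hd⟩ := h.dynamics t ht
  rwa [hk.unique hk']

/-- Off the equilibrium a zero rate would make the agent switch, so inside an interval of constant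
mode only the strict signs remain. -/
theorem strict_of_Ioo (h : G.IsTrajectory (Set.Ico 0 T) x K)
    (hn : ∀ t ∈ Set.Ico 0 T, ¬ G.IsNash (x t)) {a b : ℝ} (ha : 0 ≤ a) (hb : b ≤ T) {k : Mode}
    (hk : ∀ s ∈ Set.Ioo a b, K s = k) {s : ℝ} (hs : s ∈ Set.Ioo a b) (i : Fin 2) :
    0 < (k i).sgn * G.rate k i (x s) := by
  have hsI : s ∈ Set.Ico 0 T := ⟨ha.trans hs.1.le, hs.2.trans_le hb⟩
  obtain ⟨k', hk', hl⟩ := h.levels s hsI (ha.trans_lt hs.1)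
  have : k' = k := LeftMode.unique hk' (leftMode_of_Ioo hk hs.1 hs.2.le)
  subst this
  obtain ⟨h1, h2, h3⟩ := hl i
  rw [hk s hs] at h1 h2 h3
  rcases lt_trichotomy (G.rate k' i (x s)) 0 with h0 | h0 | h0
  · rw [h1 h0]; simpa [Level.sgn] using h0
  · exact absurd rfl (h3 h0 (hn s hsI))
  · rw [h2 h0]; simpa [Level.sgn] using h0

theorem continuousWithinAt_rate (h : G.IsTrajectory (Set.Ico 0 T) x K) (k : Mode) (i : Fin 2) :
    ContinuousOn (fun t => (k i).sgn * G.rate k i (x t)) (Set.Ico 0 T) :=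
  continuousOn_const.mul ((G.continuous_rate k i).comp_continuousOn h.continuousOn)

theorem mem_domain_of_rightMode (h : G.IsTrajectory (Set.Ico 0 T) x K)
    (hn : ∀ t ∈ Set.Ico 0 T, ¬ G.IsNash (x t)) {t : ℝ} (ht : t ∈ Set.Ico 0 T)
    {k : Mode} (hk : RightMode K t k) : x t ∈ G.domain k := by
  rw [mem_domain_iff]
  intro i
  obtain ⟨b, hb, hbT, hs⟩ := hk.exists_Ioo ht.2
  have hc : Tendsto (fun t => (k i).sgn * G.rate k i (x t)) (𝓝[>] t)
      (𝓝 ((k i).sgn * G.rate k i (x t))) := by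
    apply (h.continuousWithinAt_rate k i t ht).mono_left
    rw [nhdsWithin_le_iff]
    filter_upwards [Ioo_mem_nhdsGT ht.2] with s hs
    exact ⟨ht.1.trans hs.1.le, hs.2⟩
  refine ge_of_tendsto hc ?_
  filter_upwards [Ioo_mem_nhdsGT hb] with s hs'
  exact (h.strict_of_Ioo hn ht.1 hbT hs hs' i).le

/-- In the mode before `t`, the payoff rate of agent `i` cannot reach zero at `t` while it moves
in the direction asked for by the mode. -/
theorem strict_at_right_end (h : G.IsTrajectory (Set.Ico 0 T) x K)
    (hn : ∀ t ∈ Set.Ico 0 T, ¬ G.IsNash (x t)) {a t : ℝ} (ha : 0 ≤ a) (hat : a < t) (ht : t < T)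
    {k : Mode} (hk : ∀ s ∈ Set.Ioo a t, K s = k) (i : Fin 2)
    (hp : G.rate k i (x t) ≠ 0 ∨ 0 < (k i).sgn * G.drate k i (x t)) :
    0 < (k i).sgn * G.rate k i (x t) := by
  have htI : t ∈ Set.Ico 0 T := ⟨ha.trans hat.le, ht⟩
  have hsub : ∀ s ∈ Set.Ioo a t, s ∈ Set.Ico 0 T := fun s hs => ⟨ha.trans hs.1.le, hs.2.trans ht⟩
  have hpos := fun s hs => h.strict_of_Ioo hn ha ht.le hk (s := s) hs i
  have hc : Tendsto x (𝓝[<] t) (𝓝 (x t)) := by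
    apply (h.continuousOn t htI).mono_left
    rw [nhdsWithin_le_iff]
    filter_upwards [Ioo_mem_nhdsLT hat] with s hs
    exact hsub s hs
  have hge : 0 ≤ (k i).sgn * G.rate k i (x t) := by
    have hc' : Tendsto (fun s => (k i).sgn * G.rate k i (x s)) (𝓝[<] t)
        (𝓝 ((k i).sgn * G.rate k i (x t))) :=
      (continuous_const.mul (G.continuous_rate k i)).continuousAt.tendsto.comp hc
    refine ge_of_tendsto hc' ?_
    filter_upwards [Ioo_mem_nhdsLT hat] with s hs
    exact (hpos s hs).le
  refine lt_of_le_of_ne hge ?_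
  intro h0
  have h0' : G.rate k i (x t) = 0 := by
    rcases mul_eq_zero.1 h0.symm with h1 | h1
    · exact absurd h1 (Level.sgn_ne_zero _)
    · exact h1
  have hd := hp.resolve_left (not_not.2 h0')
  have hc' : Tendsto (fun s => (k i).sgn * G.drate k i (x s)) (𝓝[<] t)
      (𝓝 ((k i).sgn * G.drate k i (x t))) :=
    (continuous_const.mul (G.continuous_drate k i)).continuousAt.tendsto.comp hc
  obtain ⟨c, hc1, hc2⟩ := (mem_nhdsLT_iff_exists_Ioo_subset' hat).1 (hc'.eventually_const_lt hd)
  obtain ⟨s, hs1, hs2⟩ := exists_between (max_lt hat hc1)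
  have hs : s ∈ Set.Ioo a t := ⟨(le_max_left _ _).trans_lt hs1, hs2⟩
  -- Just before `t` the signed rate is positive and nondecreasing, so it cannot vanish at `t`.
  have := le_of_right_deriv_nonneg (f := fun s => (k i).sgn * G.rate k i (x s))
    (f' := fun s => (k i).sgn * G.drate k i (x s)) hs2.le ?_ ?_ ?_
  · have := hpos s hs
    simp only [h0', mul_zero] at *
    linarith
  · exact (h.continuousWithinAt_rate k i).mono fun r hr =>
      ⟨ha.trans (hs.1.le.trans hr.1), hr.2.trans_lt ht⟩
  · intro r hr
    have hr' : r ∈ Set.Ioo a t := ⟨hs.1.trans_le hr.1, hr.2⟩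
    exact (hasDerivWithinAt_rate G (h.hasDerivWithinAt (hsub r hr')
      (rightMode_of_Ioo hk hr'.1.le hr'.2)) i).const_mul _
  · intro r hr
    exact le_of_lt (hc2 ⟨(le_max_right _ _).trans_lt (hs1.trans_le hr.1), hr.2⟩)

theorem eq_left_of_strict (h : G.IsTrajectory (Set.Ico 0 T) x K) {t : ℝ} (ht : t ∈ Set.Ico 0 T)
    (h0 : 0 < t) {k : Mode} (hk : LeftMode K t k) (hs : ∀ i, 0 < (k i).sgn * G.rate k i (x t)) :
    K t = k := by
  obtain ⟨k', hk', hl⟩ := h.levels t ht h0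
  have : k' = k := LeftMode.unique hk' hk
  subst this
  funext i
  have := hs i
  rcases hki : k' i with _ | _
  · exact (hl i).1 (by simpa [hki, Level.sgn] using this)
  · exact (hl i).2.1 (by simpa [hki, Level.sgn] using this)

/-- Persistence makes all signed rates strict at `t`. Then the level rule gives mode `k` at the
instant `t`, and `keep` carries it beyond because the state is interior to the domain. -/
theorem step (h : G.IsTrajectory (Set.Ico 0 T) x K)
    (hn : ∀ t ∈ Set.Ico 0 T, ¬ G.IsNash (x t)) {a t : ℝ} (ha : 0 ≤ a) (hat : a < t) (ht : t < T)
    {k : Mode} (hk : ∀ s ∈ Set.Ioo a t, K s = k) (hp : G.Persistent k (x t)) :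
    K t = k ∧ RightMode K t k := by
  have htI : t ∈ Set.Ico 0 T := ⟨ha.trans hat.le, ht⟩
  have hs := fun i => h.strict_at_right_end hn ha hat ht hk i (hp i)
  have e := h.eq_left_of_strict htI (ha.trans_lt hat) (leftMode_of_Ioo hk hat le_rfl) hs
  refine ⟨e, ?_⟩
  have := h.keep t htI (by rw [e]; exact mem_interior_domain hs)
  rwa [e] at this

/-- At the infimum of the times with another mode, `step` extends mode `k` a little further, a
contradiction. -/
theorem eqOn_of_persistent (h : G.IsTrajectory (Set.Ico 0 T) x K)
    (hn : ∀ t ∈ Set.Ico 0 T, ¬ G.IsNash (x t)) {a t : ℝ} (ha : 0 ≤ a) (ht : t < T)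
    {k : Mode} (hk : RightMode K a k) (hp : ∀ s ∈ Set.Ioc a t, G.Persistent k (x s)) :
    ∀ s ∈ Set.Ioc a t, K s = k := by
  by_contra hc
  push Not at hc
  let B := {s | s ∈ Set.Ioc a t ∧ K s ≠ k}
  have hB : B.Nonempty := hc
  have hbdd : BddBelow B := ⟨a, fun s hs => hs.1.1.le⟩
  obtain ⟨s0, hs0⟩ := hc
  obtain ⟨b, hab, hbt, hb⟩ := hk.exists_Ioo (hs0.1.1.trans_le (hs0.1.2.trans_lt ht).le)
  have hbB : b ≤ sInf B := by
    apply le_csInf hB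
    intro s hs
    by_contra hsb
    exact hs.2 (hb s ⟨hs.1.1, not_le.1 hsb⟩)
  have hτt : sInf B ≤ t := (csInf_le hbdd hs0).trans hs0.1.2
  have haτ : a < sInf B := hab.trans_le hbB
  have hleft : ∀ s ∈ Set.Ioo a (sInf B), K s = k := by
    intro s hs
    by_contra hsk
    exact absurd (csInf_le hbdd (show s ∈ B from ⟨⟨hs.1, hs.2.le.trans hτt⟩, hsk⟩)) (not_le.2 hs.2)
  obtain ⟨e, hr⟩ := h.step hn ha haτ (hτt.trans_lt ht) hleft (hp _ ⟨haτ, hτt⟩)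
  obtain ⟨c, hc1, -, hc⟩ := hr.exists_Ioo (hτt.trans_lt ht)
  obtain ⟨s, hsB, hsc⟩ := exists_lt_of_csInf_lt hB hc1
  rcases (csInf_le hbdd hsB).eq_or_lt with he | hlt
  · exact hsB.2 (he ▸ e)
  · exact hsB.2 (hc s ⟨hlt, hsc⟩)

theorem rightMode_of_persistent (h : G.IsTrajectory (Set.Ico 0 T) x K)
    (hn : ∀ t ∈ Set.Ico 0 T, ¬ G.IsNash (x t)) {a t : ℝ} (ha : 0 ≤ a) (hat : a ≤ t) (ht : t < T)
    {k : Mode} (hk : RightMode K a k) (hp : ∀ s ∈ Set.Ioc a t, G.Persistent k (x s)) :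
    RightMode K t k := by
  rcases hat.eq_or_lt with rfl | hat
  · exact hk
  · have := h.eqOn_of_persistent hn ha ht hk hp
    exact (h.step hn ha hat ht (fun s hs => this s ⟨hs.1, hs.2.le⟩) (hp t ⟨hat, le_rfl⟩)).2

/-- A trajectory whose mode is `k` just before and just after `t` has mode `k` at `t`. -/
theorem eq_of_left_right (h : G.IsTrajectory (Set.Ico 0 T) x K)
    (hn : ∀ t ∈ Set.Ico 0 T, ¬ G.IsNash (x t)) {a b t : ℝ} (ha : 0 ≤ a) (hat : a < t) (htb : t < b)
    (hb : b ≤ T) {k : Mode} (hl : ∀ s ∈ Set.Ioo a t, K s = k) (hr : ∀ s ∈ Set.Ioo t b, K s = k)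
    (hx : G.Nondeg (x t)) : K t = k := by
  have htI : t ∈ Set.Ico 0 T := ⟨ha.trans hat.le, htb.trans_le hb⟩
  refine h.eq_left_of_strict htI (ha.trans_lt hat) (leftMode_of_Ioo hl hat le_rfl) fun i => ?_
  refine h.strict_at_right_end hn ha hat htI.2 hl i ?_
  -- Otherwise the rate vanishes at `t` with a derivative pointing strictly out of the domain. The
  -- mode right after `t` is still `k`, so the rate would get the wrong sign there.
  by_contra hc
  push Not at hc
  obtain ⟨h0, h1⟩ := hc
  have hd : (k i).sgn * G.drate k i (x t) < 0 :=
    lt_of_le_of_ne h1 (mul_ne_zero (Level.sgn_ne_zero _) (hx.drate_ne k i h0))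
  have hder := (hasDerivWithinAt_rate G (h.hasDerivWithinAt htI
    (rightMode_of_Ioo hr le_rfl htb)) i).const_mul (k i).sgn
  have hev := (hasDerivWithinAt_iff_tendsto_slope' (s := Set.Ioi t) (by simp)).1
    (hder.mono Set.Ioi_subset_Ici_self)
  obtain ⟨s, hs, hs'⟩ := ((hev.eventually_lt_const hd).and (Ioo_mem_nhdsGT htb)).exists
  have hpos := h.strict_of_Ioo hn htI.1 hb hr hs' i
  rw [slope_def_field, h0, mul_zero, sub_zero] at hs
  have : 0 < (k i).sgn * G.rate k i (x s) / (s - t) := div_pos hpos (sub_pos.2 hs'.1)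
  linarith

/-- The mode has a limit at the end of a trajectory that approaches a nondegenerate state. -/
theorem exists_leftMode (h : G.IsTrajectory (Set.Ico 0 T) x K)
    (hn : ∀ t ∈ Set.Ico 0 T, ¬ G.IsNash (x t)) (hT : 0 < T)
    (hx : ∀ t ∈ Set.Ico 0 T, G.Nondeg (x t)) {z : Fin 2 → ℝ} (hz : G.Nondeg z)
    (hlim : Tendsto x (𝓝[<] T) (𝓝 z)) : ∃ k, LeftMode K T k := by
  have hI : ∀ᶠ s in 𝓝[<] T, s ∈ Set.Ico 0 T := by
    filter_upwards [Ioo_mem_nhdsLT hT] with s hs using ⟨hs.1.le, hs.2⟩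
  -- If a mode that cannot be left near `z` recurs, it stays until `T`. Otherwise every mode that
  -- occurs close to `T` can be left at `z` and has `z` in its domain, and there is only one such
  -- mode.
  by_cases hA : ∃ k, G.Persistent k z ∧ ∃ᶠ s in 𝓝[<] T, RightMode K s k
  · obtain ⟨k, hkz, hfr⟩ := hA
    obtain ⟨a, haT, ha⟩ := (mem_nhdsLT_iff_exists_Ioo_subset' hT).1 (hlim.eventually hkz.eventually)
    have : ∃ᶠ s in 𝓝[<] T, RightMode K s k ∧ s ∈ Set.Ioo (max a 0) T :=
      hfr.and_eventually (Ioo_mem_nhdsLT (max_lt haT hT))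
    obtain ⟨s, hs, hs'⟩ := this.exists
    refine ⟨k, leftMode_of_Ioo (a := s) (b := T) ?_ hs'.2 le_rfl⟩
    intro r hr
    refine h.eqOn_of_persistent hn ((le_max_right a 0).trans hs'.1.le) hr.2 hs ?_ r ⟨hr.1, le_rfl⟩
    intro q hq
    exact ha ⟨((le_max_left a 0).trans_lt hs'.1).trans hq.1, hq.2.trans_lt hr.2⟩
  · push Not at hA
    have h1 : ∀ k, ∀ᶠ s in 𝓝[<] T, RightMode K s k → ¬ G.Persistent k z ∧ z ∈ G.domain k := by
      intro k
      by_cases hp : G.Persistent k z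
      · filter_upwards [hA k hp] with s hs hs' using absurd hs' hs
      · by_cases hd : z ∈ G.domain k
        · exact Eventually.of_forall fun s _ => ⟨hp, hd⟩
        · have hd' := hd
          rw [mem_domain_iff] at hd'
          push Not at hd'
          obtain ⟨i, hi⟩ := hd'
          have : ∀ᶠ s in 𝓝[<] T, (k i).sgn * G.rate k i (x s) < 0 :=
            ((continuous_const.mul (G.continuous_rate k i)).continuousAt.tendsto.comp
              hlim).eventually_lt_const hi
          filter_upwards [this, hI] with s hs hsI hsk
          exact absurd (mem_domain_iff.1 (h.mem_domain_of_rightMode hn hsI hsk) i) (not_le.2 hs)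
    obtain ⟨a, haT, ha⟩ := (mem_nhdsLT_iff_exists_Ioo_subset' hT).1 ((eventually_all.2 h1).and hI)
    obtain ⟨s0, hs0⟩ := Set.nonempty_Ioo.2 (Set.mem_Iio.1 haT)
    obtain ⟨k, hk⟩ := h.exists_rightMode (ha hs0).2
    have hall : ∀ s ∈ Set.Ioo a T, RightMode K s k := by
      intro s hs
      obtain ⟨k', hk'⟩ := h.exists_rightMode (ha hs).2
      have e1 := (ha hs).1 k' hk'
      have e2 := (ha hs0).1 k hk
      rwa [hz.eq_of_not_persistent e2.2 e1.2 e2.1 e1.1]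
    -- So far only the modes just after each time are known to be `k`. The value at the instant
    -- itself could differ, which `eq_of_left_right` excludes.
    refine ⟨k, leftMode_of_Ioo (a := a) (b := T) (fun s hs => ?_) haT le_rfl⟩
    have hsI := (ha hs).2
    have ha0 : 0 < s := by
      rcases hsI.1.eq_or_lt with h0 | h0
      · exfalso
        obtain ⟨r, hr⟩ := exists_between hs.1
        exact absurd (ha (show r ∈ Set.Ioo a T from ⟨hr.1, hr.2.trans hs.2⟩)).2.1
          (not_le.2 (h0 ▸ hr.2))
      · exact h0
    obtain ⟨k', hk', -⟩ := h.levels s hsI ha0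
    obtain ⟨b, hb, hab, hbs⟩ := LeftMode.exists_Ioo hk' (max_lt hs.1 ha0)
    obtain ⟨r, hr⟩ := exists_between hb
    have hk'k : k' = k := (rightMode_of_Ioo hbs hr.1.le hr.2).unique
      (hall r ⟨((le_max_left _ _).trans hab).trans_lt hr.1, hr.2.trans hs.2⟩)
    subst hk'k
    obtain ⟨c, hc, hcT, hcs⟩ := (hall s hs).exists_Ioo hs.2
    exact h.eq_of_left_right hn ((le_max_right _ _).trans hab) hb hc hcT hbs hcs (hx s hsI)

end IsTrajectory

end

end LossAverseGame

/-! ### Continuation and global existence of trajectories -/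

namespace LossAverseGame

noncomputable section

variable {G : LossAverseGame}

theorem contDiff_field (k : Mode) : ContDiff ℝ 1 (G.field k) := by
  have : G.field k = fun x i => G.alpha k i * (G.A i *ᵥ x + G.b i) i := by
    funext x i; exact G.field_eq k x i
  rw [this]
  simp only [mulVec, dotProduct, Fin.sum_univ_two, Pi.add_apply]
  fun_prop

/-- On a solution of mode `k` through `z`, the payoff rates are strictly compatible with `k` right
after `z` if `k` is ready at `z`. -/
theorem Ready.eventually {k : Mode} {z : Fin 2 → ℝ} (h : G.Ready k z) {f : ℝ → Fin 2 → ℝ} {T : ℝ}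
    (hz : f T = z) (hf : HasDerivAt f (G.field k (f T)) T) :
    ∀ᶠ t in 𝓝[>] T, ∀ i, 0 < (k i).sgn * G.rate k i (f t) := by
  refine eventually_all.2 fun i => ?_
  have hder := (hasDerivWithinAt_rate G (hf.hasDerivWithinAt (s := Set.Ioi T)) i).const_mul
    (k i).sgn
  rcases h i with h0 | ⟨h0, h1⟩
  · have := hder.continuousWithinAt.tendsto
    rw [hz] at this
    exact this.eventually_const_lt h0
  · rw [hz] at hder
    have hev := (hasDerivWithinAt_iff_tendsto_slope' (s := Set.Ioi T) (by simp)).1 hder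
    filter_upwards [hev.eventually_const_lt h1, self_mem_nhdsWithin] with t ht htT
    rw [slope_def_field, hz, h0, mul_zero, sub_zero] at ht
    have h2 := (div_pos_iff_of_pos_right (sub_pos.2 (Set.mem_Ioi.1 htT))).1 ht
    exact h2

/-- The solution of mode `k` through `z` runs in both time directions. A zero rate at an interior
point would be a local minimum of the signed rate along it, with zero derivative, against
transversality. This allows a continuation to obey `keep`. -/
theorem Nondeg.ready_of_mem_interior {k : Mode} {z : Fin 2 → ℝ} (h : G.Nondeg z)
    (hz : z ∈ interior (G.domain k)) : G.Ready k z := by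
  intro i
  have hd := mem_domain_iff.1 (interior_subset hz)
  by_cases h0 : G.rate k i z = 0
  · have h1 := h.drate_ne k i h0
    obtain ⟨f, hf0, ε, hε, hf⟩ := (G.contDiff_field k).contDiffAt
      |>.exists_forall_mem_closedBall_exists_eq_forall_mem_Ioo_hasDerivAt₀ (x₀ := z) 0
    have hf' := hf 0 (by constructor <;> linarith)
    have hder : HasDerivAt (fun t => (k i).sgn * G.rate k i (f t))
        ((k i).sgn * G.drate k i z) 0 := by
      rw [← hf0, ← hasDerivWithinAt_univ]
      exact (hasDerivWithinAt_rate G (hf'.hasDerivWithinAt (s := Set.univ)) i).const_mul _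
    have hmin : IsLocalMin (fun t => (k i).sgn * G.rate k i (f t)) 0 := by
      have hc : Tendsto f (𝓝 0) (𝓝 z) := hf0 ▸ hf'.continuousAt.tendsto
      filter_upwards [hc.eventually (mem_interior_iff_mem_nhds.1 hz)] with t ht
      simp only [hf0, h0, mul_zero]
      exact mem_domain_iff.1 ht i
    have := hmin.hasDerivAt_eq_zero hder
    exact absurd this (mul_ne_zero (Level.sgn_ne_zero _) h1)
  · exact Or.inl (lt_of_le_of_ne (hd i) (mul_ne_zero (Level.sgn_ne_zero _) h0).symm)

/-- Every clause of the dynamics at a time `t` involves only a neighbourhood of `t`, so trajectories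
that agree on overlaps can be glued. -/
theorem isTrajectory_of_local {I : Set ℝ} (hI : I ⊆ Set.Ici 0) {x : ℝ → Fin 2 → ℝ}
    {K : ℝ → Mode} (h : ∀ t ∈ I, ∃ T x' K', t < T ∧ G.IsTrajectory (Set.Ico 0 T) x' K' ∧
      Set.EqOn x x' (Set.Ico 0 T) ∧ Set.EqOn K K' (Set.Ico 0 T)) : G.IsTrajectory I x K := by
  have right : ∀ {t T : ℝ}, 0 ≤ t → t < T → Set.Ico 0 T ∈ 𝓝[>] t := fun h0 h1 => by
    filter_upwards [Ioo_mem_nhdsGT h1] with s hs using ⟨h0.trans hs.1.le, hs.2⟩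
  have left : ∀ {t T : ℝ}, 0 < t → t < T → Set.Ico 0 T ∈ 𝓝[<] t := fun h0 h1 => by
    filter_upwards [Ioo_mem_nhdsLT h0] with s hs using ⟨hs.1.le, hs.2.trans h1⟩
  constructor
  · intro t ht
    obtain ⟨T, x', K', htT, h', hx, -⟩ := h t ht
    have htI : t ∈ Set.Ico 0 T := ⟨hI ht, htT⟩
    have hle : 𝓝[I] t ≤ 𝓝[Set.Ico 0 T] t := by
      rw [nhdsWithin_le_iff]
      filter_upwards [self_mem_nhdsWithin, nhdsWithin_le_nhds (Iio_mem_nhds htT)] with s hs hs'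
        using ⟨hI hs, hs'⟩
    have hc := h'.continuousOn t htI
    refine ((hc.congr hx (hx htI)).tendsto).mono_left hle
  · intro t ht
    obtain ⟨T, x', K', htT, h', hx, hK⟩ := h t ht
    have htI : t ∈ Set.Ico 0 T := ⟨hI ht, htT⟩
    obtain ⟨k, hk, hd⟩ := h'.dynamics t htI
    refine ⟨k, ?_, ?_⟩
    · filter_upwards [hk, right htI.1 htT] with s hs hs'
      rw [hK hs', hs]
    · rw [hx htI]
      refine hd.congr_of_eventuallyEq ?_ (hx htI)
      filter_upwards [self_mem_nhdsWithin, nhdsWithin_le_nhds (Iio_mem_nhds htT)] with s hs hs'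
      exact hx ⟨htI.1.trans hs, hs'⟩
  · intro t ht h0
    obtain ⟨T, x', K', htT, h', hx, hK⟩ := h t ht
    have htI : t ∈ Set.Ico 0 T := ⟨hI ht, htT⟩
    obtain ⟨k, hk, hl⟩ := h'.levels t htI h0
    refine ⟨k, ?_, ?_⟩
    · filter_upwards [hk, left h0 htT] with s hs hs'
      rw [hK hs', hs]
    · rw [hx htI, hK htI]
      exact hl
  · intro t ht hi
    obtain ⟨T, x', K', htT, h', hx, hK⟩ := h t ht
    have htI : t ∈ Set.Ico 0 T := ⟨hI ht, htT⟩
    rw [hx htI, hK htI] at hi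
    filter_upwards [h'.keep t htI hi, right htI.1 htT] with s hs hs'
    rw [hK hs', hK htI, hs]

/-- A trajectory on `[0, T)` is continued beyond `T` by a mode that is ready at its end. -/
theorem IsTrajectory.extend {T : ℝ} (hT : 0 ≤ T) {x : ℝ → Fin 2 → ℝ} {K : ℝ → Mode}
    (h : G.IsTrajectory (Set.Ico 0 T) x K) {z : Fin 2 → ℝ} {κ k : Mode} (hk : G.Ready k z)
    (hlim : 0 < T → Tendsto x (𝓝[<] T) (𝓝 z))
    (hκ : 0 < T → ∃ k, LeftMode K T k ∧ ∀ i, (G.rate k i z < 0 → κ i = Level.L) ∧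
      (0 < G.rate k i z → κ i = Level.H) ∧ (G.rate k i z = 0 → ¬ G.IsNash z → κ i ≠ k i))
    (hkeep : z ∈ interior (G.domain κ) → k = κ) :
    ∃ T' x' K', T < T' ∧ G.IsTrajectory (Set.Ico 0 T') x' K' ∧ Set.EqOn x' x (Set.Ico 0 T) ∧
      Set.EqOn K' K (Set.Ico 0 T) ∧ x' T = z := by
  obtain ⟨f, hf0, ε, hε, hf⟩ := (G.contDiff_field k).contDiffAt
    |>.exists_forall_mem_closedBall_exists_eq_forall_mem_Ioo_hasDerivAt₀ (x₀ := z) T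
  have hfT := hf T (by constructor <;> linarith)
  obtain ⟨b, hb, hbs⟩ := (mem_nhdsGT_iff_exists_Ioo_subset' (lt_add_of_pos_right T hε)).1
    (hk.eventually hf0 hfT)
  let T' := min b (T + ε)
  have hTT' : T < T' := lt_min hb (by linarith)
  have hf' : ∀ t ∈ Set.Ico T T', HasDerivAt f (G.field k (f t)) t := fun t ht =>
    hf t ⟨by linarith [ht.1], ht.2.trans_le (min_le_right _ _)⟩
  have hs' : ∀ t ∈ Set.Ioo T T', ∀ i, 0 < (k i).sgn * G.rate k i (f t) := fun t ht =>
    hbs ⟨ht.1, ht.2.trans_le (min_le_left _ _)⟩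
  let x' : ℝ → Fin 2 → ℝ := fun t => if t < T then x t else f t
  let K' : ℝ → Mode := fun t => if t < T then K t else if t = T then κ else k
  have x1 : ∀ t, t < T → x' t = x t := fun t ht => if_pos ht
  have x2 : ∀ t, T ≤ t → x' t = f t := fun t ht => if_neg (not_lt.2 ht)
  have K1 : ∀ t, t < T → K' t = K t := fun t ht => if_pos ht
  have K2 : K' T = κ := by simp [K']
  have K3 : ∀ t, T < t → K' t = k := fun t ht => by simp [K', ht.not_gt, ht.ne']
  have loc : G.IsTrajectory (Set.Ico 0 T) x' K' :=
    isTrajectory_of_local (fun t ht => ht.1) fun t ht =>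
      ⟨T, x, K, ht.2, h, fun s hs => x1 s hs.2, fun s hs => K1 s hs.2⟩
  have xT : x' T = z := by rw [x2 T le_rfl, hf0]
  have rightk : ∀ t, T ≤ t → ∀ᶠ s in 𝓝[>] t, K' s = k := fun t ht => by
    filter_upwards [self_mem_nhdsWithin] with s hs using K3 s (ht.trans_lt hs)
  refine ⟨T', x', K', hTT', ⟨?_, ?_, ?_, ?_⟩, fun s hs => x1 s hs.2, fun s hs => K1 s hs.2, xT⟩
  · intro t ht
    rcases lt_trichotomy t T with htT | rfl | htT
    · have hle : 𝓝[Set.Ico 0 T'] t ≤ 𝓝[Set.Ico 0 T] t := by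
        rw [nhdsWithin_le_iff]
        filter_upwards [self_mem_nhdsWithin, nhdsWithin_le_nhds (Iio_mem_nhds htT)] with s hs hs'
          using ⟨hs.1, hs'⟩
      exact (loc.continuousOn t ⟨ht.1, htT⟩).mono_left hle
    · have hR : ContinuousWithinAt x' (Set.Ici t) t :=
        hfT.continuousAt.continuousWithinAt.congr (fun s hs => x2 s hs) (x2 t le_rfl)
      rcases hT.eq_or_lt with h0 | h0
      · exact hR.mono fun s hs => by rw [← h0]; exact hs.1
      · have hL : ContinuousWithinAt x' (Set.Iio t) t := by
          have := hlim h0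
          rw [← xT] at this
          refine this.congr' ?_
          filter_upwards [self_mem_nhdsWithin] with s hs using (x1 s hs).symm
        have := hL.union hR
        rw [Set.Iio_union_Ici] at this
        exact this.mono (Set.subset_univ _)
    · have : x' =ᶠ[𝓝 t] f := by
        filter_upwards [Ioi_mem_nhds htT] with s hs using x2 s (le_of_lt hs)
      exact ((hf' t ⟨htT.le, ht.2⟩).continuousAt.congr this.symm).continuousWithinAt
  · intro t ht
    rcases lt_or_ge t T with htT | htT
    · exact loc.dynamics t ⟨ht.1, htT⟩
    · refine ⟨k, rightk t htT, ?_⟩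
      rw [x2 t htT]
      exact (hf' t ⟨htT, ht.2⟩).hasDerivWithinAt.congr (fun s hs => x2 s (htT.trans hs)) (x2 t htT)
  · intro t ht h0
    rcases lt_trichotomy t T with htT | rfl | htT
    · exact loc.levels t ⟨ht.1, htT⟩ h0
    · obtain ⟨j, hj, hl⟩ := hκ h0
      refine ⟨j, ?_, ?_⟩
      · filter_upwards [hj, self_mem_nhdsWithin] with s hs hs'
        rw [K1 s hs', hs]
      · rw [xT, K2]
        exact hl
    · refine ⟨k, ?_, fun i => ?_⟩
      · filter_upwards [Ioo_mem_nhdsLT htT] with s hs using K3 s hs.1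
      · have := hs' t ⟨htT, ht.2⟩ i
        rw [x2 t htT.le, K3 t htT]
        rcases hki : k i with _ | _ <;> simp only [hki, Level.sgn] at this
        · exact ⟨fun _ => rfl, fun h => by linarith, fun h => by linarith⟩
        · exact ⟨fun h => by linarith, fun _ => rfl, fun h => by linarith⟩
  · intro t ht hi
    rcases lt_trichotomy t T with htT | rfl | htT
    · exact loc.keep t ⟨ht.1, htT⟩ hi
    · rw [K2] at hi ⊢
      rw [xT] at hi
      have := rightk t le_rfl
      rwa [hkeep hi] at this
    · rw [K3 t htT]
      exact rightk t htT.le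

/-- The level rule imposes the value `κ` at the switching instant, but the mode afterwards must
equal `κ` only if `z` is interior to its domain. Elsewhere any ready mode will do. -/
theorem Nondeg.exists_ready_keep {z : Fin 2 → ℝ} (h : G.Nondeg z) (κ : Mode) :
    ∃ k, G.Ready k z ∧ (z ∈ interior (G.domain κ) → k = κ) := by
  by_cases hz : z ∈ interior (G.domain κ)
  · exact ⟨κ, h.ready_of_mem_interior hz, fun _ => rfl⟩
  · obtain ⟨k, hk⟩ := h.exists_ready
    exact ⟨k, hk, fun h => absurd h hz⟩

theorem exists_switch (k : Mode) (z : Fin 2 → ℝ) : ∃ κ : Mode,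
    ∀ i, (G.rate k i z < 0 → κ i = Level.L) ∧ (0 < G.rate k i z → κ i = Level.H) ∧
      (G.rate k i z = 0 → ¬ G.IsNash z → κ i ≠ k i) := by
  have : ∀ i, ∃ l : Level, (G.rate k i z < 0 → l = Level.L) ∧ (0 < G.rate k i z → l = Level.H) ∧
      (G.rate k i z = 0 → ¬ G.IsNash z → l ≠ k i) := by
    intro i
    rcases lt_trichotomy (G.rate k i z) 0 with h | h | h
    · exact ⟨Level.L, fun _ => rfl, fun h' => by linarith, fun h' => by linarith⟩
    · rcases hki : k i with _ | _
      · exact ⟨Level.H, fun h' => by linarith, fun h' => by linarith, fun _ _ => by simp⟩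
      · exact ⟨Level.L, fun h' => by linarith, fun h' => by linarith, fun _ _ => by simp⟩
    · exact ⟨Level.H, fun h' => by linarith, fun _ => rfl, fun h' => by linarith⟩
  choose κ hκ using this
  exact ⟨κ, hκ⟩

theorem IsTrajectory.exists_extension {T : ℝ} (hT : 0 < T) {x : ℝ → Fin 2 → ℝ} {K : ℝ → Mode}
    (h : G.IsTrajectory (Set.Ico 0 T) x K) {z : Fin 2 → ℝ} (hz : G.Nondeg z)
    (hlim : Tendsto x (𝓝[<] T) (𝓝 z)) {j : Mode} (hj : LeftMode K T j) :
    ∃ T' x' K', T < T' ∧ G.IsTrajectory (Set.Ico 0 T') x' K' ∧ Set.EqOn x' x (Set.Ico 0 T) ∧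
      Set.EqOn K' K (Set.Ico 0 T) := by
  obtain ⟨κ, hκ⟩ := exists_switch (G := G) j z
  obtain ⟨k, hk, hkeep⟩ := hz.exists_ready_keep κ
  obtain ⟨T', x', K', h1, h2, h3, h4, -⟩ :=
    h.extend hT.le hk (fun _ => hlim) (fun _ => ⟨j, hj, hκ⟩) hkeep
  exact ⟨T', x', K', h1, h2, h3, h4⟩

theorem Nondeg.exists_trajectory {z : Fin 2 → ℝ} (hz : G.Nondeg z) :
    ∃ T x K, 0 < T ∧ G.IsTrajectory (Set.Ico 0 T) x K ∧ x 0 = z := by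
  obtain ⟨k, hk⟩ := hz.exists_ready
  have h : G.IsTrajectory (Set.Ico 0 0) (fun _ => z) (fun _ => k) := by
    constructor <;> simp
  obtain ⟨T', x', K', h1, h2, -, -, h5⟩ := h.extend (κ := k) le_rfl hk
    (fun h => absurd h (lt_irrefl _)) (fun h => absurd h (lt_irrefl _)) (fun _ => rfl)
  exact ⟨T', x', K', h1, h2, h5⟩

/-- On a bounded set the finitely many mode fields are bounded. The state is therefore Lipschitz on
`[0, T)`, and it extends continuously to `T`. -/
theorem IsTrajectory.exists_tendsto {T : ℝ} (hT : 0 < T) {x : ℝ → Fin 2 → ℝ} {K : ℝ → Mode}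
    (h : G.IsTrajectory (Set.Ico 0 T) x K) {R : ℝ} (hR : ∀ t ∈ Set.Ico 0 T, ‖x t‖ ≤ R) :
    ∃ z, Tendsto x (𝓝[<] T) (𝓝 z) := by
  have hC : ∀ k, ∃ C, ∀ y ∈ Metric.closedBall (0 : Fin 2 → ℝ) R, ‖G.field k y‖ ≤ C := fun k =>
    (isCompact_closedBall _ _).exists_bound_of_continuousOn (G.continuous_field k).continuousOn
  choose C hC using hC
  obtain ⟨B, hB⟩ := (Set.finite_range C).bddAbove
  have hlip : LipschitzOnWith (Real.toNNReal B) x (Set.Ico 0 T) := by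
    have key : ∀ a ∈ Set.Ico 0 T, ∀ b ∈ Set.Ico 0 T, a ≤ b →
        dist (x b) (x a) ≤ Real.toNNReal B * dist b a := by
      intro a ha b hb hab
      have hd : ∀ t ∈ Set.Ico a b, ∃ k, HasDerivWithinAt x (G.field k (x t)) (Set.Ici t) t :=
        fun t ht => by
          obtain ⟨k, -, hk⟩ := h.dynamics t ⟨ha.1.trans ht.1, ht.2.trans hb.2⟩
          exact ⟨k, hk⟩
      let f' : ℝ → Fin 2 → ℝ := fun t => if ht : t ∈ Set.Ico a b then
        G.field (hd t ht).choose (x t) else 0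
      have hf' : ∀ t (ht : t ∈ Set.Ico a b), f' t = G.field (hd t ht).choose (x t) :=
        fun t ht => dif_pos ht
      have := norm_image_sub_le_of_norm_deriv_right_le_segment (f := x) (f' := f') (a := a) (b := b)
        (C := B) (h.continuousOn.mono fun t ht => ⟨ha.1.trans ht.1, ht.2.trans_lt hb.2⟩)
        (fun t ht => by rw [hf' t ht]; exact (hd t ht).choose_spec)
        (fun t ht => by
          rw [hf' t ht]
          refine (hC _ _ ?_).trans (hB ⟨_, rfl⟩)
          simpa using hR t ⟨ha.1.trans ht.1, ht.2.trans hb.2⟩) b (Set.right_mem_Icc.2 hab)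
      rw [dist_eq_norm, Real.dist_eq, abs_of_nonneg (sub_nonneg.2 hab)]
      exact this.trans (mul_le_mul_of_nonneg_right (Real.le_coe_toNNReal B) (sub_nonneg.2 hab))
    refine LipschitzOnWith.of_dist_le_mul fun a ha b hb => ?_
    rcases le_total a b with hab | hab
    · rw [dist_comm, dist_comm a b]; exact key a ha b hb hab
    · exact key b hb a ha hab
  obtain ⟨g, hg, hgx⟩ := hlip.extend_pi
  refine ⟨g T, ((hg.continuous.tendsto T).mono_left nhdsWithin_le_nhds).congr' ?_⟩
  filter_upwards [Ioo_mem_nhdsLT hT] with s hs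
  exact (hgx ⟨hs.1.le, hs.2⟩).symm

/-- If all trajectories from `x₀` remain bounded and away from degenerate states, then there is
one for all times. -/
theorem exists_trajectory_Ici {x₀ : Fin 2 → ℝ} (h0 : G.Nondeg x₀) {R : ℝ}
    (hst : ∀ (T : ℝ) (x : ℝ → Fin 2 → ℝ) (K : ℝ → Mode), 0 < T →
      G.IsTrajectory (Set.Ico 0 T) x K → x 0 = x₀ →
      (∀ t ∈ Set.Ico 0 T, ‖x t‖ ≤ R ∧ G.Nondeg (x t) ∧ ¬ G.IsNash (x t)) ∧
      ∀ z, Tendsto x (𝓝[<] T) (𝓝 z) → G.Nondeg z) :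
    ∃ x K, G.IsTrajectory (Set.Ici 0) x K ∧ x 0 = x₀ := by
  by_contra hno
  let P := {p : ℝ × (ℝ → Fin 2 → ℝ) × (ℝ → Mode) //
    0 < p.1 ∧ G.IsTrajectory (Set.Ico 0 p.1) p.2.1 p.2.2 ∧ p.2.1 0 = x₀}
  let r : P → P → Prop := fun p q => p.1.1 ≤ q.1.1 ∧
    Set.EqOn q.1.2.1 p.1.2.1 (Set.Ico 0 p.1.1) ∧ Set.EqOn q.1.2.2 p.1.2.2 (Set.Ico 0 p.1.1)
  have hne : Nonempty P := by
    obtain ⟨T, x, K, hT, h, hx⟩ := h0.exists_trajectory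
    exact ⟨⟨(T, x, K), hT, h, hx⟩⟩
  -- Zorn's lemma for extension of trajectories. A chain with unbounded end times would already glue
  -- to a global trajectory, and a maximal element could still be extended at its end.
  obtain ⟨m, hm⟩ : ∃ m : P, ∀ a, r m a → r a m := by
    refine exists_maximal_of_nonempty_chains_bounded (r := r) (fun c hc hcne => ?_) ?_
    · have compat : ∀ p ∈ c, ∀ q ∈ c, ∀ t, 0 ≤ t → t < p.1.1 → t < q.1.1 →
          p.1.2.1 t = q.1.2.1 t ∧ p.1.2.2 t = q.1.2.2 t := by
        intro p hp q hq t h0 h1 h2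
        rcases eq_or_ne p q with rfl | hpq
        · exact ⟨rfl, rfl⟩
        rcases hc hp hq hpq with h | h
        · exact ⟨(h.2.1 ⟨h0, h1⟩).symm, (h.2.2 ⟨h0, h1⟩).symm⟩
        · exact ⟨h.2.1 ⟨h0, h2⟩, h.2.2 ⟨h0, h2⟩⟩
      obtain ⟨p0, hp0⟩ := hcne
      -- The member `p0` is a dummy value at times that no member of the chain covers.
      have hsel : ∀ t : ℝ, ∃ q ∈ c, (∃ p ∈ c, t < p.1.1) → t < q.1.1 := by
        intro t
        by_cases h : ∃ p ∈ c, t < p.1.1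
        · obtain ⟨p, hp, ht⟩ := h
          exact ⟨p, hp, fun _ => ht⟩
        · exact ⟨p0, hp0, fun h' => absurd h' h⟩
      choose q hq hqt using hsel
      let x : ℝ → Fin 2 → ℝ := fun t => (q t).1.2.1 t
      let K : ℝ → Mode := fun t => (q t).1.2.2 t
      have hx : ∀ p ∈ c, Set.EqOn x p.1.2.1 (Set.Ico 0 p.1.1) := fun p hp t ht =>
        (compat _ (hq t) p hp t ht.1 (hqt t ⟨p, hp, ht.2⟩) ht.2).1
      have hK : ∀ p ∈ c, Set.EqOn K p.1.2.2 (Set.Ico 0 p.1.1) := fun p hp t ht =>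
        (compat _ (hq t) p hp t ht.1 (hqt t ⟨p, hp, ht.2⟩) ht.2).2
      have traj : ∀ I : Set ℝ, I ⊆ Set.Ici 0 → (∀ t ∈ I, ∃ p ∈ c, t < p.1.1) →
          G.IsTrajectory I x K := fun I hI h => isTrajectory_of_local hI fun t ht => by
        obtain ⟨p, hp, htp⟩ := h t ht
        exact ⟨p.1.1, p.1.2.1, p.1.2.2, htp, p.2.2.1, hx p hp, hK p hp⟩
      have x0 : x 0 = x₀ := by rw [hx p0 hp0 ⟨le_rfl, p0.2.1⟩, p0.2.2.2]
      by_cases hb : BddAbove ((fun p : P => p.1.1) '' c)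
      · let S := sSup ((fun p : P => p.1.1) '' c)
        have hle : ∀ p ∈ c, p.1.1 ≤ S := fun p hp => le_csSup hb ⟨p, hp, rfl⟩
        refine ⟨⟨(S, x, K), p0.2.1.trans_le (hle p0 hp0), traj _ (fun t ht => ht.1) ?_, x0⟩,
          fun p hp => ⟨hle p hp, hx p hp, hK p hp⟩⟩
        intro t ht
        obtain ⟨_, ⟨p, hp, rfl⟩, htp⟩ := exists_lt_of_lt_csSup (Set.Nonempty.image _ ⟨p0, hp0⟩) ht.2
        exact ⟨p, hp, htp⟩
      · exfalso
        apply hno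
        refine ⟨x, K, traj _ subset_rfl fun t _ => ?_, x0⟩
        rw [not_bddAbove_iff] at hb
        obtain ⟨_, ⟨p, hp, rfl⟩, htp⟩ := hb t
        exact ⟨p, hp, htp⟩
    · rintro a b c ⟨h1, h2, h3⟩ ⟨h4, h5, h6⟩
      have hsub : Set.Ico 0 a.1.1 ⊆ Set.Ico 0 b.1.1 := Set.Ico_subset_Ico_right h1
      exact ⟨h1.trans h4, (h5.mono hsub).trans h2, (h6.mono hsub).trans h3⟩
  obtain ⟨⟨T, x, K⟩, hT, htr, hx0⟩ := m
  simp only at hT htr hx0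
  obtain ⟨h1, h2⟩ := hst T x K hT htr hx0
  obtain ⟨z, hz⟩ := htr.exists_tendsto hT fun t ht => (h1 t ht).1
  obtain ⟨j, hj⟩ := htr.exists_leftMode (fun t ht => (h1 t ht).2.2) hT
    (fun t ht => (h1 t ht).2.1) (h2 z hz) hz
  obtain ⟨T', x', K', hTT', htr', hx', hK'⟩ := htr.exists_extension hT (h2 z hz) hz hj
  have hx0' : x' 0 = x₀ := by rw [hx' ⟨le_rfl, hT⟩, hx0]
  have := hm ⟨(T', x', K'), hT.trans hTT', htr', hx0'⟩ ⟨hTT'.le, hx', hK'⟩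
  exact absurd this.1 (not_le.2 hTT')

end

end LossAverseGame

/-! ### Payoff rates in polar coordinates and nondegeneracy near the equilibrium -/

@[simp] theorem phaseVec_zero (θ : ℝ) : phaseVec θ 0 = Real.cos θ := rfl

@[simp] theorem phaseVec_one (θ : ℝ) : phaseVec θ 1 = Real.sin θ := rfl

theorem continuous_phaseVec : Continuous phaseVec := by
  refine continuous_pi fun i => ?_
  fin_cases i
  · exact Real.continuous_cos
  · exact Real.continuous_sin

namespace LossAverseGame

noncomputable section

variable (G : LossAverseGame)

/-- The determinant `det [y, 𝔸_k y]`, the angular velocity in mode `k` on the unit circle. -/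
def spin (k : Mode) (y : Fin 2 → ℝ) : ℝ :=
  y 0 * (G.alpha k 1 * G.grad1 y) - y 1 * (G.alpha k 0 * G.grad0 y)

/-- The payoff rate of agent 1 at `xs + r • phaseVec θ`, divided by `r`. -/
def scaledRate (xs : Fin 2 → ℝ) (k : Mode) (r θ : ℝ) : ℝ :=
  r * (G.alpha k 0 * G.grad0 (phaseVec θ) ^ 2) + G.alpha k 1 * G.grad1 (phaseVec θ) *
    (G.slope xs + r * (G.A 0 0 1 * Real.cos θ + G.A 0 1 1 * Real.sin θ))

/-- The derivative of the payoff rate of agent 1 at `xs + r • phaseVec θ`, divided by `r`. -/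
def scaledDrate (xs : Fin 2 → ℝ) (k : Mode) (r θ : ℝ) : ℝ :=
  r * (2 * G.alpha k 0 * G.grad0 (phaseVec θ) *
    (G.A 0 0 0 * (G.alpha k 0 * G.grad0 (phaseVec θ))
      + G.A 0 0 1 * (G.alpha k 1 * G.grad1 (phaseVec θ))))
  + G.alpha k 1 * (G.A 1 0 1 * (G.alpha k 0 * G.grad0 (phaseVec θ))
      + G.A 1 1 1 * (G.alpha k 1 * G.grad1 (phaseVec θ))) *
    (G.slope xs + r * (G.A 0 0 1 * Real.cos θ + G.A 0 1 1 * Real.sin θ))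
  + r * (G.alpha k 1 * G.grad1 (phaseVec θ) *
    (G.A 0 0 1 * (G.alpha k 0 * G.grad0 (phaseVec θ))
      + G.A 0 1 1 * (G.alpha k 1 * G.grad1 (phaseVec θ))))

theorem grad0_smul (r : ℝ) (y : Fin 2 → ℝ) : G.grad0 (r • y) = r * G.grad0 y := by
  simp [grad0]; ring

theorem grad1_smul (r : ℝ) (y : Fin 2 → ℝ) : G.grad1 (r • y) = r * G.grad1 y := by
  simp [grad1]; ring

theorem continuous_grad0 : Continuous fun θ => G.grad0 (phaseVec θ) := by
  simp only [grad0, phaseVec_zero, phaseVec_one]; fun_prop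

theorem continuous_grad1 : Continuous fun θ => G.grad1 (phaseVec θ) := by
  simp only [grad1, phaseVec_zero, phaseVec_one]; fun_prop

theorem continuous_scaledRate (xs : Fin 2 → ℝ) (k : Mode) :
    Continuous fun p : ℝ × ℝ => G.scaledRate xs k p.1 p.2 := by
  simp only [scaledRate, grad0, grad1, phaseVec_zero, phaseVec_one]; fun_prop

theorem continuous_scaledDrate (xs : Fin 2 → ℝ) (k : Mode) :
    Continuous fun p : ℝ × ℝ => G.scaledDrate xs k p.1 p.2 := by
  simp only [scaledDrate, grad0, grad1, phaseVec_zero, phaseVec_one]; fun_prop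

theorem grad0_ne_zero_of_grad1 (h : 0 < G.det0) {y : Fin 2 → ℝ} (hy : y ≠ 0) (h1 : G.grad1 y = 0) :
    G.grad0 y ≠ 0 := by
  intro h0
  unfold grad0 at h0
  unfold grad1 at h1
  apply hy
  have e0 : G.det0 * y 0 = 0 := by
    unfold det0; linear_combination G.A 1 1 1 * h0 - G.A 0 0 1 * h1
  have e1 : G.det0 * y 1 = 0 := by
    unfold det0; linear_combination G.A 0 0 0 * h1 - G.A 1 0 1 * h0
  ext i
  fin_cases i
  · simpa [h.ne'] using e0
  · simpa [h.ne'] using e1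

end

end LossAverseGame

theorem phaseVec_ne_zero (θ : ℝ) : phaseVec θ ≠ 0 := by
  intro h
  have h0 := congrFun h 0
  have h1 := congrFun h 1
  simp at h0 h1
  have := Real.sin_sq_add_cos_sq θ
  simp [h0, h1] at this

namespace LossAverseGame

namespace Mixed

variable {G : LossAverseGame} {xs : Fin 2 → ℝ}

theorem rate_zero_phase (h : G.Mixed xs) (k : Mode) (r θ : ℝ) :
    G.rate k 0 (xs + r • phaseVec θ) = r * G.scaledRate xs k r θ := by
  rw [h.rate_zero_add, grad0_smul, grad1_smul, scaledRate]
  simp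
  ring

theorem drate_zero_phase (h : G.Mixed xs) (k : Mode) (r θ : ℝ) :
    G.drate k 0 (xs + r • phaseVec θ) = r * G.scaledDrate xs k r θ := by
  rw [h.drate_zero_add, grad0_smul, grad1_smul, scaledDrate]
  simp
  ring

theorem rate_one_smul (h : G.Mixed xs) (k : Mode) (r : ℝ) (y : Fin 2 → ℝ) :
    G.rate k 1 (xs + r • y) = r ^ 2 * G.rate k 1 (xs + y) := by
  rw [h.rate_one_add, h.rate_one_add, grad0_smul, grad1_smul]
  simp
  ring

theorem drate_one_smul (h : G.Mixed xs) (k : Mode) (r : ℝ) (y : Fin 2 → ℝ) :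
    G.drate k 1 (xs + r • y) = r ^ 2 * G.drate k 1 (xs + y) := by
  rw [h.drate_one_add, h.drate_one_add, grad0_smul, grad1_smul]
  simp
  ring

theorem det0_mul_rate (h : G.Mixed xs) (k : Mode) (y : Fin 2 → ℝ) :
    G.det0 * G.rate k 1 (xs + y) = G.alpha k 0 * (G.hessDet * G.grad0 y ^ 2
      + G.mixedCoeff * G.grad0 y * G.grad1 y) + G.alpha k 1 * G.det0 * G.grad1 y ^ 2 := by
  rw [h.rate_one_add]
  simp only [det0, hessDet, mixedCoeff, grad0, grad1]
  ring

/-- At a zero of the rate, the sign of its derivative is governed by a linear form without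
sensitivities and by `spin`, whose sign is common to all modes. Hence the crossing direction does
not depend on the mode. -/
theorem grad1_mul_drate (h : G.Mixed xs) (k : Mode) (y : Fin 2 → ℝ) :
    G.grad1 y * G.drate k 1 (xs + y) =
      2 * (G.A 1 0 1 * (G.alpha k 0 * G.grad0 y) + G.A 1 1 1 * (G.alpha k 1 * G.grad1 y))
        * G.rate k 1 (xs + y)
      - G.alpha k 0 * (2 * G.hessDet * G.grad0 y + G.mixedCoeff * G.grad1 y) * G.spin k y := by
  rw [h.rate_one_add, h.drate_one_add]
  simp only [hessDet, mixedCoeff, grad0, grad1, spin]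
  ring

theorem rotation_mul_pos (h : G.Mixed xs) : 0 < G.rotation * G.A 1 0 1 := by
  have := h.mul_neg
  unfold rotation
  split_ifs with hr
  · linarith [hr.2]
  · by_contra hc
    apply hr
    have hc' : 0 < G.A 1 0 1 := by
      rcases lt_trichotomy (G.A 1 0 1) 0 with h0 | h0 | h0
      · linarith
      · simp [h0] at this
      · exact h0
    exact ⟨by by_contra h1; nlinarith, hc'⟩

theorem rotation_sq (G : LossAverseGame) : G.rotation * G.rotation = 1 := by
  unfold rotation
  split_ifs <;> norm_num

/-- As a quadratic form in `y`, the spin has a discriminant proportional to that of the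
characteristic polynomial, hence negative. The form is definite, with the sign of its leading
coefficient `alpha k 1 * a^2_{12}`. -/
theorem spin_pos (h : G.Mixed xs) (k : Mode) {y : Fin 2 → ℝ} (hy : y ≠ 0) :
    0 < G.rotation * G.spin k y := by
  have hc := h.rotation_mul_pos
  have h0 := G.alpha_pos k 0
  have h1 := G.alpha_pos k 1
  have hd := h.disc k
  have key : 0 < G.A 1 0 1 * G.spin k y := by
    have e : 4 * G.alpha k 1 * (G.A 1 0 1 * G.spin k y) =
        (2 * (G.alpha k 1 * G.A 1 0 1) * y 0
          + (G.alpha k 1 * G.A 1 1 1 - G.alpha k 0 * G.A 0 0 0) * y 1) ^ 2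
        + (-((G.alpha k 1 * G.A 1 1 1 - G.alpha k 0 * G.A 0 0 0) ^ 2
          + 4 * G.alpha k 0 * G.alpha k 1 * (G.A 0 0 1 * G.A 1 0 1))) * y 1 ^ 2 := by
      simp only [spin, grad0, grad1]
      ring
    have hpos : 0 < 4 * G.alpha k 1 * (G.A 1 0 1 * G.spin k y) := by
      rw [e]
      by_cases hy1 : y 1 = 0
      · have hy0 : y 0 ≠ 0 := by
          intro hy0
          apply hy
          ext i
          fin_cases i <;> simp [hy0, hy1]
        have hc0 : G.A 1 0 1 ≠ 0 := fun h0 => by simp [h0] at hc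
        simp only [hy1, mul_zero, add_zero, ne_eq, OfNat.ofNat_ne_zero, not_false_eq_true,
          zero_pow]
        positivity
      · have : 0 < y 1 ^ 2 := by positivity
        have := mul_pos (neg_pos.2 hd) this
        positivity
    exact pos_of_mul_pos_right hpos (by positivity)
  have h2 : 0 < (G.rotation * G.A 1 0 1) * (G.A 1 0 1 * G.spin k y) := mul_pos hc key
  have h3 : 0 < G.A 1 0 1 ^ 2 * (G.rotation * G.spin k y) := by nlinarith
  exact pos_of_mul_pos_right h3 (sq_nonneg _)

/-- The form `L` is the derivative, up to a factor, of the rate as a quadratic in `grad0`. If both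
vanished, the quadratic would have a double zero, against `indef`. -/
theorem transversal_of_grad1_ne (h : G.Mixed xs) (k : Mode) {y : Fin 2 → ℝ} (hy : G.grad1 y ≠ 0)
    (h0 : G.rate k 1 (xs + y) = 0) :
    0 < (-(G.rotation * (G.grad1 y * (2 * G.hessDet * G.grad0 y + G.mixedCoeff * G.grad1 y))))
      * G.drate k 1 (xs + y) := by
  set L := 2 * G.hessDet * G.grad0 y + G.mixedCoeff * G.grad1 y with hL
  have hα := G.alpha_pos k 0
  have hy0 : y ≠ 0 := by
    rintro rfl
    simp [grad1] at hy
  have hs := h.spin_pos k hy0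
  have hne : L ≠ 0 := by
    intro hL0
    have e := h.det0_mul_rate k y
    rw [h0, mul_zero] at e
    have hi := h.indef k
    have e2 : (4 * G.hessDet * (G.alpha k 1 * G.det0) - G.alpha k 0 * G.mixedCoeff ^ 2)
        * G.grad1 y ^ 2 = 0 := by
      linear_combination (-4 * G.hessDet) * e - G.alpha k 0 * L * hL0
        + G.alpha k 0 * (L + (2 * G.hessDet * G.grad0 y + G.mixedCoeff * G.grad1 y)) * hL
    rcases mul_eq_zero.1 e2 with h1 | h1
    · linarith
    · exact hy (pow_eq_zero_iff (two_ne_zero) |>.1 h1)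
  have e := h.grad1_mul_drate k y
  rw [h0, mul_zero, zero_sub, ← hL] at e
  have : -(G.rotation * (G.grad1 y * L)) * G.drate k 1 (xs + y)
      = G.alpha k 0 * L ^ 2 * (G.rotation * G.spin k y) := by
    linear_combination (-(G.rotation * L)) * e
  rw [this]
  positivity

/-- If `grad1` is nonzero at `θ`, agent 1 has a fixed sign (the linear term dominates) and agent 2
crosses transversally. If `grad1` vanishes, the linear term of agent 1 changes sign and the roles
are exchanged. This needs a separate look when `hessDet = 0`, because the rate of agent 2 then
vanishes on the same ray. -/
theorem nondeg_near_phase (h : G.Mixed xs) (θ : ℝ) :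
    ∀ᶠ p : ℝ × ℝ in 𝓝 (0, θ), 0 < p.1 → G.Nondeg (xs + p.1 • phaseVec p.2) := by
  have hg := h.slope_ne
  have hΔ := h.det0_pos
  have cV : Continuous fun p : ℝ × ℝ => G.grad1 (phaseVec p.2) := G.continuous_grad1.comp
    continuous_snd
  have cU : Continuous fun p : ℝ × ℝ => G.grad0 (phaseVec p.2) := G.continuous_grad0.comp
    continuous_snd
  by_cases hV : G.grad1 (phaseVec θ) = 0
  · have hU := G.grad0_ne_zero_of_grad1 hΔ (phaseVec_ne_zero θ) hV
    have hc : G.A 1 0 1 ≠ 0 := fun h0 => by have := h.mul_neg; simp [h0] at this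
    -- The number `ε` is the value of `scaledDrate` at radius `0`, up to the positive sensitivities.
    set ε := G.slope xs * G.A 1 0 1 * G.grad0 (phaseVec θ) with hε
    have d1 : ∀ᶠ p : ℝ × ℝ in 𝓝 (0, θ), ∀ k, 0 < ε * G.scaledDrate xs k p.1 p.2 := by
      refine eventually_all.2 fun k => ?_
      refine (((G.continuous_scaledDrate xs k).const_mul ε).tendsto (0, θ)).eventually_const_lt ?_
      have h0 := G.alpha_pos k 0
      have h1 := G.alpha_pos k 1
      have : ε * G.scaledDrate xs k 0 θ = G.alpha k 1 * G.alpha k 0 * ε ^ 2 := by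
        simp only [scaledDrate, hV, hε]
        ring
      simp only [this]
      have : ε ≠ 0 := by positivity
      positivity
    have first : ∀ p : ℝ × ℝ, 0 < p.1 → (∀ k, 0 < ε * G.scaledDrate xs k p.1 p.2) →
        ∀ k, G.rate k 0 (xs + p.1 • phaseVec p.2) = 0 →
        0 < ε * G.drate k 0 (xs + p.1 • phaseVec p.2) := by
      intro p hp hd k _
      rw [h.drate_zero_phase]
      have := mul_pos hp (hd k)
      linarith
    by_cases hP : G.hessDet = 0
    · have hQ : G.mixedCoeff ≠ 0 := by
        intro hQ
        have := h.indef fun _ => Level.L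
        simp [hP, hQ] at this
      -- With `hessDet = 0` the rate of agent 2 factors through `grad1`, and `σ` gives the sign of
      -- the other factor in all modes.
      set σ := G.mixedCoeff * G.grad0 (phaseVec θ) with hσ
      have d2 : ∀ᶠ p : ℝ × ℝ in 𝓝 (0, θ), ∀ k : Mode, 0 < σ * (G.alpha k 0 * G.mixedCoeff *
          G.grad0 (phaseVec p.2) + G.alpha k 1 * G.det0 * G.grad1 (phaseVec p.2)) := by
        refine eventually_all.2 fun k => ?_
        have hc : Continuous fun p : ℝ × ℝ => σ * (G.alpha k 0 * G.mixedCoeff *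
          G.grad0 (phaseVec p.2) + G.alpha k 1 * G.det0 * G.grad1 (phaseVec p.2)) := by fun_prop
        refine (hc.tendsto (0, θ)).eventually_const_lt ?_
        have h0 := G.alpha_pos k 0
        have : σ * (G.alpha k 0 * G.mixedCoeff * G.grad0 (phaseVec θ)
            + G.alpha k 1 * G.det0 * G.grad1 (phaseVec θ)) = G.alpha k 0 * σ ^ 2 := by
          rw [hV, hσ]; ring
        simp only [this]
        have : σ ≠ 0 := by positivity
        positivity
      filter_upwards [d1, d2] with p hp1 hp2 hp
      -- Exactly on the ray, the linear term of agent 1 is gone and its positive quadratic term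
      -- decides. Agent 2 has rate zero there in all modes, but a derivative of the sign of
      -- `a^2_{11}`.
      by_cases hV' : G.grad1 (phaseVec p.2) = 0
      · have hU' := G.grad0_ne_zero_of_grad1 hΔ (phaseVec_ne_zero p.2) hV'
        have he : G.A 1 0 0 ≠ 0 := by
          intro he
          have : G.A 1 0 1 ^ 2 = 0 := by simpa [hessDet, he] using hP
          exact hc (pow_eq_zero_iff two_ne_zero |>.1 this)
        refine ⟨0, 1, by decide, 1, G.A 1 0 0, fun k => ?_, fun k _ => ?_⟩
        · have h0 := G.alpha_pos k 0
          rw [h.rate_zero_phase, scaledRate, hV']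
          have : 1 * (p.1 * (p.1 * (G.alpha k 0 * G.grad0 (phaseVec p.2) ^ 2) + G.alpha k 1 * 0 *
            (G.slope xs + p.1 * (G.A 0 0 1 * Real.cos p.2 + G.A 0 1 1 * Real.sin p.2)))) =
            p.1 ^ 2 * (G.alpha k 0 * G.grad0 (phaseVec p.2) ^ 2) := by ring
          rw [this]
          positivity
        · have h0 := G.alpha_pos k 0
          have hw : G.A 1 0 0 * phaseVec p.2 0 + G.A 1 0 1 * phaseVec p.2 1 = 0 := by
            have e : G.det0 * (G.A 1 0 0 * phaseVec p.2 0 + G.A 1 0 1 * phaseVec p.2 1) = 0 := by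
              have : G.det0 * (G.A 1 0 0 * phaseVec p.2 0 + G.A 1 0 1 * phaseVec p.2 1)
                = G.hessDet * G.grad0 (phaseVec p.2) + G.mixedCoeff * G.grad1 (phaseVec p.2) := by
                simp only [det0, hessDet, mixedCoeff, grad0, grad1]; ring
              rw [this, hP, hV']; ring
            exact (mul_eq_zero.1 e).resolve_left hΔ.ne'
          rw [h.drate_one_smul, h.drate_one_add, hw, hV']
          have : G.A 1 0 0 * (p.1 ^ 2 * (G.alpha k 0 * (G.A 0 0 0 * (G.alpha k 0 *
              G.grad0 (phaseVec p.2)) + G.A 0 0 1 * (G.alpha k 1 * 0)) * 0 + G.alpha k 0 *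
              G.grad0 (phaseVec p.2) * (G.A 1 0 0 * (G.alpha k 0 * G.grad0 (phaseVec p.2))
              + G.A 1 0 1 * (G.alpha k 1 * 0)) + 2 * G.alpha k 1 * 0 * (G.A 1 0 1 * (G.alpha k 0 *
              G.grad0 (phaseVec p.2)) + G.A 1 1 1 * (G.alpha k 1 * 0)))) =
              (p.1 * G.A 1 0 0 * G.alpha k 0 * G.grad0 (phaseVec p.2)) ^ 2 := by ring
          rw [this]
          positivity
      · refine ⟨1, 0, by decide, σ * G.grad1 (phaseVec p.2), ε, fun k => ?_, first p hp hp1⟩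
        rw [h.rate_one_smul]
        have e : G.det0 * (σ * G.grad1 (phaseVec p.2) *
            (p.1 ^ 2 * G.rate k 1 (xs + phaseVec p.2))) =
            p.1 ^ 2 * G.grad1 (phaseVec p.2) ^ 2 * (σ * (G.alpha k 0 * G.mixedCoeff *
          G.grad0 (phaseVec p.2) + G.alpha k 1 * G.det0 * G.grad1 (phaseVec p.2))) := by
          have := h.det0_mul_rate k (phaseVec p.2)
          rw [hP] at this
          linear_combination (σ * G.grad1 (phaseVec p.2) * p.1 ^ 2) * this
        have := hp2 k
        refine pos_of_mul_pos_right (a := G.det0) ?_ hΔ.le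
        rw [e]
        positivity
    · have d2 : ∀ᶠ p : ℝ × ℝ in 𝓝 (0, θ), ∀ k : Mode,
          0 < G.hessDet * G.rate k 1 (xs + phaseVec p.2) := by
        refine eventually_all.2 fun k => ?_
        have hc : Continuous fun p : ℝ × ℝ => G.hessDet * G.rate k 1 (xs + phaseVec p.2) :=
          ((G.continuous_rate k 1).comp (continuous_const.add
            (continuous_phaseVec.comp continuous_snd))).const_mul _
        refine (hc.tendsto (0, θ)).eventually_const_lt ?_
        have h0 := G.alpha_pos k 0
        have e := h.det0_mul_rate k (phaseVec θ)
        rw [hV] at e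
        have e2 : G.det0 * (G.hessDet * G.rate k 1 (xs + phaseVec θ)) =
          G.alpha k 0 * (G.hessDet * G.grad0 (phaseVec θ)) ^ 2 := by
          linear_combination G.hessDet * e
        refine pos_of_mul_pos_right (a := G.det0) ?_ hΔ.le
        simp only [e2]
        positivity
      filter_upwards [d1, d2] with p hp1 hp2 hp
      refine ⟨1, 0, by decide, G.hessDet, ε, fun k => ?_, first p hp hp1⟩
      rw [h.rate_one_smul]
      have := mul_pos (pow_pos hp 2) (hp2 k)
      linarith
  · set σ := G.slope xs * G.grad1 (phaseVec θ) with hσ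
    have d1 : ∀ᶠ p : ℝ × ℝ in 𝓝 (0, θ), ∀ k, 0 < σ * G.scaledRate xs k p.1 p.2 := by
      refine eventually_all.2 fun k => ?_
      refine (((G.continuous_scaledRate xs k).const_mul σ).tendsto (0, θ)).eventually_const_lt ?_
      have h1 := G.alpha_pos k 1
      have : σ * G.scaledRate xs k 0 θ = G.alpha k 1 * σ ^ 2 := by
        simp only [scaledRate, hσ]
        ring
      simp only [this]
      have : σ ≠ 0 := by positivity
      positivity
    filter_upwards [d1, cV.continuousAt.eventually_ne (x := (0, θ)) hV] with p hp1 hp2 hp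
    refine ⟨0, 1, by decide, σ, -(G.rotation * (G.grad1 (p.1 • phaseVec p.2) *
      (2 * G.hessDet * G.grad0 (p.1 • phaseVec p.2)
        + G.mixedCoeff * G.grad1 (p.1 • phaseVec p.2)))), fun k => ?_, fun k hk => ?_⟩
    · rw [h.rate_zero_phase]
      have := mul_pos hp (hp1 k)
      linarith
    · exact h.transversal_of_grad1_ne k
        (y := p.1 • phaseVec p.2) (by rw [grad1_smul]; positivity) hk

end Mixed

end LossAverseGame

/-! ### Identification of the plane with the complex numbers -/

/-- The plane as the complex numbers. -/
def toComplex (y : Fin 2 → ℝ) : ℂ := ⟨y 0, y 1⟩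

theorem continuous_toComplex : Continuous toComplex := by
  have : toComplex = fun y : Fin 2 → ℝ => (y 0 : ℂ) + (y 1 : ℂ) * Complex.I := by
    funext y
    apply Complex.ext <;> simp [toComplex]
  rw [this]
  fun_prop

theorem toComplex_eq_zero {y : Fin 2 → ℝ} : toComplex y = 0 ↔ y = 0 := by
  constructor
  · intro h
    have h0 := congrArg Complex.re h
    have h1 := congrArg Complex.im h
    ext i
    fin_cases i
    · simpa [toComplex] using h0
    · simpa [toComplex] using h1
  · rintro rfl
    rfl

theorem eq_smul_phaseVec_of_exp {y : Fin 2 → ℝ} {l : ℂ} (h : toComplex y = Complex.exp l) :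
    y = Real.exp l.re • phaseVec l.im := by
  have h0 := congrArg Complex.re h
  have h1 := congrArg Complex.im h
  rw [Complex.exp_re] at h0
  rw [Complex.exp_im] at h1
  ext i
  fin_cases i
  · simpa [toComplex] using h0
  · simpa [toComplex] using h1

theorem exists_smul_phaseVec {y : Fin 2 → ℝ} (hy : y ≠ 0) :
    ∃ θ ∈ Set.Icc (-Real.pi) Real.pi, y = ‖toComplex y‖ • phaseVec θ := by
  have h0 : toComplex y ≠ 0 := fun h => hy (toComplex_eq_zero.1 h)
  refine ⟨(toComplex y).arg, ⟨(Complex.neg_pi_lt_arg _).le, Complex.arg_le_pi _⟩, ?_⟩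
  have := eq_smul_phaseVec_of_exp (Complex.exp_log h0).symm
  rwa [Complex.log_re, Complex.log_im, Real.exp_log (norm_pos_iff.2 h0)] at this

theorem norm_le_norm_toComplex (y : Fin 2 → ℝ) : ‖y‖ ≤ ‖toComplex y‖ := by
  rw [pi_norm_le_iff_of_nonneg (norm_nonneg _)]
  intro i
  fin_cases i
  · exact Complex.abs_re_le_norm (toComplex y)
  · exact Complex.abs_im_le_norm (toComplex y)

theorem LossAverseGame.Mixed.exists_radius_nondeg {G : LossAverseGame} {xs : Fin 2 → ℝ}
    (h : G.Mixed xs) :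
    ∃ r > 0, ∀ x, x ≠ xs → ‖toComplex (x - xs)‖ < r → G.Nondeg x := by
  have := (isCompact_Icc (a := -Real.pi) (b := Real.pi)).eventually_forall_of_forall_eventually
    (x₀ := (0 : ℝ)) (P := fun r θ => 0 < r → G.Nondeg (xs + r • phaseVec θ))
    fun θ _ => h.nondeg_near_phase θ
  obtain ⟨r, hr, hball⟩ := Metric.eventually_nhds_iff.1 this
  refine ⟨r, hr, fun x hx hxr => ?_⟩
  have hy : x - xs ≠ 0 := sub_ne_zero.2 hx
  obtain ⟨θ, hθ, e⟩ := exists_smul_phaseVec hy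
  have hpos : 0 < ‖toComplex (x - xs)‖ := norm_pos_iff.2 fun h0 => hy (toComplex_eq_zero.1 h0)
  have := hball (y := ‖toComplex (x - xs)‖) (by simpa using hxr) θ hθ hpos
  rwa [← e, add_sub_cancel] at this

/-! ### Approximated domains, effective domains and robust phases -/

/-- A quadratic that increases at `n₀` reaches positive values before it decreases below its value
at `n₀`, provided that its vertex is positive when it is a maximum. -/
theorem exists_quadratic_pos {A P q β γ n₀ : ℝ} (hA : 0 < A) (hβ : 4 * P * β < A * q ^ 2)
    (hd : 0 < 2 * P * n₀ + q) (hβ0 : A * (P * n₀ ^ 2 + q * n₀) + β < 0)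
    (hγ0 : 0 < A * (P * n₀ ^ 2 + q * n₀) + γ) :
    ∃ n₁ > n₀, 0 < A * (P * n₁ ^ 2 + q * n₁) + β ∧
      ∀ n ∈ Set.Icc n₀ n₁, 0 < A * (P * n ^ 2 + q * n) + γ := by
  have step : ∀ t δ, A * (P * (n₀ + t) ^ 2 + q * (n₀ + t)) + δ =
      A * (P * n₀ ^ 2 + q * n₀) + δ + A * (t * (2 * P * n₀ + q + P * t)) := by
    intro t δ; ring
  rcases le_or_gt 0 P with hP | hP
  · set d := 2 * P * n₀ + q
    set F := A * (P * n₀ ^ 2 + q * n₀) + β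
    have ht : 0 < (1 - F) / (A * d) := div_pos (by linarith) (by positivity)
    -- The linear term alone lifts the value from `F` to `1`, and the quadratic term does not hurt
    -- since `P ≥ 0`.
    refine ⟨n₀ + (1 - F) / (A * d), by linarith, ?_, fun n hn => ?_⟩
    · rw [step]
      have e : A * ((1 - F) / (A * d) * (d + P * ((1 - F) / (A * d)))) =
          (1 - F) + A * P * ((1 - F) / (A * d)) ^ 2 := by
        field_simp
      have : 0 ≤ A * P * ((1 - F) / (A * d)) ^ 2 := by positivity
      linarith
    · have e := step (n - n₀) γ
      rw [add_sub_cancel] at e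
      have h0 : 0 ≤ n - n₀ := by linarith [hn.1]
      have : 0 ≤ A * ((n - n₀) * (d + P * (n - n₀))) := by positivity
      linarith
  · have hP0 := hP.ne
    set d := 2 * P * n₀ + q with hdd
    have ht : 0 < d / (2 * (-P)) := div_pos hd (by linarith)
    -- This is the vertex, where the value is positive by `hβ`.
    refine ⟨n₀ + d / (2 * (-P)), by linarith, ?_, fun n hn => ?_⟩
    · have e : n₀ + d / (2 * (-P)) = q / (2 * (-P)) := by
        rw [hdd]; field_simp; ring
      rw [e]
      have e2 : A * (P * (q / (2 * (-P))) ^ 2 + q * (q / (2 * (-P)))) + β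
        = (A * q ^ 2 - 4 * P * β) / (4 * (-P)) := by
        field_simp; ring
      rw [e2]
      exact div_pos (by linarith) (by linarith)
    · have e := step (n - n₀) γ
      rw [add_sub_cancel] at e
      have h0 : 0 ≤ n - n₀ := by linarith [hn.1]
      have h1 : n - n₀ ≤ d / (2 * (-P)) := by linarith [hn.2]
      have h2 : (n - n₀) * (2 * (-P)) ≤ d := (le_div_iff₀ (by linarith)).1 h1
      have : 0 ≤ A * ((n - n₀) * (d + P * (n - n₀))) := by
        apply mul_nonneg hA.le
        apply mul_nonneg h0
        nlinarith
      linarith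

/-- This settles overlaps of two domains. The two expressions are the rates of agent 2 in the modes
with its level `L` and `H`, with `n` the ratio of `grad0` to `grad1` up to `rotation`. As `n` grows,
i.e. backwards along the rotation, one of the two modes becomes impossible while the other remains
possible. -/
theorem exists_quadratic_sign {A P q β γ n₀ : ℝ} (hA : 0 < A) (hβ : 4 * P * β < A * q ^ 2)
    (hγ : 4 * P * γ < A * q ^ 2) (hβ0 : A * (P * n₀ ^ 2 + q * n₀) + β < 0)
    (hγ0 : 0 < A * (P * n₀ ^ 2 + q * n₀) + γ) :
    ∃ n₁ > n₀, (0 < A * (P * n₁ ^ 2 + q * n₁) + β ∧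
        ∀ n ∈ Set.Icc n₀ n₁, 0 < A * (P * n ^ 2 + q * n) + γ) ∨
      (A * (P * n₁ ^ 2 + q * n₁) + γ < 0 ∧
        ∀ n ∈ Set.Icc n₀ n₁, A * (P * n ^ 2 + q * n) + β < 0) := by
  rcases lt_trichotomy (2 * P * n₀ + q) 0 with hd | hd | hd
  · obtain ⟨n₁, h1, h2, h3⟩ := exists_quadratic_pos (A := A) (P := -P) (q := -q) (β := -γ) (γ := -β)
      (n₀ := n₀) hA (by linarith) (by linarith) (by linarith) (by linarith)
    exact ⟨n₁, h1, Or.inr ⟨by linarith, fun n hn => by linarith [h3 n hn]⟩⟩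
  -- At a vertex the two discriminant conditions make `4 * P` times either value negative, but the
  -- two values have opposite signs.
  · exfalso
    have e : ∀ δ, 4 * P * (A * (P * n₀ ^ 2 + q * n₀) + δ) = 4 * P * δ - A * q ^ 2 := by
      intro δ
      linear_combination A * (2 * P * n₀ + q) * hd
    have h1 := e β
    have h2 := e γ
    rcases le_or_gt 0 P with hP | hP
    · have : 0 ≤ 4 * P * (A * (P * n₀ ^ 2 + q * n₀) + γ) := by positivity
      linarith
    · have : 0 < 4 * P * (A * (P * n₀ ^ 2 + q * n₀) + β) := by nlinarith
      linarith
  · obtain ⟨n₁, h1, h2, h3⟩ := exists_quadratic_pos hA hβ hd hβ0 hγ0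
    exact ⟨n₁, h1, Or.inl ⟨h2, h3⟩⟩

/-- Numerator and denominator on the left are two linear forms after a turn back by an angle with
cosine `c` and sine `s`; their ratio changes by a term whose sign is under control. -/
theorem ratio_identity {U V U' V' ω Δ c s : ℝ} (hω : ω * ω = 1) (hΔ : U * V' - U' * V = Δ)
    (hV : V ≠ 0) (hD : V * c - ω * V' * s ≠ 0) :
    ω * ((U * c - ω * U' * s) / (V * c - ω * V' * s)) =
      ω * (U / V) + Δ * s / (V * (V * c - ω * V' * s)) := by
  generalize h : V * c - ω * V' * s = D at *
  field_simp
  linear_combination (s * (U * V' - U' * V)) * hω + s * hΔ + (ω * U) * h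

theorem mul_neg_iff_of_pos {a b : ℝ} (ha : 0 < a) : a * b < 0 ↔ b < 0 := by
  constructor <;> intro h <;> nlinarith

namespace LossAverseGame

noncomputable section

variable (G : LossAverseGame)

/-- The state `xs + phaseVec θ` is in the interior of the approximated domain of mode `k`. -/
def StrictPhase (xs : Fin 2 → ℝ) (k : Mode) (θ : ℝ) : Prop :=
  0 < (k 0).sgn * (G.slope xs * G.grad1 (phaseVec θ)) ∧
    0 < (k 1).sgn * G.rate k 1 (xs + phaseVec θ)

/-- The state `xs + phaseVec θ` is in no approximated domain but possibly that of mode `k`. -/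
def OnlyPhase (xs : Fin 2 → ℝ) (k : Mode) (θ : ℝ) : Prop :=
  ∀ j, j ≠ k → xs + phaseVec θ ∉ G.approxDomain xs j

/-- The mode `k` has been active on an arc that ends at the phase `θ`, and was without alternative
at the start of the arc. -/
def Robust (xs : Fin 2 → ℝ) (k : Mode) (θ : ℝ) : Prop :=
  ∃ s > 0, (∀ s' ∈ Set.Icc 0 s, G.StrictPhase xs k (θ - G.rotation * s')) ∧
    G.OnlyPhase xs k (θ - G.rotation * s)

variable {G} {xs : Fin 2 → ℝ}

theorem phaseVec_sub (θ s : ℝ) : phaseVec (θ - G.rotation * s) =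
    ![Real.cos θ * Real.cos s + G.rotation * (Real.sin θ * Real.sin s),
      Real.sin θ * Real.cos s - G.rotation * (Real.cos θ * Real.sin s)] := by
  ext i
  unfold rotation
  split_ifs
  · fin_cases i
    · simp [Real.cos_sub]
    · simp [Real.sin_sub]
  · fin_cases i
    · simp [Real.cos_add, sub_eq_add_neg]
    · simp [Real.sin_add]

namespace Mixed

theorem fderiv_rate_zero (h : G.Mixed xs) (k : Mode) (y : Fin 2 → ℝ) :
    fderiv ℝ (G.rate k 0) xs y = G.alpha k 1 * (G.slope xs * G.grad1 y) := by
  have hd : DifferentiableAt ℝ (G.rate k 0) xs := by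
    have : G.rate k 0 = fun x => ∑ j, (G.A 0 *ᵥ x + G.b 0) j *
        (G.alpha k j * (G.A j *ᵥ x + G.b j) j) := by
      funext x; exact G.rate_eq k 0 x
    rw [this]
    simp only [mulVec, dotProduct, Fin.sum_univ_two, Pi.add_apply]
    fun_prop
  rw [← hd.lineDeriv_eq_fderiv]
  have e : (fun t : ℝ => G.rate k 0 (xs + t • y)) = fun t =>
      (G.alpha k 0 * G.grad0 y ^ 2 + G.alpha k 1 * G.grad1 y *
        (G.A 0 0 1 * y 0 + G.A 0 1 1 * y 1)) * t ^ 2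
      + G.alpha k 1 * (G.slope xs * G.grad1 y) * t := by
    funext t
    rw [h.rate_zero_add, grad0_smul, grad1_smul]
    simp
    ring
  rw [lineDeriv, e]
  have := (((hasDerivAt_id (0 : ℝ)).pow 2).const_mul (G.alpha k 0 * G.grad0 y ^ 2
    + G.alpha k 1 * G.grad1 y * (G.A 0 0 1 * y 0 + G.A 0 1 1 * y 1))).add
    ((hasDerivAt_id (0 : ℝ)).const_mul (G.alpha k 1 * (G.slope xs * G.grad1 y)))
  refine (this.congr_deriv ?_).deriv
  simp

theorem mem_approxDomain (h : G.Mixed xs) {k : Mode} {θ : ℝ} :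
    xs + phaseVec θ ∈ G.approxDomain xs k ↔
      0 ≤ (k 0).sgn * (G.slope xs * G.grad1 (phaseVec θ)) ∧
      0 ≤ (k 1).sgn * G.rate k 1 (xs + phaseVec θ) := by
  have hα := G.alpha_pos k 1
  simp only [approxDomain, Set.mem_ofPred_eq, Level.compatible_iff, add_sub_cancel_left,
    h.fderiv_rate_zero]
  refine and_congr_left fun _ => ?_
  rw [mul_left_comm]
  exact mul_nonneg_iff_of_pos_left hα

theorem mem_of_strictPhase (h : G.Mixed xs) {k : Mode} {θ : ℝ} (hs : G.StrictPhase xs k θ) :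
    xs + phaseVec θ ∈ G.approxDomain xs k :=
  h.mem_approxDomain.2 ⟨hs.1.le, hs.2.le⟩

theorem continuous_rate_phase (G : LossAverseGame) (xs : Fin 2 → ℝ) (k : Mode) :
    Continuous fun θ => G.rate k 1 (xs + phaseVec θ) :=
  (G.continuous_rate k 1).comp (continuous_const.add continuous_phaseVec)

theorem strictPhase_eventually {k : Mode} {θ : ℝ} (hs : G.StrictPhase xs k θ) :
    ∀ᶠ θ' in 𝓝 θ, G.StrictPhase xs k θ' :=
  (((G.continuous_grad1.const_mul (G.slope xs)).const_mul (k 0).sgn).tendsto θ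
    |>.eventually_const_lt hs.1).and
  (((continuous_rate_phase G xs k).const_mul (k 1).sgn).tendsto θ |>.eventually_const_lt hs.2)

theorem onlyPhase_eventually (h : G.Mixed xs) {k : Mode} {θ : ℝ} (hs : G.OnlyPhase xs k θ) :
    ∀ᶠ θ' in 𝓝 θ, G.OnlyPhase xs k θ' := by
  refine eventually_all.2 fun j => ?_
  by_cases hj : j = k
  · exact Eventually.of_forall fun θ' h' => absurd hj h'
  · have := hs j hj
    rw [h.mem_approxDomain, not_and_or, not_le, not_le] at this
    rcases this with h0 | h0
    · filter_upwards [(((G.continuous_grad1.const_mul (G.slope xs)).const_mul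
        (j 0).sgn).tendsto θ).eventually_lt_const h0] with θ' h1 _ h2
      exact absurd (h.mem_approxDomain.1 h2).1 (not_le.2 h1)
    · filter_upwards [(((continuous_rate_phase G xs j).const_mul
        (j 1).sgn).tendsto θ).eventually_lt_const h0] with θ' h1 _ h2
      exact absurd (h.mem_approxDomain.1 h2).2 (not_le.2 h1)

theorem robust_of_only (h : G.Mixed xs) {k : Mode} {θ : ℝ} (hs : G.StrictPhase xs k θ)
    (ho : G.OnlyPhase xs k θ) : G.Robust xs k θ := by
  obtain ⟨ε, hε, hb⟩ := Metric.eventually_nhds_iff.1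
    ((strictPhase_eventually hs).and (h.onlyPhase_eventually ho))
  have hω : |G.rotation| = 1 := by unfold rotation; split_ifs <;> simp
  have hd : ∀ s, 0 ≤ s → s ≤ ε / 2 → dist (θ - G.rotation * s) θ < ε := by
    intro s h0 h1
    rw [Real.dist_eq, sub_sub_cancel_left, abs_neg, abs_mul, hω, one_mul, abs_of_nonneg h0]
    linarith
  exact ⟨ε / 2, by positivity, fun s hs => (hb (hd s hs.1 hs.2)).1,
    (hb (hd _ (by positivity) le_rfl)).2⟩

theorem rotation_cases (G : LossAverseGame) : G.rotation = 1 ∨ G.rotation = -1 := by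
  unfold rotation; split_ifs <;> simp

/-- The start of the arc is kept, and only its length is adjusted to the new end. -/
theorem robust_eventually {k : Mode} {θ : ℝ} (hs : G.Robust xs k θ) :
    ∀ᶠ θ' in 𝓝 θ, G.Robust xs k θ' := by
  obtain ⟨s, h0, h1, h2⟩ := hs
  have hθ : G.StrictPhase xs k θ := by simpa using h1 0 ⟨le_rfl, h0.le⟩
  obtain ⟨ε, hε, hb⟩ := Metric.eventually_nhds_iff.1 (strictPhase_eventually hθ)
  filter_upwards [Metric.ball_mem_nhds θ (lt_min hε h0)] with θ' hθ'
  have hd : |θ' - θ| < min ε s := hθ'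
  have hω := rotation_sq G
  have hω' : |G.rotation * (θ' - θ)| < min ε s := by
    rcases rotation_cases G with h | h <;> rw [h] <;> simpa [abs_sub_comm] using hd
  have hlt := abs_lt.1 (hω'.trans_le (min_le_right _ _))
  refine ⟨s + G.rotation * (θ' - θ), by linarith, fun s' hs' => ?_, ?_⟩
  · have e : θ' - G.rotation * s' = θ - G.rotation * (s' - G.rotation * (θ' - θ)) := by
      linear_combination (-(θ' - θ)) * hω
    rcases le_or_gt 0 (s' - G.rotation * (θ' - θ)) with h3 | h3
    · rw [e]
      exact h1 _ ⟨h3, by linarith [hs'.2]⟩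
    · apply hb
      rw [e, Real.dist_eq, sub_sub_cancel_left, abs_neg, abs_mul]
      have : |G.rotation| = 1 := by rcases rotation_cases G with h | h <;> simp [h]
      rw [this, one_mul, abs_of_neg h3]
      have := (le_abs_self _).trans_lt (hω'.trans_le (min_le_left _ _))
      linarith [hs'.1]
  · have e : θ' - G.rotation * (s + G.rotation * (θ' - θ)) = θ - G.rotation * s := by
      linear_combination (-(θ' - θ)) * hω
    rwa [e]

theorem effectivePhases_of_robust (h : G.Mixed xs) {k : Mode} {θ : ℝ} (hs : G.Robust xs k θ) :
    θ ∈ G.effectivePhases xs k := by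
  obtain ⟨s, h0, h1, h2⟩ := hs
  exact ⟨s, h0.le, h2, fun s' hs' => h.mem_of_strictPhase (h1 s' hs')⟩

/-- The start of the shorter arc lies on the longer one, and at that start only one mode is
possible. -/
theorem effectivePhases_unique {k k' : Mode} {θ : ℝ} (hk : θ ∈ G.effectivePhases xs k)
    (hk' : θ ∈ G.effectivePhases xs k') : k = k' := by
  obtain ⟨s, h0, h1, h2⟩ := hk
  obtain ⟨s', h0', h1', h2'⟩ := hk'
  rcases le_total s s' with hss | hss
  · by_contra hne
    exact h1 k' (Ne.symm hne) (h2' s ⟨h0, hss⟩)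
  · by_contra hne
    exact h1' k hne (h2 s' ⟨h0', hss⟩)

theorem effectivePhases_congr {k : Mode} {θ θ' : ℝ} (e : phaseVec θ = phaseVec θ')
    (hk : θ ∈ G.effectivePhases xs k) : θ' ∈ G.effectivePhases xs k := by
  have e0 := congrFun e 0
  have e1 := congrFun e 1
  simp only [phaseVec_zero, phaseVec_one] at e0 e1
  have key : ∀ s, phaseVec (θ' - G.rotation * s) = phaseVec (θ - G.rotation * s) := by
    intro s
    rw [phaseVec_sub, phaseVec_sub, e0, e1]
  obtain ⟨s, h0, h1, h2⟩ := hk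
  exact ⟨s, h0, fun j hj => by rw [key]; exact h1 j hj, fun s' hs' => by rw [key]; exact h2 s' hs'⟩

theorem mem_effectiveDomain {k : Mode} {θ : ℝ} :
    xs + phaseVec θ ∈ G.effectiveDomain xs k ↔ θ ∈ G.effectivePhases xs k := by
  constructor
  · rintro ⟨r, hr, θ', hθ', e⟩
    have e := add_left_cancel e
    have e0 := congrFun e 0
    have e1 := congrFun e 1
    simp only [phaseVec_zero, phaseVec_one, Pi.smul_apply, smul_eq_mul] at e0 e1
    have h1 : r ^ 2 = 1 := by
      have a := Real.sin_sq_add_cos_sq θ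
      have b := Real.sin_sq_add_cos_sq θ'
      rw [e0, e1] at a
      linear_combination a - r ^ 2 * b
    have : r = 1 := by nlinarith
    rw [this, one_smul] at e
    exact effectivePhases_congr e.symm hθ'
  · intro h
    exact ⟨1, zero_le_one, θ, h, by simp⟩

theorem activeMode_of_robust (h : G.Mixed xs) {k : Mode} {θ : ℝ} (hs : G.Robust xs k θ) :
    G.activeMode xs θ = k := by
  have hk := mem_effectiveDomain.2 (h.effectivePhases_of_robust hs)
  have := Classical.epsilon_spec_aux (p := fun k => xs + phaseVec θ ∈ G.effectiveDomain xs k)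
    ⟨fun _ => Level.L⟩ ⟨k, hk⟩
  exact effectivePhases_unique (mem_effectiveDomain.1 this) (h.effectivePhases_of_robust hs)

/-- Going back from a phase `θ` with `grad1 ≠ 0` against the rotation, the ratio of `grad0` and
`grad1` increases to any larger value before `grad1` vanishes. -/
theorem exists_arc (h : G.Mixed xs) {θ n₁ : ℝ} (hV : G.grad1 (phaseVec θ) ≠ 0)
    (hn : G.rotation * (G.grad0 (phaseVec θ) / G.grad1 (phaseVec θ)) < n₁) :
    ∃ s > 0, (∀ s' ∈ Set.Icc 0 s,
      0 < G.grad1 (phaseVec θ) * G.grad1 (phaseVec (θ - G.rotation * s')) ∧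
      G.rotation * (G.grad0 (phaseVec (θ - G.rotation * s')) /
        G.grad1 (phaseVec (θ - G.rotation * s'))) ∈
        Set.Icc (G.rotation * (G.grad0 (phaseVec θ) / G.grad1 (phaseVec θ))) n₁) ∧
      G.rotation * (G.grad0 (phaseVec (θ - G.rotation * s)) /
        G.grad1 (phaseVec (θ - G.rotation * s))) = n₁ := by
  have hΔ := h.det0_pos
  have hω := rotation_sq G
  set ω := G.rotation with hωd
  set V := G.grad1 (phaseVec θ) with hVd
  set U := G.grad0 (phaseVec θ) with hUd
  set V' := G.A 1 1 1 * Real.cos θ - G.A 1 0 1 * Real.sin θ with hV'd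
  set U' := G.A 0 0 1 * Real.cos θ - G.A 0 0 0 * Real.sin θ with hU'd
  have hVs : ∀ s, G.grad1 (phaseVec (θ - ω * s)) = V * Real.cos s - ω * V' * Real.sin s := by
    intro s
    rw [hωd, phaseVec_sub, hVd, hV'd]
    simp [grad1]
    ring
  have hUs : ∀ s, G.grad0 (phaseVec (θ - ω * s)) = U * Real.cos s - ω * U' * Real.sin s := by
    intro s
    rw [hωd, phaseVec_sub, hUd, hU'd]
    simp [grad0]
    ring
  have hcross : U * V' - U' * V = G.det0 := by
    simp only [hUd, hVd, hU'd, hV'd, grad0, grad1, det0, phaseVec_zero, phaseVec_one]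
    linear_combination (G.A 0 0 0 * G.A 1 1 1 - G.A 0 0 1 * G.A 1 0 1) *
      Real.sin_sq_add_cos_sq θ
  set δ := n₁ - ω * (U / V) with hδ
  have hδ0 : 0 < δ := by linarith
  -- By `ratio_identity` the ratio has grown by `δ` after the angle `s` with `det0 * sin s = δ * V *
  -- (V * cos s - ω * V' * sin s)`. The solution in `(0, π)` is the argument of this number.
  let z : ℂ := ⟨G.det0 + δ * (ω * V * V'), δ * V ^ 2⟩
  have hzim : 0 < z.im := by
    change 0 < δ * V ^ 2
    positivity
  have hz0 : z ≠ 0 := fun h0 => by rw [h0] at hzim; simp at hzim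
  have hρ : 0 < ‖z‖ := norm_pos_iff.2 hz0
  have hs0 : 0 < z.arg := by
    rcases (Complex.arg_nonneg_iff.2 hzim.le).eq_or_lt with h0 | h0
    · exfalso
      rw [eq_comm, Complex.arg_eq_zero_iff] at h0
      exact hzim.ne' h0.2
    · exact h0
  have hspi : z.arg < Real.pi := by
    rcases (Complex.arg_le_pi z).eq_or_lt with h0 | h0
    · rw [Complex.arg_eq_pi_iff] at h0
      exact absurd h0.2 hzim.ne'
    · exact h0
  have hc : ‖z‖ * Real.cos z.arg = G.det0 + δ * (ω * V * V') := Complex.norm_mul_cos_arg z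
  have hsn : ‖z‖ * Real.sin z.arg = δ * V ^ 2 := Complex.norm_mul_sin_arg z
  set s := z.arg with hsd
  have hsin : 0 < Real.sin s := Real.sin_pos_of_pos_of_lt_pi hs0 hspi
  have hend : G.det0 * Real.sin s = δ * (V * (V * Real.cos s - ω * V' * Real.sin s)) := by
    apply mul_left_cancel₀ hρ.ne'
    linear_combination (G.det0 + δ * ω * V * V') * hsn - δ * V ^ 2 * hc
  -- Sinusoidal interpolation between the end points of the arc: positivity of `V` times `grad1` at
  -- both ends passes to the whole arc.
  have hmid : ∀ s', Real.sin s * (V * (V * Real.cos s' - ω * V' * Real.sin s')) =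
      Real.sin (s - s') * V ^ 2 + Real.sin s' * (V * (V * Real.cos s - ω * V' * Real.sin s)) := by
    intro s'
    rw [Real.sin_sub]
    ring
  have hratio : ∀ s', V * Real.cos s' - ω * V' * Real.sin s' ≠ 0 →
      ω * ((U * Real.cos s' - ω * U' * Real.sin s') / (V * Real.cos s' - ω * V' * Real.sin s')) =
      ω * (U / V) + G.det0 * Real.sin s' / (V * (V * Real.cos s' - ω * V' * Real.sin s')) := by
    intro s' hne
    exact ratio_identity hω hcross hV hne
  have hVV : 0 < V * (V * Real.cos s - ω * V' * Real.sin s) := by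
    have : 0 < δ * (V * (V * Real.cos s - ω * V' * Real.sin s)) := by
      rw [← hend]; positivity
    exact pos_of_mul_pos_right this hδ0.le
  refine ⟨s, hs0, fun s' hs' => ?_, ?_⟩
  · have hsin' : 0 ≤ Real.sin s' :=
      Real.sin_nonneg_of_nonneg_of_le_pi hs'.1 (hs'.2.trans hspi.le)
    have hsin2 : 0 ≤ Real.sin (s - s') :=
      Real.sin_nonneg_of_nonneg_of_le_pi (by linarith [hs'.2]) (by linarith [hs'.1])
    have hV2 : 0 < V ^ 2 := by positivity
    have hpos : 0 < V * (V * Real.cos s' - ω * V' * Real.sin s') := by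
      refine pos_of_mul_pos_right (a := Real.sin s) ?_ hsin.le
      rw [hmid]
      rcases hs'.1.eq_or_lt with h0 | h0
      · rw [← h0, sub_zero]
        have := mul_pos hsin hV2
        simpa using this
      · have : 0 < Real.sin s' := Real.sin_pos_of_pos_of_lt_pi h0 (hs'.2.trans_lt hspi)
        have := mul_pos this hVV
        have := mul_nonneg hsin2 hV2.le
        linarith
    rw [hVs, hUs]
    refine ⟨hpos, ?_⟩
    rw [hratio s' (right_ne_zero_of_mul hpos.ne')]
    constructor
    · have : 0 ≤ G.det0 * Real.sin s' / (V * (V * Real.cos s' - ω * V' * Real.sin s')) := by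
        positivity
      linarith
    · have : G.det0 * Real.sin s' / (V * (V * Real.cos s' - ω * V' * Real.sin s')) ≤ δ := by
        rw [div_le_iff₀ hpos]
        refine le_of_mul_le_mul_left ?_ hsin
        have e : Real.sin s * (δ * (V * (V * Real.cos s' - ω * V' * Real.sin s'))) =
            δ * (Real.sin (s - s') * V ^ 2) + Real.sin s' * (G.det0 * Real.sin s) := by
          linear_combination δ * hmid s' - Real.sin s' * hend
        rw [e]
        have : 0 ≤ δ * (Real.sin (s - s') * V ^ 2) := by positivity
        linarith
      linarith
  · rw [hVs, hUs, hratio s (right_ne_zero_of_mul hVV.ne'), hend, mul_div_assoc, div_self hVV.ne']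
    linarith

theorem rate_phase_eq (h : G.Mixed xs) (k : Mode) {θ : ℝ} (hV : G.grad1 (phaseVec θ) ≠ 0) :
    G.det0 * G.rate k 1 (xs + phaseVec θ) = G.grad1 (phaseVec θ) ^ 2 *
      (G.alpha k 0 * (G.hessDet * (G.rotation * (G.grad0 (phaseVec θ) / G.grad1 (phaseVec θ))) ^ 2
        + (G.rotation * G.mixedCoeff) *
          (G.rotation * (G.grad0 (phaseVec θ) / G.grad1 (phaseVec θ))))
        + G.alpha k 1 * G.det0) := by
  have hω := rotation_sq G
  have e1 : (G.rotation * (G.grad0 (phaseVec θ) / G.grad1 (phaseVec θ))) ^ 2 =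
      (G.grad0 (phaseVec θ) / G.grad1 (phaseVec θ)) ^ 2 := by
    linear_combination (G.grad0 (phaseVec θ) / G.grad1 (phaseVec θ)) ^ 2 * hω
  have e2 : (G.rotation * G.mixedCoeff) *
      (G.rotation * (G.grad0 (phaseVec θ) / G.grad1 (phaseVec θ))) =
      G.mixedCoeff * (G.grad0 (phaseVec θ) / G.grad1 (phaseVec θ)) := by
    linear_combination (G.mixedCoeff * (G.grad0 (phaseVec θ) / G.grad1 (phaseVec θ))) * hω
  rw [e1, e2, h.det0_mul_rate]
  field_simp

theorem mode_eq (k : Mode) : k = ![k 0, k 1] := by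
  ext i; fin_cases i <;> rfl

theorem onlyPhase_of (h : G.Mixed xs) {l l₁ l₂ : Level} {θ : ℝ}
    (hl : 0 < l.sgn * (G.slope xs * G.grad1 (phaseVec θ))) (hne : l₁ ≠ l₂)
    (hr : l₂.sgn * G.rate ![l, l₂] 1 (xs + phaseVec θ) < 0) : G.OnlyPhase xs ![l, l₁] θ := by
  intro j hj hmem
  rw [h.mem_approxDomain] at hmem
  have h0 : l = j 0 := Level.eq_of_sgn_mul_pos hl hmem.1
  have h1 : j 1 ≠ l₁ := fun h1 => hj (by rw [mode_eq j, ← h0, h1])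
  have h2 : j 1 = l₂ := by
    revert h1 hne
    cases j 1 <;> cases l₁ <;> cases l₂ <;> simp
  have e : j = ![l, l₂] := by rw [mode_eq j, ← h0, h2]
  have := hmem.2
  rw [h2, e] at this
  linarith

/-- Away from the boundaries of the approximated domains, each phase belongs to the interior of an
effective domain. -/
theorem exists_robust (h : G.Mixed xs) {θ : ℝ} (hV : G.grad1 (phaseVec θ) ≠ 0)
    (hR : ∀ k, G.rate k 1 (xs + phaseVec θ) ≠ 0) : ∃ k, G.Robust xs k θ := by
  have hΔ := h.det0_pos
  obtain ⟨l, hl⟩ : ∃ l : Level, 0 < l.sgn * (G.slope xs * G.grad1 (phaseVec θ)) := by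
    have hne : G.slope xs * G.grad1 (phaseVec θ) ≠ 0 := mul_ne_zero h.slope_ne hV
    rcases lt_or_gt_of_ne hne with h0 | h0
    · exact ⟨Level.L, by simpa [Level.sgn] using h0⟩
    · exact ⟨Level.H, by simpa [Level.sgn] using h0⟩
  have mono := G.rate_update_mono ![l, Level.L] 1 (xs + phaseVec θ)
  have eL : Function.update ![l, Level.L] 1 Level.L = ![l, Level.L] := by
    ext i; fin_cases i <;> simp
  have eH : Function.update ![l, Level.L] 1 Level.H = ![l, Level.H] := by
    ext i; fin_cases i <;> simp
  rw [eL, eH] at mono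
  have hα : ∀ l', G.alpha ![l, l'] 0 = G.alpha ![l, Level.L] 0 := fun l' => by simp [alpha]
  by_cases hL : 0 < G.rate ![l, Level.L] 1 (xs + phaseVec θ)
  · exact ⟨![l, Level.H], h.robust_of_only ⟨hl, by simpa [Level.sgn] using hL.trans_le mono⟩
      (h.onlyPhase_of hl (l₂ := Level.L) (by simp) (by simpa [Level.sgn] using hL))⟩
  by_cases hH : G.rate ![l, Level.H] 1 (xs + phaseVec θ) < 0
  · exact ⟨![l, Level.L], h.robust_of_only ⟨hl, by simpa [Level.sgn] using mono.trans_lt hH⟩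
      (h.onlyPhase_of hl (l₂ := Level.H) (by simp) (by simpa [Level.sgn] using hH))⟩
  -- What remains is the overlap, where both levels of agent 2 are possible and the past decides
  -- between them.
  have hL' : G.rate ![l, Level.L] 1 (xs + phaseVec θ) < 0 :=
    lt_of_le_of_ne (not_lt.1 hL) (hR _)
  have hH' : 0 < G.rate ![l, Level.H] 1 (xs + phaseVec θ) :=
    lt_of_le_of_ne (not_lt.1 hH) (hR _).symm
  have iff_pos : ∀ k, ∀ {φ : ℝ}, G.grad1 (phaseVec φ) ≠ 0 →
      (0 < G.rate k 1 (xs + phaseVec φ) ↔ 0 <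
      G.alpha k 0 * (G.hessDet * (G.rotation * (G.grad0 (phaseVec φ) / G.grad1 (phaseVec φ))) ^ 2
        + (G.rotation * G.mixedCoeff) *
          (G.rotation * (G.grad0 (phaseVec φ) / G.grad1 (phaseVec φ))))
        + G.alpha k 1 * G.det0) := by
    intro k φ hφ
    rw [← mul_pos_iff_of_pos_left hΔ, h.rate_phase_eq k hφ]
    exact mul_pos_iff_of_pos_left (by positivity)
  have iff_neg : ∀ k, ∀ {φ : ℝ}, G.grad1 (phaseVec φ) ≠ 0 →
      (G.rate k 1 (xs + phaseVec φ) < 0 ↔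
      G.alpha k 0 * (G.hessDet * (G.rotation * (G.grad0 (phaseVec φ) / G.grad1 (phaseVec φ))) ^ 2
        + (G.rotation * G.mixedCoeff) *
          (G.rotation * (G.grad0 (phaseVec φ) / G.grad1 (phaseVec φ))))
        + G.alpha k 1 * G.det0 < 0) := by
    intro k φ hφ
    rw [← mul_neg_iff_of_pos hΔ, h.rate_phase_eq k hφ]
    exact mul_neg_iff_of_pos (by positivity)
  have hq : (G.rotation * G.mixedCoeff) ^ 2 = G.mixedCoeff ^ 2 := by
    linear_combination G.mixedCoeff ^ 2 * rotation_sq G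
  have hiL := h.indef ![l, Level.L]
  have hiH := h.indef ![l, Level.H]
  rw [iff_neg _ hV] at hL'
  rw [iff_pos _ hV, hα] at hH'
  rw [hα] at hiH
  rw [← hq] at hiL hiH
  obtain ⟨n₁, hn₁, hcase⟩ := exists_quadratic_sign (G.alpha_pos ![l, Level.L] 0) hiL hiH hL' hH'
  obtain ⟨s, hs0, harc, hend⟩ := h.exists_arc hV hn₁
  have hlarc : ∀ s' ∈ Set.Icc 0 s,
      0 < l.sgn * (G.slope xs * G.grad1 (phaseVec (θ - G.rotation * s'))) := by
    intro s' hs'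
    have h1 := mul_pos hl (harc s' hs').1
    have h2 : 0 < G.grad1 (phaseVec θ) ^ 2 := by positivity
    refine pos_of_mul_pos_right (a := G.grad1 (phaseVec θ) ^ 2) ?_ h2.le
    linarith
  have hne : ∀ s' ∈ Set.Icc 0 s, G.grad1 (phaseVec (θ - G.rotation * s')) ≠ 0 := fun s' hs' =>
    right_ne_zero_of_mul (harc s' hs').1.ne'
  have hsI : s ∈ Set.Icc 0 s := ⟨hs0.le, le_rfl⟩
  rcases hcase with ⟨h1, h2⟩ | ⟨h1, h2⟩
  · refine ⟨![l, Level.H], s, hs0, fun s' hs' => ⟨hlarc s' hs', ?_⟩,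
      h.onlyPhase_of (hlarc s hsI) (l₂ := Level.L) (by simp) ?_⟩
    · have := (iff_pos ![l, Level.H] (hne s' hs')).2 (by rw [hα]; exact h2 _ (harc s' hs').2)
      simpa [Level.sgn] using this
    · have := (iff_pos ![l, Level.L] (hne s hsI)).2 (by rw [hend]; exact h1)
      simpa [Level.sgn] using this
  · refine ⟨![l, Level.L], s, hs0, fun s' hs' => ⟨hlarc s' hs', ?_⟩,
      h.onlyPhase_of (hlarc s hsI) (l₂ := Level.H) (by simp) ?_⟩
    · have := (iff_neg ![l, Level.L] (hne s' hs')).2 (h2 _ (harc s' hs').2)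
      simpa [Level.sgn] using this
    · have := (iff_neg ![l, Level.H] (hne s hsI)).2 (by rw [hα, hend]; exact h1)
      simpa [Level.sgn] using this

end Mixed

end

end LossAverseGame

/-! ### Continuous logarithms and the dynamics in polar form -/

/-- A curve in the punctured complex plane has a continuous logarithm. -/
theorem exists_continuous_log {y : ℝ → ℂ} {T : ℝ} (hT : 0 < T)
    (hy : ContinuousOn y (Set.Icc 0 T)) (h0 : ∀ t ∈ Set.Icc 0 T, y t ≠ 0) :
    ∃ l : ℝ → ℂ, ContinuousOn l (Set.Icc 0 T) ∧ ∀ t ∈ Set.Icc 0 T, y t = Complex.exp (l t) := by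
  have hmem : ∀ s : unitInterval, T * (s : ℝ) ∈ Set.Icc 0 T := fun s =>
    ⟨mul_nonneg hT.le s.2.1, mul_le_of_le_one_right hT.le s.2.2⟩
  have hc : Continuous fun s : unitInterval => y (T * (s : ℝ)) :=
    hy.comp_continuous (by fun_prop) hmem
  let γ : C(unitInterval, {z : ℂ // z ≠ 0}) :=
    ⟨fun s => ⟨y (T * (s : ℝ)), h0 _ (hmem s)⟩, hc.subtype_mk _⟩
  obtain ⟨Γ, hΓ, -⟩ := Complex.isCoveringMap_exp.exists_path_lifts γ (Complex.log (y (T * 0))) (by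
    apply Subtype.ext
    have := h0 _ (hmem 0)
    simp only [γ, ContinuousMap.coe_mk]
    exact (Complex.exp_log this).symm)
  refine ⟨fun t => Γ (Set.projIcc 0 1 zero_le_one (t / T)), ?_, fun t ht => ?_⟩
  · exact (Γ.continuous.comp (continuous_projIcc.comp (by fun_prop))).continuousOn
  · have h1 : t / T ∈ Set.Icc (0 : ℝ) 1 :=
      ⟨div_nonneg ht.1 hT.le, (div_le_one hT).2 ht.2⟩
    have h2 := congrArg Subtype.val (congrFun hΓ (Set.projIcc 0 1 zero_le_one (t / T)))
    simp only [Function.comp_apply, γ, ContinuousMap.coe_mk] at h2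
    rw [h2, Set.projIcc_of_mem zero_le_one h1]
    congr 1
    field_simp

/-- Near `t`, continuity identifies `l` with `l t` plus the principal logarithm of `y / y t`, since
the imaginary parts differ by less than `π`. -/
theorem hasDerivWithinAt_of_exp {y l : ℝ → ℂ} {y' : ℂ} {s : Set ℝ} {t : ℝ}
    (hl : ContinuousWithinAt l s t) (he : ∀ᶠ r in 𝓝[s] t, y r = Complex.exp (l r))
    (het : y t = Complex.exp (l t)) (hy : HasDerivWithinAt y y' s t) :
    HasDerivWithinAt l (y' / y t) s t := by
  have hne : y t ≠ 0 := by rw [het]; exact Complex.exp_ne_zero _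
  have h1 : HasDerivWithinAt (fun r => l t + Complex.log (y r / y t)) (y' / y t) s t := by
    have := (hy.div_const (y t)).clog_real (by rw [div_self hne]; exact Complex.one_mem_slitPlane)
    rw [div_self hne, div_one] at this
    exact this.const_add _
  refine h1.congr_of_eventuallyEq ?_ (by rw [div_self hne, Complex.log_one, add_zero])
  have hnear : ∀ᶠ r in 𝓝[s] t, dist (l r) (l t) < 1 :=
    hl.eventually (Metric.ball_mem_nhds (l t) one_pos)
  filter_upwards [he, hnear] with r hr hd
  rw [hr, het, ← Complex.exp_sub]
  have him : |(l r - l t).im| < 1 := (Complex.abs_im_le_norm _).trans_lt (by rwa [← dist_eq_norm])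
  have hpi := Real.pi_gt_three
  rw [Complex.log_exp (by linarith [(abs_lt.1 him).1]) (by linarith [(abs_lt.1 him).2])]
  ring

theorem hasDerivWithinAt_toComplex {x : ℝ → Fin 2 → ℝ} {x' xs : Fin 2 → ℝ} {s : Set ℝ} {t : ℝ}
    (h : HasDerivWithinAt x x' s t) :
    HasDerivWithinAt (fun t => toComplex (x t - xs)) (toComplex x') s t := by
  have e : ∀ y : Fin 2 → ℝ, toComplex y = (y 0 : ℂ) + (y 1 : ℂ) * Complex.I := by
    intro y
    apply Complex.ext <;> simp [toComplex]
  simp only [e]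
  have h0 := ((hasDerivWithinAt_pi.1 h 0).sub_const (xs 0)).ofReal_comp
  have h1 := ((hasDerivWithinAt_pi.1 h 1).sub_const (xs 1)).ofReal_comp
  exact h0.add (h1.mul_const _)

theorem HasDerivWithinAt.re {l : ℝ → ℂ} {l' : ℂ} {s : Set ℝ} {t : ℝ}
    (h : HasDerivWithinAt l l' s t) : HasDerivWithinAt (fun t => (l t).re) l'.re s t :=
  Complex.reCLM.hasFDerivAt.comp_hasDerivWithinAt t h

theorem HasDerivWithinAt.im {l : ℝ → ℂ} {l' : ℂ} {s : Set ℝ} {t : ℝ}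
    (h : HasDerivWithinAt l l' s t) : HasDerivWithinAt (fun t => (l t).im) l'.im s t :=
  Complex.imCLM.hasFDerivAt.comp_hasDerivWithinAt t h

theorem Function.Periodic.exists_pos_le {f : ℝ → ℝ} {c : ℝ} (hf : Function.Periodic f c)
    (hc : c ≠ 0) (hcont : Continuous f) (hpos : ∀ t, 0 < f t) : ∃ w > 0, ∀ t, w ≤ f t := by
  obtain ⟨w, ⟨t, rfl⟩, hw⟩ := (hf.compact_of_continuous hc hcont).exists_isLeast
    (Set.range_nonempty f)
  exact ⟨f t, hpos t, fun t' => hw ⟨t', rfl⟩⟩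

theorem Function.Periodic.exists_abs_le {f : ℝ → ℝ} {c : ℝ} (hf : Function.Periodic f c)
    (hc : c ≠ 0) (hcont : Continuous f) : ∃ C, ∀ t, |f t| ≤ C := by
  obtain ⟨C, hC⟩ := (hf.compact_of_continuous hc hcont).isBounded.exists_norm_le
  exact ⟨C, fun t => hC _ ⟨t, rfl⟩⟩

theorem phaseVec_periodic : Function.Periodic phaseVec (2 * Real.pi) := by
  intro θ
  simp [phaseVec]

namespace LossAverseGame

noncomputable section

variable (G : LossAverseGame)

/-- The radial growth `ηᵀ 𝔸_k η` at phase `θ`. -/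
def radial (k : Mode) (θ : ℝ) : ℝ := phaseVec θ ⬝ᵥ (G.sysMatrix k *ᵥ phaseVec θ)

theorem growthRate_eq (k : Mode) (θ : ℝ) :
    G.growthRate k θ = G.radial k θ / G.spin k (phaseVec θ) := by
  rw [growthRate, radial, Matrix.det_transpose, Matrix.det_fin_two, spin, sysMatrix_mulVec]
  simp

theorem continuous_radial (k : Mode) : Continuous (G.radial k) := by
  have : G.radial k = fun θ => Real.cos θ * (G.alpha k 0 * G.grad0 (phaseVec θ))
      + Real.sin θ * (G.alpha k 1 * G.grad1 (phaseVec θ)) := by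
    funext θ
    rw [radial, sysMatrix_mulVec]
    simp [dotProduct, Fin.sum_univ_two]
  rw [this]
  have := G.continuous_grad0
  have := G.continuous_grad1
  fun_prop

theorem continuous_spin (k : Mode) : Continuous fun θ => G.spin k (phaseVec θ) := by
  simp only [spin, phaseVec_zero, phaseVec_one]
  have := G.continuous_grad0
  have := G.continuous_grad1
  fun_prop

theorem radial_periodic (k : Mode) : Function.Periodic (G.radial k) (2 * Real.pi) := by
  intro θ
  simp only [radial, phaseVec_periodic θ]

variable {G} {xs : Fin 2 → ℝ}

/-- `l` is a continuous logarithm of `x - xs` on `[0, t₁]`. -/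
def IsLog (xs : Fin 2 → ℝ) (x : ℝ → Fin 2 → ℝ) (l : ℝ → ℂ) (t₁ : ℝ) : Prop :=
  ContinuousOn l (Set.Icc 0 t₁) ∧ ∀ t ∈ Set.Icc 0 t₁, toComplex (x t - xs) = Complex.exp (l t)

theorem IsLog.eq_polar {x : ℝ → Fin 2 → ℝ} {l : ℝ → ℂ} {t₁ : ℝ} (hl : IsLog xs x l t₁) {t : ℝ}
    (ht : t ∈ Set.Icc 0 t₁) : x t = xs + Real.exp (l t).re • phaseVec (l t).im := by
  rw [← eq_smul_phaseVec_of_exp (hl.2 t ht), add_sub_cancel]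

theorem IsLog.norm_eq {x : ℝ → Fin 2 → ℝ} {l : ℝ → ℂ} {t₁ : ℝ} (hl : IsLog xs x l t₁) {t : ℝ}
    (ht : t ∈ Set.Icc 0 t₁) : ‖toComplex (x t - xs)‖ = Real.exp (l t).re := by
  rw [hl.2 t ht, Complex.norm_exp]

theorem IsLog.add_period {x : ℝ → Fin 2 → ℝ} {l : ℝ → ℂ} {t₁ : ℝ} (hl : IsLog xs x l t₁) (n : ℤ) :
    IsLog xs x (fun t => l t + n * (2 * Real.pi * Complex.I)) t₁ :=
  ⟨hl.1.add continuousOn_const, fun t ht => by rw [hl.2 t ht, Complex.exp_add,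
    Complex.exp_int_mul_two_pi_mul_I, mul_one]⟩

theorem IsTrajectory.exists_isLog {x : ℝ → Fin 2 → ℝ} {K : ℝ → Mode} {T : ℝ}
    (h : G.IsTrajectory (Set.Ico 0 T) x K) (hx : ∀ t ∈ Set.Ico 0 T, x t ≠ xs) {t₁ : ℝ}
    (h0 : 0 < t₁) (h1 : t₁ < T) : ∃ l, IsLog xs x l t₁ := by
  have hsub : Set.Icc 0 t₁ ⊆ Set.Ico 0 T := fun t ht => ⟨ht.1, ht.2.trans_lt h1⟩
  obtain ⟨l, hl⟩ := exists_continuous_log (y := fun t => toComplex (x t - xs)) h0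
    (continuous_toComplex.comp_continuousOn ((h.continuousOn.mono hsub).sub continuousOn_const))
    fun t ht h0 => hx t (hsub ht) (sub_eq_zero.1 (toComplex_eq_zero.1 h0))
  exact ⟨l, hl⟩

namespace Mixed

theorem eq_of_isNash (h : G.Mixed xs) {x : Fin 2 → ℝ} (hx : G.IsNash x) : x = xs := by
  obtain ⟨h0, h1, -, -⟩ := h.own_grad (x - xs)
  rw [add_sub_cancel, hx.dpayoff_eq_zero 0] at h0
  rw [add_sub_cancel, hx.dpayoff_eq_zero 1] at h1
  by_contra hne
  exact G.grad0_ne_zero_of_grad1 h.det0_pos (sub_ne_zero.2 hne) h1.symm h0.symm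

theorem hasDerivWithinAt_log (h : G.Mixed xs) {x : ℝ → Fin 2 → ℝ} {K : ℝ → Mode} {T : ℝ}
    (hx : G.IsTrajectory (Set.Ico 0 T) x K) {l : ℝ → ℂ} {t₁ : ℝ} (hT : t₁ < T)
    (hl : IsLog xs x l t₁) {t : ℝ} (ht : t ∈ Set.Ico 0 t₁) {k : Mode} (hk : RightMode K t k) :
    HasDerivWithinAt l ⟨G.radial k (l t).im, G.spin k (phaseVec (l t).im)⟩ (Set.Ici t) t := by
  have htc : t ∈ Set.Icc 0 t₁ := ⟨ht.1, ht.2.le⟩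
  have hle : 𝓝[Set.Ici t] t ≤ 𝓝[Set.Icc 0 t₁] t := by
    rw [nhdsWithin_le_iff]
    filter_upwards [self_mem_nhdsWithin, nhdsWithin_le_nhds (Iio_mem_nhds ht.2)] with s hs hs'
      using ⟨ht.1.trans hs, le_of_lt hs'⟩
  have hd := hasDerivWithinAt_toComplex (xs := xs)
    (hx.hasDerivWithinAt (t := t) ⟨ht.1, ht.2.trans hT⟩ hk)
  have := hasDerivWithinAt_of_exp (s := Set.Ici t) ((hl.1 t htc).mono_left hle)
    (hle (by filter_upwards [self_mem_nhdsWithin] with s hs using hl.2 s hs)) (hl.2 t htc) hd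
  refine this.congr_deriv ?_
  rw [hl.2 t htc, div_eq_iff (Complex.exp_ne_zero _), hl.eq_polar htc, h.field_add, grad0_smul,
    grad1_smul]
  apply Complex.ext
  · simp only [toComplex, Complex.mul_re, Complex.exp_re, Complex.exp_im, radial, sysMatrix_mulVec,
      spin, dotProduct, Fin.sum_univ_two, phaseVec_zero, phaseVec_one, cons_val_zero, cons_val_one]
    linear_combination (-(Real.exp (l t).re * G.alpha k 0 * G.grad0 (phaseVec (l t).im))) *
      Real.sin_sq_add_cos_sq (l t).im
  · simp only [toComplex, Complex.mul_im, Complex.exp_re, Complex.exp_im, radial, sysMatrix_mulVec,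
      spin, dotProduct, Fin.sum_univ_two, phaseVec_zero, phaseVec_one, cons_val_zero, cons_val_one]
    linear_combination (-(Real.exp (l t).re * G.alpha k 1 * G.grad1 (phaseVec (l t).im))) *
      Real.sin_sq_add_cos_sq (l t).im

theorem exists_spin_lower (h : G.Mixed xs) :
    ∃ w > 0, ∀ k θ, w ≤ G.rotation * G.spin k (phaseVec θ) := by
  have : ∀ k, ∃ w > 0, ∀ θ, w ≤ G.rotation * G.spin k (phaseVec θ) := fun k =>
    Function.Periodic.exists_pos_le (c := 2 * Real.pi)
      (fun θ => by simp only [phaseVec_periodic θ]) (by positivity)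
      ((G.continuous_spin k).const_mul _) fun θ => h.spin_pos k (phaseVec_ne_zero θ)
  choose w hw hws using this
  have : Nonempty Mode := ⟨fun _ => Level.L⟩
  obtain ⟨k₀, hk₀⟩ := Finite.exists_min w
  exact ⟨w k₀, hw k₀, fun k θ => (hk₀ k).trans (hws k θ)⟩

/-- The phase turns with speed at least `w` in whatever mode, so phases can serve as a clock. -/
theorem phase_advance (h : G.Mixed xs) {w : ℝ}
    (hw : ∀ k θ, w ≤ G.rotation * G.spin k (phaseVec θ)) {x : ℝ → Fin 2 → ℝ} {K : ℝ → Mode} {T : ℝ}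
    (hx : G.IsTrajectory (Set.Ico 0 T) x K) {l : ℝ → ℂ} {t₁ : ℝ} (hT : t₁ < T)
    (hl : IsLog xs x l t₁) {a b : ℝ} (ha : 0 ≤ a) (hab : a ≤ b) (hb : b ≤ t₁) :
    G.rotation * (l a).im + w * (b - a) ≤ G.rotation * (l b).im := by
  have hex : ∀ t ∈ Set.Ico a b, ∃ k, RightMode K t k := fun t ht =>
    hx.exists_rightMode ⟨ha.trans ht.1, ht.2.trans_le (hb.trans hT.le)⟩
  let k : ℝ → Mode := fun t => if ht : t ∈ Set.Ico a b then (hex t ht).choose else fun _ => Level.L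
  have hk : ∀ t ∈ Set.Ico a b, RightMode K t (k t) := fun t ht => by
    have : k t = (hex t ht).choose := dif_pos ht
    rw [this]
    exact (hex t ht).choose_spec
  have := le_of_right_deriv_nonneg
    (f := fun t => G.rotation * (l t).im - w * t)
    (f' := fun t => G.rotation * G.spin (k t) (phaseVec (l t).im) - w * 1) hab ?_ ?_ ?_
  · linarith
  · refine ContinuousOn.sub (continuousOn_const.mul ?_) (by fun_prop)
    exact Complex.continuous_im.comp_continuousOn
      (hl.1.mono fun t ht => ⟨ha.trans ht.1, ht.2.trans hb⟩)
  · intro t ht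
    have := (h.hasDerivWithinAt_log hx hT hl ⟨ha.trans ht.1, ht.2.trans_le hb⟩ (hk t ht)).im
    exact (this.const_mul _).sub ((hasDerivWithinAt_id t _).const_mul w)
  · intro t ht
    have := hw (k t) (l t).im
    linarith

/-! ### The actual mode near the equilibrium is the mode of the phase -/

/-- Close to the equilibrium and after a transient, a trajectory whose phase is near a robust phase
is in the active mode of that phase. -/
theorem rightMode_near_robust (h : G.Mixed xs) {k : Mode} {θ : ℝ} (hs : G.Robust xs k θ) :
    ∃ δ > 0, ∃ r₀ > 0, ∃ T₀, ∀ (T : ℝ) (x : ℝ → Fin 2 → ℝ) (K : ℝ → Mode),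
      G.IsTrajectory (Set.Ico 0 T) x K →
      (∀ t ∈ Set.Ico 0 T, x t ≠ xs ∧ ‖toComplex (x t - xs)‖ < r₀) →
      ∀ t ∈ Set.Ico 0 T, T₀ ≤ t → ∀ l, IsLog xs x l t → |(l t).im - θ| < δ → RightMode K t k := by
  obtain ⟨s, hs0, harc, honly⟩ := hs
  have hω := rotation_sq G
  have hωa : |G.rotation| = 1 := by rcases rotation_cases G with h | h <;> simp [h]
  have hθ : G.StrictPhase xs k θ := by simpa using harc 0 ⟨le_rfl, hs0.le⟩
  obtain ⟨ε, hε, hb⟩ := Metric.eventually_nhds_iff.1 (strictPhase_eventually hθ)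
  -- The bound `ε / 2` keeps phases slightly beyond `θ` strict; the bound `s` keeps the current
  -- phase ahead of the start of the arc.
  set δ := min (ε / 2) s with hδ
  have hδ0 : 0 < δ := lt_min (by positivity) hs0
  have hstrict : ∀ s' ∈ Set.Icc (-δ) s, G.StrictPhase xs k (θ - G.rotation * s') := by
    intro s' hs'
    rcases le_or_gt 0 s' with h0 | h0
    · exact harc s' ⟨h0, hs'.2⟩
    · apply hb
      rw [Real.dist_eq, sub_sub_cancel_left, abs_neg, abs_mul, hωa, one_mul, abs_of_neg h0]
      have := min_le_left (ε / 2) s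
      linarith [hs'.1]
  have hunif : ∀ᶠ r in 𝓝 (0 : ℝ), ∀ s' ∈ Set.Icc (-δ) s,
      0 < (k 0).sgn * G.scaledRate xs k r (θ - G.rotation * s') := by
    refine isCompact_Icc.eventually_forall_of_forall_eventually fun s' hs' => ?_
    have hc : Continuous fun p : ℝ × ℝ =>
        (k 0).sgn * G.scaledRate xs k p.1 (θ - G.rotation * p.2) :=
      ((G.continuous_scaledRate xs k).comp
        (continuous_fst.prodMk (by fun_prop : Continuous fun p : ℝ × ℝ =>
          θ - G.rotation * p.2))).const_mul _
    refine (hc.tendsto (0, s')).eventually_const_lt ?_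
    have h1 := mul_pos (G.alpha_pos k 1) (hstrict s' hs').1
    simp only [scaledRate]
    linarith
  have hstart : ∀ᶠ r in 𝓝 (0 : ℝ), ∀ j, j ≠ k →
      (j 0).sgn * G.scaledRate xs j r (θ - G.rotation * s) < 0 ∨
      (j 1).sgn * G.rate j 1 (xs + phaseVec (θ - G.rotation * s)) < 0 := by
    refine eventually_all.2 fun j => ?_
    by_cases hj : j = k
    · exact Eventually.of_forall fun r h' => absurd hj h'
    have := honly j hj
    rw [h.mem_approxDomain, not_and_or, not_le, not_le] at this
    rcases this with h0 | h0
    · have hc : Continuous fun r : ℝ =>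
          (j 0).sgn * G.scaledRate xs j r (θ - G.rotation * s) :=
        ((G.continuous_scaledRate xs j).comp (continuous_id.prodMk continuous_const)).const_mul _
      have hneg : (j 0).sgn * G.scaledRate xs j 0 (θ - G.rotation * s) < 0 := by
        have h1 := mul_neg_of_pos_of_neg (G.alpha_pos j 1) h0
        simp only [scaledRate]
        linarith
      filter_upwards [(hc.tendsto 0).eventually_lt_const hneg] with r hr _ using Or.inl hr
    · exact Eventually.of_forall fun r _ => Or.inr h0
  obtain ⟨r₀, hr₀, hr⟩ := Metric.eventually_nhds_iff.1 (hunif.and hstart)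
  obtain ⟨w, hw0, hw⟩ := h.exists_spin_lower
  -- By this time the phase has turned by at least `s + δ`, so a trajectory now within `δ` of `θ`
  -- has passed the start `θ - rotation * s` of the arc.
  refine ⟨δ, hδ0, r₀, hr₀, (s + δ) / w, ?_⟩
  intro T x K hx hball t ht htT₀ l hl hlt
  have hn : ∀ t ∈ Set.Ico 0 T, ¬ G.IsNash (x t) := fun t ht hN =>
    (hball t ht).1 (h.eq_of_isNash hN)
  have hexp : ∀ τ ∈ Set.Icc 0 t, dist (Real.exp (l τ).re) 0 < r₀ := by
    intro τ hτ
    have := (hball τ ⟨hτ.1, hτ.2.trans_lt ht.2⟩).2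
    rw [hl.norm_eq hτ] at this
    simpa using this
  have hωt : |G.rotation * (l t).im - G.rotation * θ| < δ := by
    rw [← mul_sub, abs_mul, hωa, one_mul]; exact hlt
  have hlow := (abs_lt.1 hωt).1
  have hup := (abs_lt.1 hωt).2
  have hδs : δ ≤ s := min_le_right _ _
  have hstart0 : G.rotation * (l 0).im ≤ G.rotation * θ - s := by
    have h1 := h.phase_advance hw hx ht.2 hl le_rfl ht.1 le_rfl
    have h2 := (div_le_iff₀ hw0).1 htT₀
    linarith
  have hcont : ContinuousOn (fun τ => G.rotation * (l τ).im) (Set.Icc 0 t) :=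
    continuousOn_const.mul (Complex.continuous_im.comp_continuousOn hl.1)
  obtain ⟨τ₀, hτ₀, hτ₀e⟩ := intermediate_value_Icc ht.1 hcont
    (show G.rotation * θ - s ∈ Set.Icc _ _ from ⟨hstart0, by linarith⟩)
  simp only at hτ₀e
  have hphase : ∀ τ, (l τ).im = θ - G.rotation * (G.rotation * θ - G.rotation * (l τ).im) := by
    intro τ
    linear_combination ((l τ).im - θ) * (-hω)
  have hmem : ∀ τ ∈ Set.Icc τ₀ t, G.rotation * θ - G.rotation * (l τ).im ∈ Set.Icc (-δ) s := by
    intro τ hτ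
    have h1 := h.phase_advance hw hx ht.2 hl hτ₀.1 hτ.1 hτ.2
    have h2 := h.phase_advance hw hx ht.2 hl (hτ₀.1.trans hτ.1) hτ.2 le_rfl
    have h3 := mul_nonneg hw0.le (sub_nonneg.2 hτ.1)
    have h4 := mul_nonneg hw0.le (sub_nonneg.2 hτ.2)
    constructor <;> linarith
  have hpos : ∀ τ ∈ Set.Icc τ₀ t, ∀ i, 0 < (k i).sgn * G.rate k i (x τ) := by
    intro τ hτ
    have hτ' : τ ∈ Set.Icc 0 t := ⟨hτ₀.1.trans hτ.1, hτ.2⟩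
    rw [hl.eq_polar hτ']
    have h1 := (hr (hexp τ hτ')).1 _ (hmem τ hτ)
    have h2 := (hstrict _ (hmem τ hτ)).2
    rw [← hphase] at h1 h2
    intro i
    fin_cases i
    · change 0 < (k 0).sgn * G.rate k 0 _
      rw [h.rate_zero_phase]
      have := mul_pos (Real.exp_pos (l τ).re) h1
      linarith
    · change 0 < (k 1).sgn * G.rate k 1 _
      rw [h.rate_one_smul]
      have := mul_pos (pow_pos (Real.exp_pos (l τ).re) 2) h2
      linarith
  have hτ₀T : τ₀ ∈ Set.Ico 0 T := ⟨hτ₀.1, hτ₀.2.trans_lt ht.2⟩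
  obtain ⟨j, hj⟩ := hx.exists_rightMode hτ₀T
  -- At the start of the arc every other mode has a rate of the wrong strict sign, also for the
  -- exact dynamics at radius below `r₀`.
  have hjk : j = k := by
    by_contra hne
    have hd := mem_domain_iff.1 (hx.mem_domain_of_rightMode hn hτ₀T hj)
    rw [hl.eq_polar hτ₀] at hd
    have h0 := hd 0
    have h1 := hd 1
    have e : (l τ₀).im = θ - G.rotation * s := by
      rw [hphase τ₀, hτ₀e, sub_sub_cancel]
    rw [h.rate_zero_phase] at h0
    rw [h.rate_one_smul] at h1
    have hE := Real.exp_pos (l τ₀).re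
    rcases (hr (hexp τ₀ hτ₀)).2 j hne with h2 | h2
    · rw [← e] at h2
      have := mul_neg_of_pos_of_neg hE h2
      linarith
    · rw [← e] at h2
      have := mul_neg_of_pos_of_neg (pow_pos hE 2) h2
      linarith
  subst hjk
  exact hx.rightMode_of_persistent hn hτ₀.1 hτ₀.2 ht.2 hj fun τ hτ =>
    persistent_of_strict (hpos τ ⟨hτ.1.le, hτ.2⟩)

theorem rightMode_on_compact (h : G.Mixed xs) {C : Set ℝ} (hC : IsCompact C)
    (hrob : ∀ θ ∈ C, ∃ k, G.Robust xs k θ) :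
    ∃ r₀ > 0, ∃ T₀, ∀ (T : ℝ) (x : ℝ → Fin 2 → ℝ) (K : ℝ → Mode),
      G.IsTrajectory (Set.Ico 0 T) x K →
      (∀ t ∈ Set.Ico 0 T, x t ≠ xs ∧ ‖toComplex (x t - xs)‖ < r₀) →
      ∀ t ∈ Set.Ico 0 T, T₀ ≤ t → ∀ l, IsLog xs x l t → (l t).im ∈ C →
        RightMode K t (G.activeMode xs (l t).im) := by
  let P : Set ℝ → Prop := fun D => ∃ r₀ > 0, ∃ T₀, ∀ (T : ℝ) (x : ℝ → Fin 2 → ℝ) (K : ℝ → Mode),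
      G.IsTrajectory (Set.Ico 0 T) x K →
      (∀ t ∈ Set.Ico 0 T, x t ≠ xs ∧ ‖toComplex (x t - xs)‖ < r₀) →
      ∀ t ∈ Set.Ico 0 T, T₀ ≤ t → ∀ l, IsLog xs x l t → (l t).im ∈ D →
        RightMode K t (G.activeMode xs (l t).im)
  refine hC.induction_on (p := P) ?_ ?_ ?_ ?_
  · exact ⟨1, one_pos, 0, fun T x K _ _ t _ _ l _ hl => absurd hl (Set.notMem_empty _)⟩
  · rintro D D' hDD ⟨r, hr, T₀, hP⟩
    exact ⟨r, hr, T₀, fun T x K h1 h2 t h3 h4 l h5 h6 => hP T x K h1 h2 t h3 h4 l h5 (hDD h6)⟩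
  · rintro D D' ⟨r, hr, T₀, hP⟩ ⟨r', hr', T₀', hP'⟩
    refine ⟨min r r', lt_min hr hr', max T₀ T₀', fun T x K h1 h2 t h3 h4 l h5 h6 => ?_⟩
    rcases h6 with h6 | h6
    · exact hP T x K h1 (fun t ht => ⟨(h2 t ht).1, (h2 t ht).2.trans_le (min_le_left _ _)⟩) t h3
        ((le_max_left _ _).trans h4) l h5 h6
    · exact hP' T x K h1 (fun t ht => ⟨(h2 t ht).1, (h2 t ht).2.trans_le (min_le_right _ _)⟩) t h3
        ((le_max_right _ _).trans h4) l h5 h6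
  · intro θ hθ
    obtain ⟨k, hk⟩ := hrob θ hθ
    obtain ⟨δ, hδ, r, hr, T₀, hP⟩ := h.rightMode_near_robust hk
    refine ⟨{θ' | |θ' - θ| < δ ∧ G.Robust xs k θ'}, ?_, r, hr, T₀, ?_⟩
    · refine nhdsWithin_le_nhds ?_
      filter_upwards [Metric.ball_mem_nhds θ hδ, robust_eventually hk] with θ' h1 h2
      exact ⟨h1, h2⟩
    · intro T x K h1 h2 t h3 h4 l h5 h6
      rw [h.activeMode_of_robust h6.2]
      exact hP T x K h1 h2 t h3 h4 l h5 h6.1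

end Mixed

end

end LossAverseGame

/-! ### Averaging the growth rate over one turn -/

namespace LossAverseGame

noncomputable section

variable {G : LossAverseGame} {xs : Fin 2 → ℝ}

theorem activeMode_periodic (G : LossAverseGame) (xs : Fin 2 → ℝ) :
    Function.Periodic (G.activeMode xs) (2 * Real.pi) := by
  intro θ
  simp only [activeMode, phaseVec_periodic θ]

theorem growthRate_periodic (G : LossAverseGame) (k : Mode) :
    Function.Periodic (G.growthRate k) (2 * Real.pi) := by
  intro θ
  simp only [growthRate, phaseVec_periodic θ]

/-- The product of the linear form `grad1` and of the payoff rates of agent 2 in all modes: it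
vanishes at the boundaries of the approximated domains. -/
def barrier (G : LossAverseGame) (xs : Fin 2 → ℝ) (θ : ℝ) : ℝ :=
  G.grad1 (phaseVec θ) * ∏ k : Mode, G.rate k 1 (xs + phaseVec θ)

theorem barrier_ne_zero {θ : ℝ} : G.barrier xs θ ≠ 0 ↔
    G.grad1 (phaseVec θ) ≠ 0 ∧ ∀ k, G.rate k 1 (xs + phaseVec θ) ≠ 0 := by
  simp [barrier, Finset.prod_ne_zero_iff]

theorem continuous_barrier (G : LossAverseGame) (xs : Fin 2 → ℝ) : Continuous (G.barrier xs) :=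
  G.continuous_grad1.mul (continuous_finsetProd _ fun k _ => Mixed.continuous_rate_phase G xs k)

theorem barrier_periodic (G : LossAverseGame) (xs : Fin 2 → ℝ) :
    Function.Periodic (G.barrier xs) (2 * Real.pi) := by
  intro θ
  simp only [barrier, phaseVec_periodic θ]

/-- A continuous cutoff that is `1` near the zeros of the barrier, and concentrates there as
`n → ∞`. -/
def cutoff (G : LossAverseGame) (xs : Fin 2 → ℝ) (n : ℕ) (θ : ℝ) : ℝ :=
  max 0 (min 1 (2 - n * G.barrier xs θ ^ 2))

theorem continuous_cutoff (G : LossAverseGame) (xs : Fin 2 → ℝ) (n : ℕ) :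
    Continuous (G.cutoff xs n) := by
  have := continuous_barrier G xs
  unfold cutoff
  fun_prop

theorem cutoff_mem (n : ℕ) (θ : ℝ) : G.cutoff xs n θ ∈ Set.Icc 0 1 :=
  ⟨le_max_left _ _, max_le zero_le_one (min_le_left _ _)⟩

theorem cutoff_eq_one {n : ℕ} {θ : ℝ} (h : n * G.barrier xs θ ^ 2 ≤ 1) : G.cutoff xs n θ = 1 := by
  unfold cutoff
  rw [min_eq_left (by linarith), max_eq_right zero_le_one]

theorem tendsto_cutoff {θ : ℝ} (h : G.barrier xs θ ≠ 0) :
    Tendsto (fun n => G.cutoff xs n θ) atTop (𝓝 0) := by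
  have hp : 0 < G.barrier xs θ ^ 2 := by positivity
  have h1 : Tendsto (fun n : ℕ => (n : ℝ) * G.barrier xs θ ^ 2) atTop atTop :=
    tendsto_natCast_atTop_atTop.atTop_mul_const hp
  refine tendsto_const_nhds.congr' ?_
  filter_upwards [h1.eventually_ge_atTop 2] with n hn
  unfold cutoff
  rw [max_eq_left]
  exact (min_le_right _ _).trans (by linarith)

/-- The growth rate of the active mode, up to sign, replaced near the switching phases by the
bound `M`. -/
def smoothRate (G : LossAverseGame) (xs : Fin 2 → ℝ) (σ M : ℝ) (n : ℕ) (θ : ℝ) : ℝ :=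
  σ * G.growthRate (G.activeMode xs θ) θ * (1 - G.cutoff xs n θ) + M * G.cutoff xs n θ

theorem smoothRate_periodic (G : LossAverseGame) (xs : Fin 2 → ℝ) (σ M : ℝ) (n : ℕ) :
    Function.Periodic (G.smoothRate xs σ M n) (2 * Real.pi) := by
  intro θ
  simp only [smoothRate, cutoff, barrier_periodic G xs θ, activeMode_periodic G xs θ,
    growthRate_periodic G _ θ]

namespace Mixed

theorem continuous_growthRate (h : G.Mixed xs) (k : Mode) : Continuous (G.growthRate k) := by
  have : G.growthRate k = fun θ => G.radial k θ / G.spin k (phaseVec θ) := by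
    funext θ; exact G.growthRate_eq k θ
  rw [this]
  refine (G.continuous_radial k).div (G.continuous_spin k) fun θ h0 => ?_
  have := h.spin_pos k (phaseVec_ne_zero θ)
  simp [h0] at this

theorem exists_growthRate_bound (h : G.Mixed xs) :
    ∃ M, 0 ≤ M ∧ ∀ k θ, |G.growthRate k θ| ≤ M := by
  have : ∀ k, ∃ C, ∀ θ, |G.growthRate k θ| ≤ C := fun k =>
    (growthRate_periodic G k).exists_abs_le (by positivity) (h.continuous_growthRate k)
  choose C hC using this
  obtain ⟨M, hM⟩ := (Set.finite_range C).bddAbove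
  have hM' : ∀ k θ, |G.growthRate k θ| ≤ M := fun k θ => (hC k θ).trans (hM ⟨k, rfl⟩)
  exact ⟨M, (abs_nonneg _).trans (hM' (fun _ => Level.L) 0), hM'⟩

theorem exists_radial_bound (G : LossAverseGame) :
    ∃ B, 0 ≤ B ∧ ∀ k θ, |G.radial k θ| ≤ B := by
  have : ∀ k, ∃ C, ∀ θ, |G.radial k θ| ≤ C := fun k =>
    (G.radial_periodic k).exists_abs_le (by positivity) (G.continuous_radial k)
  choose C hC using this
  obtain ⟨M, hM⟩ := (Set.finite_range C).bddAbove
  have hM' : ∀ k θ, |G.radial k θ| ≤ M := fun k θ => (hC k θ).trans (hM ⟨k, rfl⟩)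
  exact ⟨M, (abs_nonneg _).trans (hM' (fun _ => Level.L) 0), hM'⟩

/-- Near a zero of the barrier the cutoff is identically `1` and hides the jumps of the active mode.
Elsewhere the active mode is locally constant, by robustness. -/
theorem continuous_smoothRate (h : G.Mixed xs) (σ M : ℝ) (n : ℕ) :
    Continuous (G.smoothRate xs σ M n) := by
  rw [continuous_iff_continuousAt]
  intro θ
  by_cases h0 : G.barrier xs θ = 0
  · have hc : Continuous fun θ => (n : ℝ) * G.barrier xs θ ^ 2 :=
      ((continuous_barrier G xs).pow 2).const_mul _
    have hev : ∀ᶠ θ' in 𝓝 θ, (n : ℝ) * G.barrier xs θ' ^ 2 < 1 :=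
      (hc.tendsto θ).eventually_lt_const (by simp [h0])
    have : G.smoothRate xs σ M n =ᶠ[𝓝 θ] fun _ => M := by
      filter_upwards [hev] with θ' hθ'
      rw [smoothRate, cutoff_eq_one hθ'.le]
      ring
    exact (continuousAt_const.congr this.symm)
  · obtain ⟨hV, hR⟩ := barrier_ne_zero.1 h0
    obtain ⟨k, hk⟩ := h.exists_robust hV hR
    have : G.smoothRate xs σ M n =ᶠ[𝓝 θ] fun θ =>
        σ * G.growthRate k θ * (1 - G.cutoff xs n θ) + M * G.cutoff xs n θ := by
      filter_upwards [robust_eventually hk] with θ' hθ'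
      rw [smoothRate, h.activeMode_of_robust hθ']
    refine ContinuousAt.congr ?_ this.symm
    have h1 := h.continuous_growthRate k
    have h2 := continuous_cutoff G xs n
    have : Continuous fun θ =>
        σ * G.growthRate k θ * (1 - G.cutoff xs n θ) + M * G.cutoff xs n θ := by fun_prop
    exact this.continuousAt

/-- The barrier is analytic and not identically zero, so its zeros are isolated and form a null set.
-/
theorem ae_barrier_ne_zero (h : G.Mixed xs) (a b : ℝ) :
    ∀ᵐ θ ∂MeasureTheory.volume, θ ∈ Set.uIoc a b → G.barrier xs θ ≠ 0 := by
  have hΔ := h.det0_pos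
  have ha : AnalyticOnNhd ℝ (G.barrier xs) Set.univ := by
    intro θ _
    have e : G.barrier xs = fun θ => G.grad1 (phaseVec θ) * ∏ k : Mode,
        (G.alpha k 0 * G.grad0 (phaseVec θ) * (G.A 1 0 0 * Real.cos θ + G.A 1 0 1 * Real.sin θ)
      + G.alpha k 1 * G.grad1 (phaseVec θ) ^ 2) := by
      funext θ
      simp only [barrier, h.rate_one_add, phaseVec_zero, phaseVec_one]
    have hc : AnalyticAt ℝ Real.cos θ := Real.analyticAt_cos
    have hs : AnalyticAt ℝ Real.sin θ := Real.analyticAt_sin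
    rw [e]
    simp only [grad0, grad1, phaseVec_zero, phaseVec_one]
    refine AnalyticAt.mul (by fun_prop) ?_
    exact Finset.analyticAt_fun_prod _ fun k _ => by fun_prop
  obtain ⟨φ, hφ⟩ : ∃ φ, G.barrier xs φ ≠ 0 := by
    -- This vector spans the kernel of `grad0`, where the rate of agent 2 reduces to `alpha k 1 *
    -- grad1 ^ 2 > 0` in all modes.
    let y : Fin 2 → ℝ := ![G.A 0 0 1, -G.A 0 0 0]
    have hy : y ≠ 0 := by
      intro h0
      have := congrFun h0 1
      have h1 := G.concave 0
      simp [y] at this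
      linarith
    obtain ⟨φ, -, hφ⟩ := exists_smul_phaseVec hy
    have hpos : 0 < ‖toComplex y‖ := norm_pos_iff.2 fun h0 => hy (toComplex_eq_zero.1 h0)
    have hU : G.grad0 (phaseVec φ) = 0 := by
      have h0 : G.grad0 y = 0 := by simp [grad0, y]; ring
      rw [hφ, grad0_smul] at h0
      exact (mul_eq_zero.1 h0).resolve_left hpos.ne'
    have hV : G.grad1 (phaseVec φ) ≠ 0 := fun hV =>
      G.grad0_ne_zero_of_grad1 hΔ (phaseVec_ne_zero φ) hV hU
    refine ⟨φ, barrier_ne_zero.2 ⟨hV, fun k => ?_⟩⟩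
    have := G.alpha_pos k 1
    rw [h.rate_one_add, hU]
    have : 0 < G.alpha k 1 * G.grad1 (phaseVec φ) ^ 2 := by positivity
    simp only [mul_zero, zero_mul, zero_add]
    exact this.ne'
  have hcod := ha.preimage_zero_mem_codiscreteWithin (x := φ) hφ trivial isConnected_univ
  have hcod' : G.barrier xs ⁻¹' {0}ᶜ ∈ codiscreteWithin (Set.uIoc a b) :=
    Filter.codiscreteWithin_mono (Set.subset_univ _) hcod
  have := ae_restrict_le_codiscreteWithin (μ := MeasureTheory.volume)
    (measurableSet_uIoc (a := a) (b := b)) hcod'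
  exact (MeasureTheory.ae_restrict_iff' measurableSet_uIoc).1 this

theorem abs_smoothRate_le {σ M : ℝ} (hσ : |σ| = 1)
    (hb : ∀ k θ, |G.growthRate k θ| ≤ M) (n : ℕ) (θ : ℝ) : |G.smoothRate xs σ M n θ| ≤ M := by
  obtain ⟨h0, h1⟩ := cutoff_mem (G := G) (xs := xs) n θ
  have h2 : |σ * G.growthRate (G.activeMode xs θ) θ| ≤ M := by
    rw [abs_mul, hσ, one_mul]; exact hb _ _
  obtain ⟨h3, h4⟩ := abs_le.1 h2
  rw [smoothRate, abs_le]
  constructor <;> nlinarith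

theorem tendsto_integral_smoothRate (h : G.Mixed xs) {σ M : ℝ} (hσ : |σ| = 1)
    (hb : ∀ k θ, |G.growthRate k θ| ≤ M) (θ₀ : ℝ) :
    Tendsto (fun n => ∫ θ in θ₀..(θ₀ + 2 * Real.pi), G.smoothRate xs σ M n θ) atTop
      (𝓝 (σ * G.gammaRg xs θ₀)) := by
  rw [gammaRg, ← intervalIntegral.integral_const_mul]
  refine intervalIntegral.tendsto_integral_filter_of_dominated_convergence (fun _ => M) ?_ ?_ ?_ ?_
  · exact Eventually.of_forall fun n => (h.continuous_smoothRate σ M n).aestronglyMeasurable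
  · exact Eventually.of_forall fun n => Eventually.of_forall fun θ _ =>
      abs_smoothRate_le hσ hb n θ
  · exact intervalIntegrable_const
  · filter_upwards [h.ae_barrier_ne_zero θ₀ (θ₀ + 2 * Real.pi)] with θ hθ hmem
    have := tendsto_cutoff (hθ hmem)
    have h2 := ((tendsto_const_nhds (x := (1 : ℝ))).sub this).const_mul
      (σ * G.growthRate (G.activeMode xs θ) θ)
    have h3 := h2.add (this.const_mul M)
    simpa [smoothRate] using h3

/-- The logarithm of the distance to the equilibrium decreases (for `s = 1`) or increases (for
`s = -1`) at a linear rate along all trajectories that remain near the equilibrium. -/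
theorem exists_radial_estimate (h : G.Mixed xs) {s θ₀ : ℝ} (hs : |s| = 1)
    (hγ : s * G.rotation * G.gammaRg xs θ₀ < 0) :
    ∃ r₀ > 0, ∃ κ > 0, ∃ C, ∀ (T : ℝ) (x : ℝ → Fin 2 → ℝ) (K : ℝ → Mode),
      G.IsTrajectory (Set.Ico 0 T) x K →
      (∀ t ∈ Set.Ico 0 T, x t ≠ xs ∧ ‖toComplex (x t - xs)‖ < r₀) →
      ∀ t ∈ Set.Ico 0 T, s * Real.log ‖toComplex (x t - xs)‖ ≤
        s * Real.log ‖toComplex (x 0 - xs)‖ + C - κ * t := by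
  have hω := rotation_sq G
  have hωa : |G.rotation| = 1 := by rcases rotation_cases G with h | h <;> simp [h]
  have hσ : |s * G.rotation| = 1 := by rw [abs_mul, hs, hωa, one_mul]
  obtain ⟨M, hM0, hM⟩ := h.exists_growthRate_bound
  obtain ⟨B, hB0, hB⟩ := exists_radial_bound G
  obtain ⟨w, hw0, hw⟩ := h.exists_spin_lower
  -- The cutoff is fixed here, so fine that overestimating the growth near the switching phases does
  -- not change the sign of the integral.
  obtain ⟨n, hn⟩ := ((h.tendsto_integral_smoothRate hσ hM θ₀).eventually_lt_const hγ).exists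
  have hp2 : (0 : ℝ) < 2 * Real.pi := by positivity
  set R := G.smoothRate xs (s * G.rotation) M n with hR
  have hRc : Continuous R := h.continuous_smoothRate _ _ _
  have hRp : Function.Periodic R (2 * Real.pi) := smoothRate_periodic G xs _ _ _
  set m := (∫ θ in θ₀..(θ₀ + 2 * Real.pi), R θ) / (2 * Real.pi) with hm
  have hm0 : m < 0 := div_neg_of_neg_of_pos hn hp2
  -- Subtracting the mean `m` makes the primitive periodic, hence bounded; it absorbs the
  -- oscillation of `log r` within a turn.
  let W : ℝ → ℝ := fun θ => ∫ φ in (0 : ℝ)..θ, (R φ - m)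
  have hint : ∀ a b, IntervalIntegrable (fun φ => R φ - m) MeasureTheory.volume a b := fun a b =>
    (hRc.sub continuous_const).intervalIntegrable a b
  have hWd : ∀ θ, HasDerivAt W (R θ - m) θ := fun θ =>
    intervalIntegral.integral_hasDerivAt_right (hint _ _)
      ((hRc.sub continuous_const).stronglyMeasurableAtFilter _ _)
      (hRc.sub continuous_const).continuousAt
  have hWc : Continuous W := continuous_iff_continuousAt.2 fun θ => (hWd θ).continuousAt
  have hWp : Function.Periodic W (2 * Real.pi) := by
    intro θ
    have e : W (θ + 2 * Real.pi) = W θ + ∫ φ in θ..(θ + 2 * Real.pi), (R φ - m) :=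
      (intervalIntegral.integral_add_adjacent_intervals (hint _ _) (hint _ _)).symm
    rw [e, intervalIntegral.integral_sub (hRc.intervalIntegrable _ _) intervalIntegrable_const,
      hRp.intervalIntegral_add_eq θ θ₀, intervalIntegral.integral_const, hm]
    simp only [add_sub_cancel_left, smul_eq_mul]
    field_simp
    ring
  obtain ⟨D, hD⟩ := hWp.exists_abs_le hp2.ne' hWc
  obtain ⟨r₀, hr₀, T₀, hmode⟩ := h.rightMode_on_compact
    (C := Set.Icc 0 (2 * Real.pi) ∩ {θ | 1 ≤ n * G.barrier xs θ ^ 2})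
    (isCompact_Icc.inter_right (isClosed_le continuous_const
      (((continuous_barrier G xs).pow 2).const_mul _)))
    (fun θ hθ => by
      have hb : G.barrier xs θ ≠ 0 := by
        intro h0
        have := hθ.2
        simp only [Set.mem_ofPred_eq, h0] at this
        norm_num at this
      exact h.exists_robust (barrier_ne_zero.1 hb).1 (barrier_ne_zero.1 hb).2)
  -- The rate is the mean decrease per unit of phase times the minimal angular speed. The constant
  -- pays for the transient up to `max T₀ 0`, where only the bound `B` is available, and for the
  -- oscillation of `W`.
  refine ⟨r₀, hr₀, -m * w, by nlinarith, B * max T₀ 0 + 2 * D + -m * w * max T₀ 0, ?_⟩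
  intro T x K hx hball t ht
  have hκ : 0 < -m * w := by nlinarith
  rcases ht.1.eq_or_lt with h0 | ht0
  · have hD0 : 0 ≤ D := (abs_nonneg _).trans (hD 0)
    have := mul_nonneg hκ.le (le_max_right T₀ 0)
    have := mul_nonneg hB0 (le_max_right T₀ 0)
    rw [← h0]
    linarith
  obtain ⟨l, hl⟩ := hx.exists_isLog (fun t ht => (hball t ht).1) ht0 ht.2
  have hlog : ∀ τ ∈ Set.Icc 0 t, Real.log ‖toComplex (x τ - xs)‖ = (l τ).re := fun τ hτ => by
    rw [hl.norm_eq hτ, Real.log_exp]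
  rw [hlog t ⟨ht.1, le_rfl⟩, hlog 0 ⟨le_rfl, ht.1⟩]
  have hex : ∀ τ ∈ Set.Ico 0 t, ∃ k, RightMode K τ k := fun τ hτ =>
    hx.exists_rightMode ⟨hτ.1, hτ.2.trans ht.2⟩
  let k : ℝ → Mode := fun τ => if hτ : τ ∈ Set.Ico 0 t then (hex τ hτ).choose else fun _ => Level.L
  have hk : ∀ τ ∈ Set.Ico 0 t, RightMode K τ (k τ) := fun τ hτ => by
    have : k τ = (hex τ hτ).choose := dif_pos hτ
    rw [this]
    exact (hex τ hτ).choose_spec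
  have hder := fun τ hτ => h.hasDerivWithinAt_log hx ht.2 hl hτ (hk τ hτ)
  have hre : ContinuousOn (fun τ => (l τ).re) (Set.Icc 0 t) :=
    Complex.continuous_re.comp_continuousOn hl.1
  have him : ContinuousOn (fun τ => (l τ).im) (Set.Icc 0 t) :=
    Complex.continuous_im.comp_continuousOn hl.1
  have hsB : ∀ k θ, s * G.radial k θ ≤ B := fun k θ =>
    (le_abs_self _).trans (by rw [abs_mul, hs, one_mul]; exact hB k θ)
  have htrans : ∀ τ ∈ Set.Icc 0 t, s * (l τ).re ≤ s * (l 0).re + B * τ := by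
    intro τ hτ
    have := le_of_right_deriv_nonneg (f := fun r => B * r - s * (l r).re)
      (f' := fun r => B * 1 - s * G.radial (k r) (l r).im) hτ.1 ?_ ?_ ?_
    · linarith
    · exact ContinuousOn.sub (by fun_prop)
        (continuousOn_const.mul (hre.mono (Set.Icc_subset_Icc_right hτ.2)))
    · intro r hr
      exact ((hasDerivWithinAt_id r _).const_mul B).sub
        ((hder r ⟨hr.1, hr.2.trans_le hτ.2⟩).re.const_mul s)
    · intro r hr
      linarith [hsB (k r) (l r).im]
  have hrate : ∀ τ ∈ Set.Ico 0 t, T₀ ≤ τ →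
      s * G.rotation * G.growthRate (k τ) (l τ).im ≤ R (l τ).im := by
    intro τ hτ hτ₀
    have hle : ∀ k θ, s * G.rotation * G.growthRate k θ ≤ M := fun k θ =>
      (le_abs_self _).trans (by rw [abs_mul, hσ, one_mul]; exact hM k θ)
    by_cases hb : n * G.barrier xs (l τ).im ^ 2 ≤ 1
    · rw [hR, smoothRate, cutoff_eq_one hb]
      linarith [hle (k τ) (l τ).im]
    · push Not at hb
      -- The phase of a continuous logarithm is unbounded; shifting the logarithm by whole turns
      -- brings it into the compact set.
      obtain ⟨j, hj, -⟩ := existsUnique_add_zsmul_mem_Ico hp2 (l τ).im 0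
      have him' : (l τ + j * (2 * Real.pi * Complex.I)).im = (l τ).im + j • (2 * Real.pi) := by
        simp
      have hlj := IsLog.add_period (t₁ := τ) (xs := xs) (x := x) (l := l)
        ⟨hl.1.mono (Set.Icc_subset_Icc_right hτ.2.le), fun r hr => hl.2 r ⟨hr.1, hr.2.trans hτ.2.le⟩⟩ j
      have hper : ∀ {α : Type} {f : ℝ → α}, Function.Periodic f (2 * Real.pi) →
          f ((l τ).im + j • (2 * Real.pi)) = f (l τ).im := fun hf => (hf.zsmul j) _
      have := hmode T x K hx hball τ ⟨hτ.1, hτ.2.trans ht.2⟩ hτ₀ _ hlj ?_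
      · rw [him', hper (activeMode_periodic G xs)] at this
        have e := (hk τ hτ).unique this
        obtain ⟨h0, h1⟩ := cutoff_mem (G := G) (xs := xs) n (l τ).im
        have h2 := hle (k τ) (l τ).im
        rw [hR, smoothRate, ← e]
        nlinarith
      · rw [him']
        refine ⟨⟨hj.1, by simpa using hj.2.le⟩, ?_⟩
        simp only [Set.mem_ofPred_eq]
        rw [hper (barrier_periodic G xs)]
        exact hb.le
  have hlate : ∀ a ∈ Set.Icc 0 t, T₀ ≤ a →
      s * (l t).re ≤ s * (l a).re + 2 * D - (-m * w) * (t - a) := by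
    intro a ha haT
    -- Apart from the linear term, the monotone quantity is `rotation * W(θ) - s * log r`. As `s *
    -- radial = s * rotation * growthRate * (rotation * spin) ≤ R * (rotation * spin)`, its
    -- derivative is at least `-m * (rotation * spin) ≥ -m * w`.
    have := le_of_right_deriv_nonneg
      (f := fun r => G.rotation * W (l r).im - s * (l r).re + m * w * r)
      (f' := fun r => G.rotation * ((R (l r).im - m) * G.spin (k r) (phaseVec (l r).im))
        - s * G.radial (k r) (l r).im + m * w * 1) ha.2 ?_ ?_ ?_
    · have h1 : |G.rotation * W (l t).im| ≤ D := by rw [abs_mul, hωa, one_mul]; exact hD _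
      have h2 : |G.rotation * W (l a).im| ≤ D := by rw [abs_mul, hωa, one_mul]; exact hD _
      have h3 := (abs_le.1 h1).2
      have h4 := (abs_le.1 h2).1
      linarith
    · have hsub := Set.Icc_subset_Icc_left (b := t) ha.1
      exact ((continuousOn_const.mul (hWc.comp_continuousOn (him.mono hsub))).sub
        (continuousOn_const.mul (hre.mono hsub))).add (by fun_prop)
    · intro r hr
      have hd := hder r ⟨ha.1.trans hr.1, hr.2⟩
      exact ((((hWd (l r).im).comp_hasDerivWithinAt r hd.im).const_mul _).sub
        (hd.re.const_mul s)).add ((hasDerivWithinAt_id r _).const_mul _)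
    · intro r hr
      have h1 := hrate r ⟨ha.1.trans hr.1, hr.2⟩ (haT.trans hr.1)
      have h2 := hw (k r) (l r).im
      have hne : G.spin (k r) (phaseVec (l r).im) ≠ 0 := by
        intro h0
        rw [h0, mul_zero] at h2
        linarith
      have e : G.radial (k r) (l r).im =
          G.growthRate (k r) (l r).im * G.spin (k r) (phaseVec (l r).im) := by
        rw [growthRate_eq]; field_simp
      have h3 : 0 < G.rotation * G.spin (k r) (phaseVec (l r).im) := hw0.trans_le h2
      have h4 := mul_le_mul_of_nonneg_right h1 h3.le
      have h5 : s * G.radial (k r) (l r).im = s * G.rotation * G.growthRate (k r) (l r).im *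
          (G.rotation * G.spin (k r) (phaseVec (l r).im)) := by
        rw [e]
        linear_combination (-(s * G.growthRate (k r) (l r).im *
          G.spin (k r) (phaseVec (l r).im))) * hω
      have h6 := mul_le_mul_of_nonneg_left h2 (neg_nonneg.2 hm0.le)
      rw [h5]
      linarith
  rcases le_or_gt t (max T₀ 0) with hc | hc
  · have h1 := htrans t ⟨ht.1, le_rfl⟩
    have h2 := mul_le_mul_of_nonneg_left hc hB0
    have h3 := mul_le_mul_of_nonneg_left hc hκ.le
    have hD0 : 0 ≤ D := (abs_nonneg _).trans (hD 0)
    linarith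
  · have hmem : max T₀ 0 ∈ Set.Icc 0 t := ⟨le_max_right _ _, hc.le⟩
    have h1 := htrans _ hmem
    have h2 := hlate _ hmem (le_max_left _ _)
    linarith

end Mixed

end

end LossAverseGame

/-! ### Stability and instability -/

namespace LossAverseGame

noncomputable section

variable {G : LossAverseGame} {xs : Fin 2 → ℝ}

theorem IsTrajectory.mono {x : ℝ → Fin 2 → ℝ} {K : ℝ → Mode} {I J : Set ℝ}
    (h : G.IsTrajectory I x K) (hJ : J ⊆ I) : G.IsTrajectory J x K :=
  ⟨h.continuousOn.mono hJ, fun t ht => h.dynamics t (hJ ht), fun t ht => h.levels t (hJ ht),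
    fun t ht => h.keep t (hJ ht)⟩

theorem eventually_norm_toComplex_lt (xs : Fin 2 → ℝ) {r : ℝ} (hr : 0 < r) :
    {x | ‖toComplex (x - xs)‖ < r} ∈ 𝓝 xs := by
  have hc : Continuous fun x : Fin 2 → ℝ => ‖toComplex (x - xs)‖ :=
    (continuous_toComplex.comp (continuous_id.sub continuous_const)).norm
  refine (hc.tendsto xs).eventually_lt_const ?_
  simpa [toComplex_eq_zero.2 rfl] using hr

/-- The squared distance to `xs`. -/
def distSq (xs x : Fin 2 → ℝ) : ℝ := (x 0 - xs 0) ^ 2 + (x 1 - xs 1) ^ 2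

theorem norm_toComplex_sq (x : Fin 2 → ℝ) : ‖toComplex (x - xs)‖ ^ 2 = distSq xs x := by
  rw [Complex.sq_norm, Complex.normSq_apply, distSq]
  simp [toComplex]
  ring

theorem distSq_eq_zero {x : Fin 2 → ℝ} : distSq xs x = 0 ↔ x = xs := by
  rw [← norm_toComplex_sq, pow_eq_zero_iff two_ne_zero, norm_eq_zero, toComplex_eq_zero,
    sub_eq_zero]

theorem distSq_nonneg (x : Fin 2 → ℝ) : 0 ≤ distSq xs x := by
  unfold distSq; positivity

namespace Mixed

theorem abs_inner_field_le (h : G.Mixed xs) {B : ℝ} (hB : ∀ k θ, |G.radial k θ| ≤ B) (k : Mode)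
    (x : Fin 2 → ℝ) : |(x 0 - xs 0) * G.field k x 0 + (x 1 - xs 1) * G.field k x 1|
      ≤ B * distSq xs x := by
  by_cases hx : x = xs
  · subst hx
    simp [distSq]
  · obtain ⟨θ, -, hθ⟩ := exists_smul_phaseVec (sub_ne_zero.2 hx)
    set r := ‖toComplex (x - xs)‖ with hr
    have e : x = xs + r • phaseVec θ := by rw [← hθ, add_sub_cancel]
    have h0 : (x 0 - xs 0) * G.field k x 0 + (x 1 - xs 1) * G.field k x 1
        = r ^ 2 * G.radial k θ := by
      rw [e, h.field_add, grad0_smul, grad1_smul, radial, sysMatrix_mulVec]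
      simp [dotProduct, Fin.sum_univ_two]
      ring
    rw [h0, ← norm_toComplex_sq, abs_mul, abs_of_nonneg (sq_nonneg r), mul_comm]
    exact mul_le_mul_of_nonneg_right (hB k θ) (sq_nonneg r)

/-- The distance to the equilibrium changes at most exponentially along trajectories. -/
theorem exists_distSq_bounds (h : G.Mixed xs) :
    ∃ B, ∀ (T : ℝ) (x : ℝ → Fin 2 → ℝ) (K : ℝ → Mode), G.IsTrajectory (Set.Ico 0 T) x K →
      ∀ t ∈ Set.Ico 0 T, distSq xs (x 0) * Real.exp (-(B * t)) ≤ distSq xs (x t) ∧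
        distSq xs (x t) ≤ distSq xs (x 0) * Real.exp (B * t) := by
  obtain ⟨B, hB0, hB⟩ := exists_radial_bound G
  refine ⟨2 * B, fun T x K hx t ht => ?_⟩
  have hd : ∀ τ ∈ Set.Ico 0 t, ∃ d, HasDerivWithinAt (fun τ => distSq xs (x τ)) d (Set.Ici τ) τ ∧
      |d| ≤ 2 * B * distSq xs (x τ) := by
    intro τ hτ
    obtain ⟨k, -, hk⟩ := hx.dynamics τ ⟨hτ.1, hτ.2.trans ht.2⟩
    have h0 := ((hasDerivWithinAt_pi.1 hk 0).sub_const (xs 0)).pow 2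
    have h1 := ((hasDerivWithinAt_pi.1 hk 1).sub_const (xs 1)).pow 2
    refine ⟨2 * ((x τ 0 - xs 0) * G.field k (x τ) 0 + (x τ 1 - xs 1) * G.field k (x τ) 1), ?_, ?_⟩
    · refine (h0.add h1).congr_deriv ?_
      norm_num
      ring
    · rw [abs_mul, abs_two]
      have := h.abs_inner_field_le hB k (x τ)
      linarith
  choose! d hd using hd
  have hcont : ContinuousOn (fun τ => distSq xs (x τ)) (Set.Icc 0 t) := by
    have hc : Continuous (distSq xs) := by unfold distSq; fun_prop
    exact hc.comp_continuousOn (hx.continuousOn.mono fun τ hτ => ⟨hτ.1, hτ.2.trans_lt ht.2⟩)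
  have hexp : ∀ (c τ : ℝ), HasDerivWithinAt (fun τ => Real.exp (c * τ))
      (Real.exp (c * τ) * (c * 1)) (Set.Ici τ) τ := fun c τ =>
    ((hasDerivWithinAt_id τ _).const_mul c).exp
  constructor
  · have := le_of_right_deriv_nonneg (f := fun τ => distSq xs (x τ) * Real.exp (2 * B * τ))
      (f' := fun τ => d τ * Real.exp (2 * B * τ)
        + distSq xs (x τ) * (Real.exp (2 * B * τ) * (2 * B * 1))) ht.1
      (hcont.mul (by fun_prop)) (fun τ hτ => (hd τ hτ).1.mul (hexp _ τ)) (fun τ hτ => by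
        have h1 := (abs_le.1 (hd τ hτ).2).1
        have h2 := Real.exp_pos (2 * B * τ)
        nlinarith)
    simp only [mul_zero, Real.exp_zero, mul_one] at this
    rw [Real.exp_neg, ← div_eq_mul_inv, div_le_iff₀ (Real.exp_pos _)]
    exact this
  · have := le_of_right_deriv_nonneg (f := fun τ => -(distSq xs (x τ) * Real.exp (-(2 * B) * τ)))
      (f' := fun τ => -(d τ * Real.exp (-(2 * B) * τ)
        + distSq xs (x τ) * (Real.exp (-(2 * B) * τ) * (-(2 * B) * 1)))) ht.1
      (hcont.mul (by fun_prop)).neg (fun τ hτ => ((hd τ hτ).1.mul (hexp _ τ)).neg) (fun τ hτ => by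
        have h1 := (abs_le.1 (hd τ hτ).2).2
        have h2 := Real.exp_pos (-(2 * B) * τ)
        nlinarith)
    simp only [mul_zero, Real.exp_zero, mul_one, neg_le_neg_iff] at this
    rw [neg_mul, Real.exp_neg, ← div_eq_mul_inv, div_le_iff₀ (Real.exp_pos _)] at this
    exact this

/-- The exponential lower bound on the distance keeps a trajectory off the equilibrium in finite
time, so its phase is defined throughout. -/
theorem ne_of_initial_ne (h : G.Mixed xs) {T : ℝ} {x : ℝ → Fin 2 → ℝ} {K : ℝ → Mode}
    (hx : G.IsTrajectory (Set.Ico 0 T) x K) (h0 : x 0 ≠ xs) :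
    ∀ t ∈ Set.Ico 0 T, x t ≠ xs := by
  intro t ht he
  obtain ⟨B, hB⟩ := h.exists_distSq_bounds
  have h1 := (hB T x K hx t ht).1
  have h2 : 0 < distSq xs (x 0) :=
    lt_of_le_of_ne (distSq_nonneg _) fun e => h0 (distSq_eq_zero.1 e.symm)
  have h3 := mul_pos h2 (Real.exp_pos (-(B * t)))
  rw [distSq_eq_zero.2 he] at h1
  linarith

theorem eq_of_initial_eq (h : G.Mixed xs) {T : ℝ} {x : ℝ → Fin 2 → ℝ} {K : ℝ → Mode}
    (hx : G.IsTrajectory (Set.Ico 0 T) x K) (h0 : x 0 = xs) :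
    ∀ t ∈ Set.Ico 0 T, x t = xs := by
  intro t ht
  obtain ⟨B, hB⟩ := h.exists_distSq_bounds
  have h1 := (hB T x K hx t ht).2
  rw [distSq_eq_zero.2 h0, zero_mul] at h1
  exact distSq_eq_zero.1 (le_antisymm h1 (distSq_nonneg _))

/-- If the trajectories from `x₀` remain in a ball of nondegenerate states, then there is one for
all times. -/
theorem exists_global (h : G.Mixed xs) {r q : ℝ} (hqr : q < r)
    (hr : ∀ x, x ≠ xs → ‖toComplex (x - xs)‖ < r → G.Nondeg x) {x₀ : Fin 2 → ℝ} (h0 : x₀ ≠ xs)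
    (hq : ‖toComplex (x₀ - xs)‖ ≤ q)
    (hst : ∀ (T : ℝ) (x : ℝ → Fin 2 → ℝ) (K : ℝ → Mode), 0 < T →
      G.IsTrajectory (Set.Ico 0 T) x K → x 0 = x₀ →
      ∀ t ∈ Set.Ico 0 T, ‖toComplex (x t - xs)‖ ≤ q) :
    ∃ x K, G.IsTrajectory (Set.Ici 0) x K ∧ x 0 = x₀ := by
  obtain ⟨B, hB⟩ := h.exists_distSq_bounds
  refine exists_trajectory_Ici (R := ‖xs‖ + q) (hr x₀ h0 (hq.trans_lt hqr)) ?_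
  intro T x K hT hx hx0
  have hne := h.ne_of_initial_ne hx (by rwa [hx0])
  have hle := hst T x K hT hx hx0
  refine ⟨fun t ht => ⟨?_, hr _ (hne t ht) ((hle t ht).trans_lt hqr),
    fun hN => hne t ht (h.eq_of_isNash hN)⟩, fun z hz => ?_⟩
  · have h1 : ‖x t‖ ≤ ‖xs‖ + ‖x t - xs‖ := by
      have := norm_add_le xs (x t - xs)
      rwa [add_sub_cancel] at this
    linarith [norm_le_norm_toComplex (x t - xs), hle t ht]
  · have hI : ∀ᶠ s in 𝓝[<] T, s ∈ Set.Ico 0 T := by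
      filter_upwards [Ioo_mem_nhdsLT hT] with s hs using ⟨hs.1.le, hs.2⟩
    have hc : Continuous fun x : Fin 2 → ℝ => ‖toComplex (x - xs)‖ :=
      (continuous_toComplex.comp (continuous_id.sub continuous_const)).norm
    have hzq : ‖toComplex (z - xs)‖ ≤ q :=
      le_of_tendsto ((hc.tendsto z).comp hz) (hI.mono fun t ht => hle t ht)
    refine hr z (fun hzx => ?_) (hzq.trans_lt hqr)
    have hc2 : Continuous (distSq xs) := by unfold distSq; fun_prop
    -- The same bound passes to the limit at the finite time `T`, so the limit state is not the
    -- equilibrium and is nondegenerate.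
    have hlim : Tendsto (fun t => distSq xs (x 0) * Real.exp (-(B * t))) (𝓝[<] T)
        (𝓝 (distSq xs (x 0) * Real.exp (-(B * T)))) := by
      have : Continuous fun t => distSq xs (x 0) * Real.exp (-(B * t)) := by fun_prop
      exact (this.tendsto T).mono_left nhdsWithin_le_nhds
    have := le_of_tendsto_of_tendsto hlim ((hc2.tendsto z).comp hz)
      (hI.mono fun t ht => (hB T x K hx t ht).1)
    have h2 : 0 < distSq xs (x 0) :=
      lt_of_le_of_ne (distSq_nonneg _) fun e => h0 (by rw [← hx0]; exact distSq_eq_zero.1 e.symm)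
    have h3 := mul_pos h2 (Real.exp_pos (-(B * T)))
    rw [distSq_eq_zero.2 hzx] at this
    linarith

/-- A bootstrap: the radial estimate presupposes that the trajectory stays in the ball of radius
`r₀`. Up to the first exit time it holds, and for initial distances below `r₀ * exp (-(max C 0))` it
excludes the exit. -/
theorem exists_exponential_decay (h : G.Mixed xs) {θ₀ : ℝ} (hγ : G.rotation * G.gammaRg xs θ₀ < 0) :
    ∃ ρ > 0, ∃ κ > 0, ∃ C ≥ 0, ∀ (T : ℝ) (x : ℝ → Fin 2 → ℝ) (K : ℝ → Mode),
      G.IsTrajectory (Set.Ico 0 T) x K → ‖toComplex (x 0 - xs)‖ < ρ →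
      ∀ t ∈ Set.Ico 0 T, ‖toComplex (x t - xs)‖ ≤
        ‖toComplex (x 0 - xs)‖ * Real.exp (C - κ * t) := by
  obtain ⟨r₀, hr₀, κ, hκ, C, hest⟩ := h.exists_radial_estimate (s := 1) (θ₀ := θ₀) (by simp)
    (by simpa using hγ)
  have hC0 : C ≤ max C 0 := le_max_left _ _
  refine ⟨r₀ * Real.exp (-(max C 0)), by positivity, κ, hκ, max C 0, le_max_right _ _, ?_⟩
  intro T x K hx hx0
  by_cases he : x 0 = xs
  · intro t ht
    rw [h.eq_of_initial_eq hx he t ht]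
    simp [toComplex_eq_zero.2 rfl]
    positivity
  have hne := h.ne_of_initial_ne hx he
  have hpos : ∀ t ∈ Set.Ico 0 T, 0 < ‖toComplex (x t - xs)‖ := fun t ht =>
    norm_pos_iff.2 fun h0 => hne t ht (sub_eq_zero.1 (toComplex_eq_zero.1 h0))
  have hexp : ∀ S ≤ T, (∀ t ∈ Set.Ico 0 S, ‖toComplex (x t - xs)‖ < r₀) → ∀ t ∈ Set.Ico 0 S,
      ‖toComplex (x t - xs)‖ ≤ ‖toComplex (x 0 - xs)‖ * Real.exp (max C 0 - κ * t) := by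
    intro S hS hball t ht
    have hsub : Set.Ico 0 S ⊆ Set.Ico 0 T := Set.Ico_subset_Ico_right hS
    have h0 : (0 : ℝ) ∈ Set.Ico 0 T := hsub ⟨le_rfl, ht.1.trans_lt ht.2⟩
    have := hest S x K (hx.mono hsub) (fun τ hτ => ⟨hne τ (hsub hτ), hball τ hτ⟩) t ht
    rw [← Real.log_le_log_iff (hpos t (hsub ht)) (mul_pos (hpos 0 h0) (Real.exp_pos _)),
      Real.log_mul (hpos 0 h0).ne' (Real.exp_pos _).ne', Real.log_exp]
    linarith
  refine hexp T le_rfl ?_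
  by_contra hc
  push Not at hc
  let S := {t | t ∈ Set.Ico 0 T ∧ r₀ ≤ ‖toComplex (x t - xs)‖}
  have hS : S.Nonempty := hc
  obtain ⟨t₁, ht₁⟩ := hS
  have hbdd : BddBelow S := ⟨0, fun t ht => ht.1.1⟩
  set τ := sInf S with hτ
  have hτ0 : 0 ≤ τ := le_csInf ⟨t₁, ht₁⟩ fun t ht => ht.1.1
  have hτT : τ < T := (csInf_le hbdd ht₁).trans_lt ht₁.1.2
  have hcont : ContinuousOn (fun t => ‖toComplex (x t - xs)‖) (Set.Ico 0 T) :=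
    (continuous_toComplex.comp_continuousOn (hx.continuousOn.sub continuousOn_const)).norm
  have hin : ∀ t ∈ Set.Ico 0 τ, ‖toComplex (x t - xs)‖ < r₀ := by
    intro t ht
    by_contra hge
    exact absurd (csInf_le hbdd (show t ∈ S from ⟨⟨ht.1, ht.2.trans hτT⟩, not_lt.1 hge⟩))
      (not_le.2 ht.2)
  have h0T : (0 : ℝ) ∈ Set.Ico 0 T := ⟨le_rfl, hτ0.trans_lt hτT⟩
  have hq : ‖toComplex (x 0 - xs)‖ * Real.exp (max C 0) < r₀ := by
    rw [Real.exp_neg, ← div_eq_mul_inv] at hx0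
    exact (lt_div_iff₀ (Real.exp_pos _)).1 hx0
  have hτr : ‖toComplex (x τ - xs)‖ < r₀ := by
    rcases hτ0.eq_or_lt with he | hlt
    · rw [← he]
      have : (1 : ℝ) ≤ Real.exp (max C 0) := Real.one_le_exp (le_max_right _ _)
      nlinarith [hpos 0 h0T]
    · refine lt_of_le_of_lt ?_ hq
      have hlim : Tendsto (fun t => ‖toComplex (x t - xs)‖) (𝓝[<] τ)
          (𝓝 ‖toComplex (x τ - xs)‖) := by
        refine (hcont τ ⟨hτ0, hτT⟩).tendsto.mono_left ?_
        rw [nhdsWithin_le_iff]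
        filter_upwards [Ioo_mem_nhdsLT hlt] with s hs using ⟨hs.1.le, hs.2.trans hτT⟩
      refine le_of_tendsto hlim ?_
      filter_upwards [Ioo_mem_nhdsLT hlt] with s hs
      refine (hexp τ hτT.le hin s ⟨hs.1.le, hs.2⟩).trans ?_
      refine mul_le_mul_of_nonneg_left (Real.exp_le_exp.2 ?_) (norm_nonneg _)
      have := mul_nonneg hκ.le hs.1.le
      linarith
  have hev : ∀ᶠ t in 𝓝[Set.Ico 0 T] τ, ‖toComplex (x t - xs)‖ < r₀ :=
    (hcont τ ⟨hτ0, hτT⟩).eventually_lt_const hτr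
  obtain ⟨ε, hε, hball⟩ := Metric.mem_nhdsWithin_iff.1 hev
  obtain ⟨t, htS, htτ⟩ := exists_lt_of_csInf_lt ⟨t₁, ht₁⟩ (show sInf S < τ + ε by linarith)
  have hle := csInf_le hbdd htS
  have : t ∈ Metric.ball τ ε ∩ Set.Ico 0 T := by
    refine ⟨?_, htS.1⟩
    rw [Metric.mem_ball, Real.dist_eq, abs_of_nonneg (by linarith)]
    linarith
  exact absurd htS.2 (not_le.2 (hball this))

theorem isTrajectory_const (h : G.Mixed xs) (hxs : G.IsNash xs) :
    G.IsTrajectory (Set.Ici 0) (fun _ => xs) (fun _ => fun _ => Level.L) := by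
  have hf : ∀ k, G.field k xs = 0 := fun k => by
    have := h.field_add k 0
    rw [add_zero] at this
    rw [this]
    ext i
    fin_cases i <;> simp [grad0, grad1]
  have hr : ∀ k i, G.rate k i xs = 0 := fun k i => by simp [rate, hf]
  refine ⟨continuousOn_const, fun t _ => ⟨fun _ => Level.L, by simp, ?_⟩,
    fun t _ _ => ⟨fun _ => Level.L, by simp, fun i => ?_⟩, fun t _ _ => by simp⟩
  · rw [hf]
    exact hasDerivWithinAt_const _ _ _
  · exact ⟨fun _ => rfl, fun h1 => by rw [hr] at h1; linarith,
      fun _ h1 => absurd hxs h1⟩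

theorem isAsymptoticallyStable (h : G.Mixed xs) (hxs : G.IsNash xs) {θ₀ : ℝ}
    (hγ : G.rotation * G.gammaRg xs θ₀ < 0) : G.IsAsymptoticallyStable xs := by
  obtain ⟨ρ, hρ, κ, hκ, C, hC, hest⟩ := h.exists_exponential_decay hγ
  obtain ⟨r, hr, hnd⟩ := h.exists_radius_nondeg
  have hbound : ∀ (T : ℝ) (x : ℝ → Fin 2 → ℝ) (K : ℝ → Mode),
      G.IsTrajectory (Set.Ico 0 T) x K → ‖toComplex (x 0 - xs)‖ < ρ →
      ∀ t ∈ Set.Ico 0 T, ‖toComplex (x t - xs)‖ ≤ ‖toComplex (x 0 - xs)‖ * Real.exp C := by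
    intro T x K hx h0 t ht
    refine (hest T x K hx h0 t ht).trans (mul_le_mul_of_nonneg_left (Real.exp_le_exp.2 ?_)
      (norm_nonneg _))
    have := mul_nonneg hκ.le ht.1
    linarith
  refine ⟨fun U hU => ?_, {x | ‖toComplex (x - xs)‖ < min ρ (r * Real.exp (-C))},
    eventually_norm_toComplex_lt xs (lt_min hρ (by positivity)), fun x₀ hx₀ => ?_, ?_⟩
  · obtain ⟨ε, hε, hball⟩ := Metric.mem_nhds_iff.1 hU
    refine ⟨{x | ‖toComplex (x - xs)‖ < min ρ (ε * Real.exp (-C))},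
      eventually_norm_toComplex_lt xs (lt_min hρ (by positivity)), ?_⟩
    intro T x K hT hx hx0 t ht
    have h1 := hbound T x K hx (lt_of_lt_of_le hx0 (min_le_left _ _)) t ht
    have h2 : ‖toComplex (x 0 - xs)‖ < ε * Real.exp (-C) := lt_of_lt_of_le hx0 (min_le_right _ _)
    rw [Real.exp_neg, ← div_eq_mul_inv, lt_div_iff₀ (Real.exp_pos _)] at h2
    apply hball
    rw [Metric.mem_ball, dist_eq_norm]
    exact (norm_le_norm_toComplex _).trans_lt (h1.trans_lt h2)
  · by_cases he : x₀ = xs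
    · exact ⟨_, _, h.isTrajectory_const hxs, he.symm⟩
    · have h1 : ‖toComplex (x₀ - xs)‖ < ρ := lt_of_lt_of_le hx₀ (min_le_left _ _)
      have h2 : ‖toComplex (x₀ - xs)‖ < r * Real.exp (-C) :=
        lt_of_lt_of_le hx₀ (min_le_right _ _)
      rw [Real.exp_neg, ← div_eq_mul_inv, lt_div_iff₀ (Real.exp_pos _)] at h2
      refine h.exists_global h2 hnd he ?_ fun T x K hT hx hx0 t ht => ?_
      · exact le_mul_of_one_le_right (norm_nonneg _) (Real.one_le_exp hC)
      · rw [← hx0] at h1 ⊢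
        exact hbound T x K hx h1 t ht
  · intro x K hx hx0
    have h1 : ‖toComplex (x 0 - xs)‖ < ρ := lt_of_lt_of_le hx0 (min_le_left _ _)
    rw [tendsto_iff_norm_sub_tendsto_zero]
    have hlim : Tendsto (fun t : ℝ => ‖toComplex (x 0 - xs)‖ * Real.exp (C - κ * t)) atTop
        (𝓝 0) := by
      have : Tendsto (fun t : ℝ => C - κ * t) atTop atBot := by
        simp only [sub_eq_add_neg]
        exact tendsto_atBot_add_const_left _ _
          (tendsto_neg_atTop_atBot.comp (tendsto_id.const_mul_atTop hκ))
      simpa using (Real.tendsto_exp_atBot.comp this).const_mul ‖toComplex (x 0 - xs)‖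
    refine squeeze_zero' (Eventually.of_forall fun t => norm_nonneg _) ?_ hlim
    filter_upwards [eventually_ge_atTop 0] with t ht
    exact (norm_le_norm_toComplex _).trans
      (hest (t + 1) x K (hx.mono fun s hs => hs.1) h1 t ⟨ht, by linarith⟩)

/-- Stability would confine trajectories to a ball of nondegenerate states, so one that starts off
the equilibrium would exist for all times. The radial estimate with `s = -1` makes its distance grow
exponentially, out of that ball. -/
theorem isUnstable (h : G.Mixed xs) {θ₀ : ℝ} (hγ : 0 < G.rotation * G.gammaRg xs θ₀) :
    G.IsUnstable xs := by
  intro hst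
  obtain ⟨r₀, hr₀, κ, hκ, C, hest⟩ := h.exists_radial_estimate (s := -1) (θ₀ := θ₀) (by simp)
    (by linarith)
  obtain ⟨r, hr, hnd⟩ := h.exists_radius_nondeg
  set q := min r₀ r / 2 with hq
  have hmin : 0 < min r₀ r := lt_min hr₀ hr
  have hq0 : 0 < q := by positivity
  have hqr : q < r := by linarith [min_le_right r₀ r]
  have hqr₀ : q < r₀ := by linarith [min_le_left r₀ r]
  obtain ⟨V, hV, hstay⟩ := hst _ (eventually_norm_toComplex_lt xs hq0)
  obtain ⟨x₀, hx₀V, hx₀q, hx₀⟩ : ∃ x₀ ∈ V, ‖toComplex (x₀ - xs)‖ < q ∧ x₀ ≠ xs := by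
    have hc : Continuous fun ε : ℝ => xs + ε • phaseVec 0 := by fun_prop
    have hlim : Tendsto (fun ε : ℝ => xs + ε • phaseVec 0) (𝓝 0) (𝓝 xs) := by
      simpa using hc.tendsto 0
    have hev := hlim (inter_mem hV (eventually_norm_toComplex_lt xs hq0))
    have hev' : ∀ᶠ ε in 𝓝[>] (0 : ℝ), xs + ε • phaseVec 0 ∈
      V ∩ {x | ‖toComplex (x - xs)‖ < q} := nhdsWithin_le_nhds hev
    obtain ⟨ε, hε, hε0⟩ := (hev'.and self_mem_nhdsWithin).exists
    refine ⟨_, hε.1, hε.2, fun he => ?_⟩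
    rw [add_eq_left, smul_eq_zero] at he
    rcases he with he | he
    · exact (ne_of_gt hε0) he
    · exact phaseVec_ne_zero 0 he
  obtain ⟨x, K, hx, hx0⟩ := h.exists_global hqr hnd hx₀ hx₀q.le fun T x K hT hx hx0 t ht =>
    le_of_lt (hstay T x K hT hx (by rwa [hx0]) t ht)
  have hsub : ∀ T : ℝ, G.IsTrajectory (Set.Ico 0 T) x K := fun T => hx.mono fun s hs => hs.1
  have hgrow : ∀ t : ℝ, 0 ≤ t → κ * t ≤ Real.log q - Real.log ‖toComplex (x 0 - xs)‖ + C := by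
    intro t ht
    have hT : 0 < t + 1 := by linarith
    have hne := h.ne_of_initial_ne (hsub (t + 1)) (by rwa [hx0])
    have hb := hstay (t + 1) x K hT (hsub _) (by rwa [hx0])
    have h1 := hest (t + 1) x K (hsub _) (fun τ hτ => ⟨hne τ hτ, lt_trans (hb τ hτ) hqr₀⟩) t
      ⟨ht, by linarith⟩
    have hpos : 0 < ‖toComplex (x t - xs)‖ := norm_pos_iff.2 fun h0 =>
      hne t ⟨ht, by linarith⟩ (sub_eq_zero.1 (toComplex_eq_zero.1 h0))
    have h2 := Real.log_le_log hpos (le_of_lt (hb t ⟨ht, by linarith⟩))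
    linarith
  set E := Real.log q - Real.log ‖toComplex (x 0 - xs)‖ + C
  -- At this time the linear growth already exceeds the bound `E`.
  have h1 := hgrow ((|E| + 1) / κ) (by positivity)
  rw [mul_div_cancel₀ _ hκ.ne'] at h1
  linarith [le_abs_self E]

end Mixed

end

end LossAverseGame

theorem theorem4 (G : LossAverseGame) (hG : G.HasComplexEigenvalues)
    (xs : Fin 2 → ℝ) (hxs : G.IsNash xs)
    (h1 : G.A 0 *ᵥ xs + G.b 0 ≠ 0) (h2 : G.A 1 *ᵥ xs + G.b 1 = 0)
    (hQ : ∀ k : Mode, SignIndefinite (G.rateMatrix k 1)) (θ₀ : ℝ) :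
    (0 < G.A 0 0 1 * G.gammaRg xs θ₀ ∧ G.A 1 0 1 * G.gammaRg xs θ₀ < 0 →
      G.IsAsymptoticallyStable xs) ∧
    (G.A 0 0 1 * G.gammaRg xs θ₀ < 0 ∧ 0 < G.A 1 0 1 * G.gammaRg xs θ₀ →
      G.IsUnstable xs) := by
  have h := LossAverseGame.mixed_of hG hxs h1 h2 hQ
  have hr := h.rotation_mul_pos
  constructor
  -- Since `rotation` has the sign of `a^2_{12}`, the second inequality alone gives the sign of
  -- `rotation * γ_rg`.
  · rintro ⟨-, hγ⟩
    refine h.isAsymptoticallyStable hxs (θ₀ := θ₀) ?_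
    have := mul_neg_of_pos_of_neg hr hγ
    nlinarith [sq_nonneg (G.A 1 0 1)]
  · rintro ⟨-, hγ⟩
    refine h.isUnstable (θ₀ := θ₀) ?_
    have := mul_pos hr hγ
    nlinarith [sq_nonneg (G.A 1 0 1)]
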